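/- Let $M$ be a smooth manifold (Hausdorff, paracompact) with a smooth foliation $\mathcal F$ with leaves of dimension $p$ and codimension $q$, given by a maximal atlas of distinguished charts, i.e. of diffeomorphisms from open sets of $M$ onto open sets of $\mathbb R^p\times\mathbb R^q$ whose changes of coordinates are locally of the form $(x,y)\mapsto(f(x,y),g(y))$. Let $\nabla$ be a smooth affine connection on $M$ which is torsion-free and adapted to $\mathcal F$: $\nabla_XY$ is tangent to $\mathcal F$ for every vector field $Y$ tangent to $\mathcal F$ and every vector $X$. Then every atlas $\{U_i,\varphi_i\}$ of $M$ by distinguished charts has an open refinement $\{V_l,\psi_l\}$ (each $V_l$ is contained in some $U_i$ with $\psi_l=\varphi_i|_{V_l}$, and the $V_l$ cover $M$) such that (1) each $V_l$ has compact closure; (2) $(V_l)$ is locally finite and is a good covering of $M$: for all $k\ge 1$, all $l_1,\dots,l_k$ and all $m>0$, the leafwise de Rham cohomology $H^m$ of the foliation induced by $\mathcal F$ on $V_{l_1}\cap\dots\cap V_{l_k}$ (leafwise closed $m$-forms, i.e. smooth sections of $\Lambda^mT^*\mathcal F$, modulo leafwise exact ones) is $\{0\}$; (3) the plaques of each $V_l$,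 and more generally the leaves of the foliation induced by $\mathcal F$ on each finite intersection $V_{l_1}\cap\dots\cap V_{l_k}$ ($k\ge1$), are geodesically convex: any two points of such a plaque are joined by exactly one geodesic $[0,1]\to M$ of $\nabla$ contained in the plaque. -/

import Mathlib

open Set Filter Topology Manifold ContDiff TopologicalSpace

universe u

noncomputable section

/-- The model space of foliated charts: `ℝ^p` (along the leaves) times `ℝ^q` (transverse). -/
abbrev FolModel (p q : ℕ) : Type := EuclideanSpace ℝ (Fin p) × EuclideanSpace ℝ (Fin q)

/-- The transverse coordinates of `ψ` are, near each point of the common domain, a function of the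
transverse coordinates of `φ`. -/
def TransverselyCompatible {p q : ℕ} {M : Type u} [TopologicalSpace M]
    (φ ψ : OpenPartialHomeomorph M (FolModel p q)) : Prop :=
  ∀ x ∈ φ.source ∩ ψ.source, ∃ U ∈ 𝓝 x, ∃ h : EuclideanSpace ℝ (Fin q) → EuclideanSpace ℝ (Fin q),
    ∀ y ∈ U, (ψ y).2 = h (φ y).2

/-- `φ` is a diffeomorphism from its source onto its target, an open set of `ℝ^p × ℝ^q`. -/
def IsSmoothChart {p q : ℕ} {M : Type u} [TopologicalSpace M]
    [ChartedSpace (EuclideanSpace ℝ (Fin (p + q))) M]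
    (φ : OpenPartialHomeomorph M (FolModel p q)) : Prop :=
  ContMDiffOn (𝓡 (p + q)) 𝓘(ℝ, FolModel p q) ∞ φ φ.source ∧
    ContMDiffOn 𝓘(ℝ, FolModel p q) (𝓡 (p + q)) ∞ φ.symm φ.target

/-- A smooth foliation with leaves of dimension `p` and codimension `q` on a manifold of dimension
`p + q`, given by its maximal atlas of foliated charts. The members of `charts` are the
distinguished charts. -/
structure Foliation (p q : ℕ) (M : Type u) [TopologicalSpace M]
    [ChartedSpace (EuclideanSpace ℝ (Fin (p + q))) M] where
  charts : Set (OpenPartialHomeomorph M (FolModel p q))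
  smooth : ∀ φ ∈ charts, IsSmoothChart φ
  cover : ∀ x : M, ∃ φ ∈ charts, x ∈ φ.source
  compatible : ∀ φ ∈ charts, ∀ ψ ∈ charts, TransverselyCompatible φ ψ
  maximal : ∀ χ : OpenPartialHomeomorph M (FolModel p q), IsSmoothChart χ →
    (∀ φ ∈ charts, TransverselyCompatible φ χ ∧ TransverselyCompatible χ φ) → χ ∈ charts

namespace Foliation

variable {p q : ℕ} {M : Type u} [TopologicalSpace M]
  [ChartedSpace (EuclideanSpace ℝ (Fin (p + q))) M]

/-- The differential at `x` of the transverse coordinates of a chart. -/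
def transverseDeriv (φ : OpenPartialHomeomorph M (FolModel p q)) (x : M) :
    TangentSpace (𝓡 (p + q)) x →L[ℝ] EuclideanSpace ℝ (Fin q) :=
  (ContinuousLinearMap.snd ℝ (EuclideanSpace ℝ (Fin p)) (EuclideanSpace ℝ (Fin q))).comp
    (mfderiv (𝓡 (p + q)) 𝓘(ℝ, FolModel p q) φ x :
      TangentSpace (𝓡 (p + q)) x →L[ℝ] FolModel p q)

/-- The space `T_x F` tangent to the foliation: vectors killed by the differentials of the
transverse coordinates (all distinguished charts around `x` give the same subspace). -/
def tangent (F : Foliation p q M) (x : M) : Submodule ℝ (TangentSpace (𝓡 (p + q)) x) where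
  carrier := {v | ∀ φ ∈ F.charts, x ∈ φ.source → transverseDeriv φ x v = 0}
  add_mem' := by
    intro a b ha hb φ hφ hx
    rw [map_add, ha φ hφ hx, hb φ hφ hx, add_zero]
  zero_mem' := by
    intro φ _ _
    exact map_zero _
  smul_mem' := by
    intro c a ha φ hφ hx
    rw [map_smul, ha φ hφ hx, smul_zero]

/-- A path is leafwise (continuous for the leaf topology) if, in every distinguished chart, its
transverse coordinates are locally constant. -/
def IsLeafwisePath (F : Foliation p q M) {x y : M} (γ : Path x y) : Prop :=
  ∀ φ ∈ F.charts, ∀ t, γ t ∈ φ.source → ∀ᶠ s in 𝓝 t, (φ (γ s)).2 = (φ (γ t)).2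

/-- The leaf through `y` of the foliation induced on the open set `V`: the points which can be
reached from `y` by a leafwise path inside `V`. When `V` is the domain of a distinguished chart
these leaves are the plaques of the chart. -/
def plaque (F : Foliation p q M) (V : Opens M) (y : M) : Set M :=
  {z | ∃ γ : Path y z, (∀ t, γ t ∈ V) ∧ F.IsLeafwisePath γ}

/-! ### Leafwise differential forms -/

/-- The inclusion of `ℝ^p` in `T_m M`, `m = φ⁻¹(a, b)`, by means of the coordinate fields of the
leaf coordinates of `φ`. -/
def frameAux (φ : OpenPartialHomeomorph M (FolModel p q)) (y : FolModel p q) :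
    EuclideanSpace ℝ (Fin p) →L[ℝ] TangentSpace (𝓡 (p + q)) (φ.symm y) :=
  (mfderiv 𝓘(ℝ, FolModel p q) (𝓡 (p + q)) φ.symm y :
      FolModel p q →L[ℝ] TangentSpace (𝓡 (p + q)) (φ.symm y)).comp
    (ContinuousLinearMap.inl ℝ (EuclideanSpace ℝ (Fin p)) (EuclideanSpace ℝ (Fin q)))

theorem frameAux_mem (F : Foliation p q M) {φ : OpenPartialHomeomorph M (FolModel p q)}
    (hφ : φ ∈ F.charts) {y : FolModel p q} (hy : y ∈ φ.target) (w : EuclideanSpace ℝ (Fin p)) :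
    frameAux φ y w ∈ F.tangent (φ.symm y) := by
  intro ψ hψ hx
  have hxφ : φ.symm y ∈ φ.source := φ.map_target hy
  have h1 : MDifferentiableAt 𝓘(ℝ, FolModel p q) (𝓡 (p + q)) φ.symm y :=
    (((F.smooth φ hφ).2 y hy).contMDiffAt (φ.open_target.mem_nhds hy)).mdifferentiableAt (by simp)
  have h2 : MDifferentiableAt (𝓡 (p + q)) 𝓘(ℝ, FolModel p q) ψ (φ.symm y) :=
    (((F.smooth ψ hψ).1 _ hx).contMDiffAt (ψ.open_source.mem_nhds hx)).mdifferentiableAt (by simp)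
  have h3 : HasFDerivAt (fun z : FolModel p q => ψ (φ.symm z))
      ((mfderiv (𝓡 (p + q)) 𝓘(ℝ, FolModel p q) ψ (φ.symm y)).comp
        (mfderiv 𝓘(ℝ, FolModel p q) (𝓡 (p + q)) φ.symm y) : FolModel p q →L[ℝ] FolModel p q) y :=
    (h2.hasMFDerivAt.comp y h1.hasMFDerivAt).hasFDerivAt
  have h4 : HasFDerivAt (fun a : EuclideanSpace ℝ (Fin p) => ((a, y.2) : FolModel p q))
      (ContinuousLinearMap.inl ℝ (EuclideanSpace ℝ (Fin p)) (EuclideanSpace ℝ (Fin q))) y.1 :=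
    hasFDerivAt_prodMk_left y.1 y.2
  have h5 := ((ContinuousLinearMap.snd ℝ (EuclideanSpace ℝ (Fin p))
    (EuclideanSpace ℝ (Fin q))).hasFDerivAt (x := ψ (φ.symm y))).comp y.1
      (HasFDerivAt.comp (g := fun z : FolModel p q => ψ (φ.symm z)) y.1 h3 h4)
  obtain ⟨U, hU, h, hh⟩ := F.compatible φ hφ ψ hψ _ ⟨hxφ, hx⟩
  have hc : Tendsto (fun a : EuclideanSpace ℝ (Fin p) => φ.symm ((a, y.2) : FolModel p q))
      (𝓝 y.1) (𝓝 (φ.symm y)) :=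
    (φ.continuousAt_symm hy).tendsto.comp
      (Continuous.tendsto (by fun_prop : Continuous
        fun a : EuclideanSpace ℝ (Fin p) => ((a, y.2) : FolModel p q)) y.1)
  have ht : ∀ᶠ a in 𝓝 y.1, ((a, y.2) : FolModel p q) ∈ φ.target :=
    (Continuous.tendsto (by fun_prop : Continuous
        fun a : EuclideanSpace ℝ (Fin p) => ((a, y.2) : FolModel p q)) y.1).eventually
      (φ.open_target.mem_nhds hy)
  have h6 : (fun a : EuclideanSpace ℝ (Fin p) => (ψ (φ.symm ((a, y.2) : FolModel p q))).2)
      =ᶠ[𝓝 y.1] fun _ => h y.2 := by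
    filter_upwards [hc.eventually hU, ht] with a ha hta
    rw [hh _ ha, φ.right_inv hta]
  have h7 := (hasFDerivAt_const (𝕜 := ℝ) (h y.2) y.1).congr_of_eventuallyEq h6
  exact congrArg (fun L : EuclideanSpace ℝ (Fin p) →L[ℝ] EuclideanSpace ℝ (Fin q) => L w)
    (h5.unique h7)

/-- The frame of `T F` at `φ⁻¹(y)` given by the leaf coordinates of `φ`. -/
def frame (F : Foliation p q M) {φ : OpenPartialHomeomorph M (FolModel p q)}
    (hφ : φ ∈ F.charts) {y : FolModel p q} (hy : y ∈ φ.target) :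
    EuclideanSpace ℝ (Fin p) →L[ℝ] F.tangent (φ.symm y) :=
  (frameAux φ y).codRestrict (F.tangent (φ.symm y)) (F.frameAux_mem hφ hy)

open Classical in
/-- The expression of a family of alternating forms on the tangent spaces of the leaves, over an
open set `V`, in a distinguished chart `φ`; it is extended by zero outside `φ(V)`. -/
def localRep (F : Foliation p q M) {V : Opens M} {k : ℕ}
    (θ : ∀ x : V, F.tangent (x : M) [⋀^Fin k]→L[ℝ] ℝ)
    {φ : OpenPartialHomeomorph M (FolModel p q)} (hφ : φ ∈ F.charts) (y : FolModel p q) :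
    EuclideanSpace ℝ (Fin p) [⋀^Fin k]→L[ℝ] ℝ :=
  if h : y ∈ φ.target ∧ φ.symm y ∈ V then
    (θ ⟨φ.symm y, h.2⟩).compContinuousLinearMap (F.frame hφ h.1)
  else 0

theorem localRep_add (F : Foliation p q M) {V : Opens M} {k : ℕ}
    (θ η : ∀ x : V, F.tangent (x : M) [⋀^Fin k]→L[ℝ] ℝ)
    {φ : OpenPartialHomeomorph M (FolModel p q)} (hφ : φ ∈ F.charts) :
    F.localRep (θ + η) hφ = F.localRep θ hφ + F.localRep η hφ := by
  funext y
  by_cases h : y ∈ φ.target ∧ φ.symm y ∈ V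
  · simp only [localRep, Pi.add_apply, dif_pos h]
    rfl
  · simp only [localRep, Pi.add_apply, dif_neg h, add_zero]

theorem localRep_smul (F : Foliation p q M) {V : Opens M} {k : ℕ} (c : ℝ)
    (θ : ∀ x : V, F.tangent (x : M) [⋀^Fin k]→L[ℝ] ℝ)
    {φ : OpenPartialHomeomorph M (FolModel p q)} (hφ : φ ∈ F.charts) :
    F.localRep (c • θ) hφ = c • F.localRep θ hφ := by
  funext y
  by_cases h : y ∈ φ.target ∧ φ.symm y ∈ V
  · simp only [localRep, Pi.smul_apply, dif_pos h]
    rfl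
  · simp only [localRep, Pi.smul_apply, dif_neg h, smul_zero]

theorem localRep_zero (F : Foliation p q M) {V : Opens M} {k : ℕ}
    {φ : OpenPartialHomeomorph M (FolModel p q)} (hφ : φ ∈ F.charts) :
    F.localRep (0 : ∀ x : V, F.tangent (x : M) [⋀^Fin k]→L[ℝ] ℝ) hφ = 0 := by
  have := F.localRep_smul 0 (0 : ∀ x : V, F.tangent (x : M) [⋀^Fin k]→L[ℝ] ℝ) hφ
  simpa using this

/-- Leafwise `k`-forms on `V`: smooth sections over `V` of the bundle `⋀^k T*F`, smoothness being
tested on the coefficients in the distinguished charts. -/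
def leafwiseForms (F : Foliation p q M) (V : Opens M) (k : ℕ) :
    Submodule ℝ (∀ x : V, F.tangent (x : M) [⋀^Fin k]→L[ℝ] ℝ) where
  carrier := {θ | ∀ (φ : OpenPartialHomeomorph M (FolModel p q)) (hφ : φ ∈ F.charts),
    ContDiffOn ℝ ∞ (F.localRep θ hφ) (φ.target ∩ φ.symm ⁻¹' (V : Set M))}
  add_mem' := by
    intro θ η hθ hη φ hφ
    rw [localRep_add]
    exact (hθ φ hφ).add (hη φ hφ)
  zero_mem' := by
    intro φ hφ
    rw [localRep_zero]
    exact contDiffOn_const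
  smul_mem' := by
    intro c θ hθ φ hφ
    rw [localRep_smul]
    exact contDiffOn_const.smul (hθ φ hφ)

/-- The type of leafwise `k`-forms on `V`. -/
def LeafwiseForm (F : Foliation p q M) (V : Opens M) (k : ℕ) : Type u := F.leafwiseForms V k

instance (F : Foliation p q M) (V : Opens M) (k : ℕ) : AddCommGroup (F.LeafwiseForm V k) :=
  inferInstanceAs (AddCommGroup (F.leafwiseForms V k))

instance (F : Foliation p q M) (V : Opens M) (k : ℕ) : Module ℝ (F.LeafwiseForm V k) :=
  inferInstanceAs (Module ℝ (F.leafwiseForms V k))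

/-- The expression of a leafwise form in a distinguished chart. -/
def LeafwiseForm.rep {F : Foliation p q M} {V : Opens M} {k : ℕ} (θ : F.LeafwiseForm V k)
    {φ : OpenPartialHomeomorph M (FolModel p q)} (hφ : φ ∈ F.charts) :
    FolModel p q → EuclideanSpace ℝ (Fin p) [⋀^Fin k]→L[ℝ] ℝ :=
  F.localRep (Subtype.val θ) hφ

theorem LeafwiseForm.rep_add {F : Foliation p q M} {V : Opens M} {k : ℕ}
    (θ η : F.LeafwiseForm V k) {φ : OpenPartialHomeomorph M (FolModel p q)} (hφ : φ ∈ F.charts)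
    (y : FolModel p q) : (θ + η).rep hφ y = θ.rep hφ y + η.rep hφ y :=
  congrFun (F.localRep_add (Subtype.val θ) (Subtype.val η) hφ) y

theorem LeafwiseForm.rep_smul {F : Foliation p q M} {V : Opens M} {k : ℕ} (r : ℝ)
    (θ : F.LeafwiseForm V k) {φ : OpenPartialHomeomorph M (FolModel p q)} (hφ : φ ∈ F.charts)
    (y : FolModel p q) : (r • θ).rep hφ y = r • θ.rep hφ y :=
  congrFun (F.localRep_smul r (Subtype.val θ) hφ) y

theorem LeafwiseForm.rep_zero {F : Foliation p q M} {V : Opens M} {k : ℕ}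
    {φ : OpenPartialHomeomorph M (FolModel p q)} (hφ : φ ∈ F.charts)
    (y : FolModel p q) : (0 : F.LeafwiseForm V k).rep hφ y = 0 :=
  congrFun (F.localRep_zero hφ) y

theorem LeafwiseForm.differentiableAt_slice {F : Foliation p q M} {V : Opens M} {k : ℕ}
    (θ : F.LeafwiseForm V k) {φ : OpenPartialHomeomorph M (FolModel p q)} (hφ : φ ∈ F.charts)
    {y : FolModel p q} (hy : y ∈ φ.target ∩ φ.symm ⁻¹' (V : Set M)) :
    DifferentiableAt ℝ (fun a : EuclideanSpace ℝ (Fin p) => θ.rep hφ (a, y.2)) y.1 := by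
  have ho : IsOpen (φ.target ∩ φ.symm ⁻¹' (V : Set M)) := φ.isOpen_inter_preimage_symm V.isOpen
  have h1 : DifferentiableAt ℝ (θ.rep hφ) (y.1, y.2) :=
    ((Subtype.property θ φ hφ).contDiffAt (ho.mem_nhds hy)).differentiableAt (by simp)
  have h2 : HasFDerivAt (fun a : EuclideanSpace ℝ (Fin p) => ((a, y.2) : FolModel p q))
      (ContinuousLinearMap.inl ℝ (EuclideanSpace ℝ (Fin p)) (EuclideanSpace ℝ (Fin q))) y.1 :=
    hasFDerivAt_prodMk_left y.1 y.2
  exact (h1.hasFDerivAt.comp y.1 h2).differentiableAt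

/-- The graph of the leafwise exterior derivative `d_F`, from leafwise `k`-forms to leafwise
`(k+1)`-forms on `V`: a pair `(θ, η)` belongs to it when `η = d_F θ`, that is when, in each
distinguished chart, `η` restricted to each slice `{transverse coordinates = const}` is the usual
exterior derivative of `θ` restricted to that slice. -/
def leafwiseDeriv (F : Foliation p q M) (V : Opens M) (k : ℕ) :
    Submodule ℝ (F.LeafwiseForm V k × F.LeafwiseForm V (k + 1)) where
  carrier := {c | ∀ (φ : OpenPartialHomeomorph M (FolModel p q)) (hφ : φ ∈ F.charts),
    ∀ y ∈ φ.target ∩ φ.symm ⁻¹' (V : Set M),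
      c.2.rep hφ y = extDeriv (fun a : EuclideanSpace ℝ (Fin p) => c.1.rep hφ (a, y.2)) y.1}
  add_mem' := by
    intro c c' hc hc' φ hφ y hy
    simp only [Prod.fst_add, Prod.snd_add, LeafwiseForm.rep_add]
    rw [hc φ hφ y hy, hc' φ hφ y hy]
    exact (extDeriv_fun_add (c.1.differentiableAt_slice hφ hy)
      (c'.1.differentiableAt_slice hφ hy)).symm
  zero_mem' := by
    intro φ hφ y _
    simp only [Prod.fst_zero, Prod.snd_zero, LeafwiseForm.rep_zero]
    have h := extDeriv_smul (x := y.1) (0 : ℝ)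
      (fun _ : EuclideanSpace ℝ (Fin p) => (0 : EuclideanSpace ℝ (Fin p) [⋀^Fin k]→L[ℝ] ℝ))
    rw [zero_smul, zero_smul] at h
    exact h.symm
  smul_mem' := by
    intro r c hc φ hφ y hy
    simp only [Prod.smul_fst, Prod.smul_snd, LeafwiseForm.rep_smul]
    rw [hc φ hφ y hy]
    exact (extDeriv_smul (x := y.1) r
      (fun a : EuclideanSpace ℝ (Fin p) => c.1.rep hφ (a, y.2))).symm

/-- Leafwise closed `k`-forms on `V`. -/
def closedForms (F : Foliation p q M) (V : Opens M) (k : ℕ) :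
    Submodule ℝ (F.LeafwiseForm V k) :=
  (F.leafwiseDeriv V k).comap (LinearMap.inl ℝ _ _)

/-- Leafwise exact `k`-forms on `V`. -/
def exactForms (F : Foliation p q M) (V : Opens M) :
    (k : ℕ) → Submodule ℝ (F.LeafwiseForm V k)
  | 0 => ⊥
  | k + 1 => (F.leafwiseDeriv V k).map (LinearMap.snd ℝ _ _)

/-- The leafwise de Rham cohomology (closed forms modulo exact forms) in degree `k` of the
foliation induced on the open set `V`. -/
abbrev LeafwiseCohomology (F : Foliation p q M) (V : Opens M) (k : ℕ) : Type u :=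
  F.closedForms V k ⧸ (F.exactForms V k).submoduleOf (F.closedForms V k)

/-- A locally finite open covering is good if all the higher leafwise cohomology of the finite
(nonempty) intersections of its members vanishes. -/
structure IsGoodCovering (F : Foliation p q M) {Λ : Type u} (V : Λ → Opens M) : Prop where
  covers : ∀ x : M, ∃ l, x ∈ V l
  locallyFinite : LocallyFinite fun l => (V l : Set M)
  acyclic : ∀ S : Finset Λ, S.Nonempty → ∀ k : ℕ, 0 < k →
    Subsingleton (F.LeafwiseCohomology (S.inf V) k)

/-- An affine connection is adapted to `F` when `∇_X Y` is tangent to `F` for every vector field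
`Y` tangent to `F` and every vector `X`, i.e. parallel transport preserves `T F`. -/
def IsAdapted (F : Foliation p q M) [IsManifold (𝓡 (p + q)) ∞ M]
    (cov : CovariantDerivative (𝓡 (p + q)) (EuclideanSpace ℝ (Fin (p + q)))
      (TangentSpace (𝓡 (p + q)) : M → Type _)) : Prop :=
  ∀ Y : ∀ x : M, TangentSpace (𝓡 (p + q)) x,
    ContMDiff (𝓡 (p + q)) (𝓡 (p + q)).tangent ∞
      (fun x => (⟨x, Y x⟩ : TangentBundle (𝓡 (p + q)) M)) →
    (∀ x, Y x ∈ F.tangent x) →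
    ∀ (x : M) (X : TangentSpace (𝓡 (p + q)) x), cov Y x X ∈ F.tangent x

end Foliation

/-! ### Geodesics of an affine connection -/

section Geodesics

variable {n : ℕ} {M : Type u} [TopologicalSpace M] [ChartedSpace (EuclideanSpace ℝ (Fin n)) M]
  [IsManifold (𝓡 n) ∞ M]

/-- The vector field with constant components `v` in the chart at `x₀` (on its domain). -/
def coordField (x₀ : M) (v : EuclideanSpace ℝ (Fin n)) (x : M) : TangentSpace (𝓡 n) x :=
  VectorField.mpullback (𝓡 n) 𝓘(ℝ, EuclideanSpace ℝ (Fin n)) (extChartAt (𝓡 n) x₀)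
    (fun _ => v) x

/-- The Christoffel symbols, at `x`, in the chart at `x₀`: the bilinear expression
`(v, w) ↦ ∑ Γ^k_{ij} v^i w^j`, that is the components of `∇_v w` for `v`, `w` of constant
components. -/
def christoffel
    (cov : CovariantDerivative (𝓡 n) (EuclideanSpace ℝ (Fin n))
      (TangentSpace (𝓡 n) : M → Type _))
    (x₀ x : M) (v w : EuclideanSpace ℝ (Fin n)) : EuclideanSpace ℝ (Fin n) :=
  mfderiv (𝓡 n) 𝓘(ℝ, EuclideanSpace ℝ (Fin n)) (extChartAt (𝓡 n) x₀) x
    (cov (coordField x₀ w) x (coordField x₀ v x))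

/-- `γ` restricted to `[0,1]` is a geodesic: it is `C²` and satisfies in all charts of the atlas
the geodesic equation `c'' + Γ(c', c') = 0` (hence it is smooth). Values of `γ` outside `[0,1]`
are irrelevant. -/
def IsGeodesicSegment
    (cov : CovariantDerivative (𝓡 n) (EuclideanSpace ℝ (Fin n))
      (TangentSpace (𝓡 n) : M → Type _)) (γ : ℝ → M) : Prop :=
  ContMDiffOn 𝓘(ℝ, ℝ) (𝓡 n) 2 γ (Icc 0 1) ∧
    ∀ t ∈ Icc (0 : ℝ) 1, ∀ x₀ : M, γ t ∈ (extChartAt (𝓡 n) x₀).source →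
      let c : ℝ → EuclideanSpace ℝ (Fin n) := fun s => extChartAt (𝓡 n) x₀ (γ s)
      let c' : ℝ → EuclideanSpace ℝ (Fin n) := derivWithin c (Icc 0 1)
      derivWithin c' (Icc 0 1) t + christoffel cov x₀ (γ t) (c' t) (c' t) = 0

/-- `γ` restricted to `[0,1]` is a geodesic from `a` to `b` which stays in `S`. -/
def IsGeodesicFromToIn
    (cov : CovariantDerivative (𝓡 n) (EuclideanSpace ℝ (Fin n))
      (TangentSpace (𝓡 n) : M → Type _)) (S : Set M) (a b : M) (γ : ℝ → M) : Prop :=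
  IsGeodesicSegment cov γ ∧ γ 0 = a ∧ γ 1 = b ∧ ∀ t ∈ Icc (0 : ℝ) 1, γ t ∈ S

/-- A set is geodesically convex when any two of its points are joined by exactly one geodesic
`[0,1] → S` inside the set. -/
def IsGeodesicallyConvex
    (cov : CovariantDerivative (𝓡 n) (EuclideanSpace ℝ (Fin n))
      (TangentSpace (𝓡 n) : M → Type _)) (S : Set M) : Prop :=
  ∀ a ∈ S, ∀ b ∈ S, ∃ γ : ℝ → M, IsGeodesicFromToIn cov S a b γ ∧
    ∀ γ' : ℝ → M, IsGeodesicFromToIn cov S a b γ' → EqOn γ' γ (Icc 0 1)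

end Geodesics

/-- The open set on which a chart is defined. -/
def chartDomain {p q : ℕ} {M : Type u} [TopologicalSpace M]
    (φ : OpenPartialHomeomorph M (FolModel p q)) : Opens M :=
  ⟨φ.source, φ.open_source⟩

end

/-! The members of the covering are boxes: preimages, under the given charts, of small balls of
`FolModel p q`. The norm of this product is the maximum of the two Euclidean norms, so each nonempty
slice of such a ball is a round ball of `ℝ^p`. As the connection is adapted, its Christoffel symbols
map pairs of leaf directions to leaf directions. A curve inside a slice is therefore a geodesic
exactly when its leaf coordinates solve `c'' + Γ(c', c') = 0`, an equation in `ℝ^p` with the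
transverse coordinate as a parameter.

For a single box the argument is Whitehead's. If the radius is small compared with bounds on `Γ`,
two points of a ball are joined by exactly one solution inside it
(`exists_unique_geodesicCurve_in_ball`). Existence is a contraction argument on velocities. The
solution stays in the ball because the squared distance to the centre is convex along it
(`norm_sub_lt_of_acceleration_le`). Uniqueness holds because an a priori bound places the velocity
of every solution in the domain of the contraction. The radius works for all slices at once
(`exists_radius_isGeodesicallyConvex_slab`).

For intersections the boxes, which come from different charts, are chosen so that all those
containing a given point lie in one larger box with geodesically convex slices
(`exists_locallyFinite_adapted_cover`). Uniqueness in the larger box forces the geodesics supplied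
by the smaller ones to coincide, so the common geodesic lies in the intersection
(`isGeodesicallyConvex_plaque`).

For the cohomology, the convexity inequality is used again, now for straight segments: read in
another chart, a segment along a slice has acceleration controlled by its squared velocity. Hence
small boxes have affinely convex slices in the chart of the larger box
(`exists_radius_convex_slices`). This property passes to intersections. It identifies their plaques
with slices, and a smooth choice of centres together with the Poincaré lemma with parameters makes
closed leafwise forms of positive degree exact (`subsingleton_of_convex_slices`). -/

/-! ### Convexity of small balls for second order equations -/

section ConvexBall

variable {E : Type*} [NormedAddCommGroup E] [InnerProductSpace ℝ E]

/-- A curve whose acceleration is small compared with its squared velocity and which has its end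
points in a small ball stays in the ball. -/
theorem norm_sub_lt_of_acceleration_le {c v a : ℝ → E} {x₀ : E} {r C : ℝ}
    (hc : ∀ t ∈ Icc (0 : ℝ) 1, HasDerivWithinAt c (v t) (Icc 0 1) t)
    (hv : ∀ t ∈ Icc (0 : ℝ) 1, HasDerivWithinAt v (a t) (Icc 0 1) t)
    (ha : ∀ t ∈ Icc (0 : ℝ) 1, ‖a t‖ ≤ C * ‖v t‖ ^ 2)
    (hC : ∀ t ∈ Icc (0 : ℝ) 1, ‖c t - x₀‖ * C ≤ 1)
    (h0 : ‖c 0 - x₀‖ < r) (h1 : ‖c 1 - x₀‖ < r) :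
    ∀ t ∈ Icc (0 : ℝ) 1, ‖c t - x₀‖ < r := by
  have hr : 0 < r := (norm_nonneg _).trans_lt h0
  -- The second derivative of the squared distance is `2 (‖v‖² + ⟨c - x₀, a⟩)`. The two bounds on
  -- `a` and `c - x₀` make the inner product at least `-‖v‖²`.
  have hconv : ConvexOn ℝ (Icc (0 : ℝ) 1) (fun t => inner ℝ (c t - x₀) (c t - x₀)) := by
    have hcx : ∀ t ∈ Icc (0 : ℝ) 1, HasDerivWithinAt (fun t => c t - x₀) (v t) (Icc 0 1) t :=
      fun t ht => (hc t ht).sub_const x₀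
    have h1 : ∀ t ∈ Icc (0 : ℝ) 1, HasDerivWithinAt (fun t => inner ℝ (c t - x₀) (c t - x₀))
        (inner ℝ (c t - x₀) (v t) + inner ℝ (v t) (c t - x₀)) (Icc 0 1) t :=
      fun t ht => (hcx t ht).inner ℝ (hcx t ht)
    have h2 : ∀ t ∈ Icc (0 : ℝ) 1,
        HasDerivWithinAt (fun t => inner ℝ (c t - x₀) (v t) + inner ℝ (v t) (c t - x₀))
        ((inner ℝ (c t - x₀) (a t) + inner ℝ (v t) (v t)) +
          (inner ℝ (v t) (v t) + inner ℝ (a t) (c t - x₀))) (Icc 0 1) t :=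
      fun t ht => ((hcx t ht).inner ℝ (hv t ht)).add ((hv t ht).inner ℝ (hcx t ht))
    refine convexOn_of_hasDerivWithinAt2_nonneg (convex_Icc 0 1)
      (fun t ht => (h1 t ht).continuousWithinAt) (f' := fun t =>
        inner ℝ (c t - x₀) (v t) + inner ℝ (v t) (c t - x₀)) (f'' := fun t =>
        ((inner ℝ (c t - x₀) (a t) + inner ℝ (v t) (v t)) +
          (inner ℝ (v t) (v t) + inner ℝ (a t) (c t - x₀)))) ?_ ?_ ?_
    · intro t ht
      exact (h1 t (interior_subset ht)).mono interior_subset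
    · intro t ht
      exact (h2 t (interior_subset ht)).mono interior_subset
    · intro t ht
      have ht := interior_subset ht
      have hi : |inner ℝ (c t - x₀) (a t)| ≤ ‖v t‖ ^ 2 := by
        calc |inner ℝ (c t - x₀) (a t)| ≤ ‖c t - x₀‖ * ‖a t‖ := abs_real_inner_le_norm _ _
          _ ≤ ‖c t - x₀‖ * (C * ‖v t‖ ^ 2) := by gcongr; exact ha t ht
          _ = (‖c t - x₀‖ * C) * ‖v t‖ ^ 2 := by ring
          _ ≤ 1 * ‖v t‖ ^ 2 := by gcongr; exact hC t ht
          _ = ‖v t‖ ^ 2 := one_mul _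
      rw [real_inner_comm (c t - x₀) (a t), real_inner_self_eq_norm_sq]
      linarith [neg_abs_le (inner ℝ (c t - x₀) (a t))]
  intro t ht
  have := hconv.le_max_of_mem_Icc (left_mem_Icc.2 zero_le_one) (right_mem_Icc.2 zero_le_one) ht
  simp only [real_inner_self_eq_norm_sq] at this
  refine lt_of_pow_lt_pow_left₀ 2 hr.le (this.trans_lt (max_lt ?_ ?_))
  · gcongr
  · gcongr

end ConvexBall

/-! ### The geodesic equation as a two-point boundary value problem. -/

section GeodesicODE

variable {E : Type*} [NormedAddCommGroup E] [NormedSpace ℝ E]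

/-- `c` solves `c'' + Γ(c)(c', c') = 0` on `[0,1]`, with velocity `v`. -/
structure IsGeodesicCurve (Γ : E → E →L[ℝ] E →L[ℝ] E) (c v : ℝ → E) : Prop where
  hasDeriv : ∀ t ∈ Icc (0 : ℝ) 1, HasDerivWithinAt c (v t) (Icc 0 1) t
  hasDeriv_velocity : ∀ t ∈ Icc (0 : ℝ) 1,
    HasDerivWithinAt v (-(Γ (c t) (v t) (v t))) (Icc 0 1) t

/-- A-priori bound of the velocity of a geodesic which stays in a small ball. -/
theorem IsGeodesicCurve.norm_velocity_le {Γ : E → E →L[ℝ] E →L[ℝ] E} {c v : ℝ → E} {K r : ℝ}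
    {x₀ : E} (h : IsGeodesicCurve Γ c v) (hK : 0 ≤ K)
    (hΓ : ∀ t ∈ Icc (0 : ℝ) 1, ‖Γ (c t)‖ ≤ K)
    (hr : 16 * (K * r) < 1) (hc : ∀ t ∈ Icc (0 : ℝ) 1, c t ∈ Metric.ball x₀ r) :
    ∀ t ∈ Icc (0 : ℝ) 1, ‖v t‖ ≤ 8 * r := by
  have hvc : ContinuousOn v (Icc 0 1) := fun t ht => (h.hasDeriv_velocity t ht).continuousWithinAt
  obtain ⟨t₀, ht₀, hmax⟩ := isCompact_Icc.exists_isMaxOn (nonempty_Icc.2 zero_le_one)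
    hvc.norm
  intro t ht
  refine (hmax ht).trans ?_
  simp only
  set m := ‖v t₀‖ with hm
  have hm0 : 0 ≤ m := norm_nonneg _
  by_contra! hlt
  have hr0 : 0 ≤ r := by
    have := hc 0 (left_mem_Icc.2 zero_le_one)
    rw [Metric.mem_ball] at this
    exact dist_nonneg.trans this.le
  have hmpos : 0 < m := by linarith
  -- the estimate over a time `τ`
  have key : ∀ τ : ℝ, 0 ≤ τ → τ ≤ 1 / 2 → m * τ ≤ 2 * r + K * m ^ 2 * τ ^ 2 := by
    intro τ hτ hτ2
    -- Since `τ ≤ 1/2`, at least one of `t₀ + τ` and `t₀ - τ` is still in `[0,1]`.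
    obtain ⟨t₁, ht₁, habs⟩ : ∃ t₁ ∈ Icc (0 : ℝ) 1, |t₁ - t₀| = τ := by
      by_cases h2 : t₀ ≤ 1 / 2
      · exact ⟨t₀ + τ, ⟨by linarith [ht₀.1], by linarith⟩, by simp [abs_of_nonneg hτ]⟩
      · exact ⟨t₀ - τ, ⟨by linarith, by linarith [ht₀.2]⟩, by simp [abs_of_nonneg hτ]⟩
    have hsub : uIcc t₀ t₁ ⊆ Icc (0 : ℝ) 1 := uIcc_subset_Icc ht₀ ht₁
    have hdist : ∀ s ∈ uIcc t₀ t₁, |s - t₀| ≤ τ := fun s hs => by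
      rw [← habs]; exact abs_sub_left_of_mem_uIcc hs
    have hv1 : ∀ s ∈ uIcc t₀ t₁, ‖v s - v t₀‖ ≤ K * m ^ 2 * τ := by
      intro s hs
      have := (convex_uIcc t₀ t₁).norm_image_sub_le_of_norm_hasDerivWithin_le (C := K * m ^ 2)
        (f := v) (f' := fun t => -(Γ (c t) (v t) (v t)))
        (fun x hx => (h.hasDeriv_velocity x (hsub hx)).mono hsub) (fun x hx => by
          rw [norm_neg]
          calc ‖Γ (c x) (v x) (v x)‖ ≤ ‖Γ (c x)‖ * ‖v x‖ * ‖v x‖ :=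
                ContinuousLinearMap.le_opNorm₂ _ _ _
            _ ≤ K * m * m := by
                have hx' : ‖v x‖ ≤ m := hmax (hsub hx)
                gcongr
                exact hΓ x (hsub hx)
            _ = K * m ^ 2 := by ring) left_mem_uIcc hs
      refine this.trans ?_
      rw [Real.norm_eq_abs]
      gcongr
      exact hdist s hs
    -- Comparison with the uniform motion of velocity `v t₀`: the curve departs from it by at most
    -- `K m² τ²`, while the ball allows a displacement of at most `2 r`.
    have hc1 := (convex_uIcc t₀ t₁).norm_image_sub_le_of_norm_hasDerivWithin_le
        (C := K * m ^ 2 * τ)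
        (f := fun s => c s - s • v t₀) (f' := fun s => v s - (1 : ℝ) • v t₀)
        (fun x hx => ((h.hasDeriv x (hsub hx)).mono hsub).sub
          ((hasDerivWithinAt_id x _).smul_const (v t₀)))
        (fun x hx => by simpa using hv1 x hx) left_mem_uIcc right_mem_uIcc
    rw [Real.norm_eq_abs, habs] at hc1
    have hcc : ‖c t₁ - c t₀‖ ≤ 2 * r := by
      have ha := hc t₁ ht₁
      have hb := hc t₀ ht₀
      rw [mem_ball_iff_norm] at ha hb
      calc ‖c t₁ - c t₀‖ = ‖(c t₁ - x₀) - (c t₀ - x₀)‖ := by congr 1; abel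
        _ ≤ _ := norm_sub_le _ _
        _ ≤ 2 * r := by linarith
    have e : (t₁ - t₀) • v t₀ = (c t₁ - c t₀) - ((c t₁ - t₁ • v t₀) - (c t₀ - t₀ • v t₀)) := by
      rw [sub_smul]; abel
    have : ‖(t₁ - t₀) • v t₀‖ = m * τ := by
      rw [norm_smul, Real.norm_eq_abs, habs, mul_comm]
    rw [← this, e]
    refine (norm_sub_le _ _).trans ?_
    nlinarith
  -- The gain `m τ - K m² τ²` is largest at `τ = 1 / (2 K m)`, which is admissible when `K m ≥ 1`;
  -- otherwise the best choice is `τ = 1/2`. The first case contradicts `8 r < m`, the second `16 K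
  -- r < 1`.
  rcases le_or_gt (K * m) 1 with h1 | h1
  · have := key (1 / 2) (by norm_num) le_rfl
    have hm' : K * m ^ 2 ≤ m := by nlinarith
    nlinarith
  · have hKpos : 0 < K := by
      by_contra! hK0
      nlinarith
    have hKm : 0 < K * m := by positivity
    have := key (1 / (2 * (K * m))) (by positivity) (by
      rw [div_le_div_iff₀ (by positivity) (by norm_num)]; linarith)
    have e1 : m * (1 / (2 * (K * m))) = 1 / (2 * K) := by field_simp
    have e2 : K * m ^ 2 * (1 / (2 * (K * m))) ^ 2 = 1 / (4 * K) := by field_simp; norm_num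
    rw [e1, e2] at this
    have e3 : 1 / (2 * K) - 1 / (4 * K) = 1 / (4 * K) := by field_simp; norm_num
    have h4 : 1 / (4 * K) ≤ 2 * r := by linarith
    rw [div_le_iff₀ (by positivity)] at h4
    nlinarith

/-- The curve with velocity `v` starting at `a`. -/
noncomputable def curveOfVelocity (a : E) (v : C(Icc (0 : ℝ) 1, E)) (s : ℝ) : E :=
  a + ∫ τ in (0 : ℝ)..s, IccExtend zero_le_one v τ

theorem norm_integral_IccExtend_le (v : C(Icc (0 : ℝ) 1, E)) {s C : ℝ} (hs : s ∈ Icc (0 : ℝ) 1)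
    (hC : ∀ t, ‖v t‖ ≤ C) : ‖∫ τ in (0 : ℝ)..s, IccExtend zero_le_one v τ‖ ≤ C := by
  have h0 : 0 ≤ C := (norm_nonneg _).trans (hC ⟨0, left_mem_Icc.2 zero_le_one⟩)
  have := intervalIntegral.norm_integral_le_of_norm_le_const (a := 0) (b := s) (C := C)
    (f := IccExtend zero_le_one v) (fun t _ => hC _)
  refine this.trans ?_
  rw [sub_zero, abs_of_nonneg hs.1]
  nlinarith [hs.2]

theorem curveOfVelocity_sub (a : E) (v w : C(Icc (0 : ℝ) 1, E)) (s : ℝ) :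
    curveOfVelocity a v s - curveOfVelocity a w s =
      ∫ τ in (0 : ℝ)..s, IccExtend zero_le_one (v - w) τ := by
  have hv : Continuous (IccExtend zero_le_one v) := v.continuous.Icc_extend'
  have hw : Continuous (IccExtend zero_le_one w) := w.continuous.Icc_extend'
  rw [curveOfVelocity, curveOfVelocity, add_sub_add_left_eq_sub,
    ← intervalIntegral.integral_sub (hv.intervalIntegrable _ _) (hw.intervalIntegrable _ _)]
  rfl

variable [CompleteSpace E]

theorem hasDerivAt_curveOfVelocity (a : E) (v : C(Icc (0 : ℝ) 1, E)) (s : ℝ) :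
    HasDerivAt (curveOfVelocity a v) (IccExtend zero_le_one v s) s := by
  have hv : Continuous (IccExtend zero_le_one v) := v.continuous.Icc_extend'
  exact (intervalIntegral.integral_hasDerivAt_right (hv.intervalIntegrable _ _)
    (hv.stronglyMeasurableAtFilter _ _) hv.continuousAt).const_add a

/-- The acceleration prescribed by the geodesic equation along the curve of velocity `v`. -/
noncomputable def geodesicAcceleration {Γ : E → E →L[ℝ] E →L[ℝ] E} (hΓ : Continuous Γ) (a : E)
    (v : C(Icc (0 : ℝ) 1, E)) : C(Icc (0 : ℝ) 1, E) where
  toFun s := -(Γ (curveOfVelocity a v s) (v s) (v s))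
  continuous_toFun := by
    have h1 : Continuous (curveOfVelocity a v) :=
      continuous_iff_continuousAt.2 fun s => (hasDerivAt_curveOfVelocity a v s).continuousAt
    exact (((hΓ.comp (h1.comp continuous_subtype_val)).clm_apply v.continuous).clm_apply
      v.continuous).neg

/-- The operator whose fixed points are the velocities of the geodesics from `a` to `b`. -/
noncomputable def geodesicOperator {Γ : E → E →L[ℝ] E →L[ℝ] E} (hΓ : Continuous Γ) (a b : E)
    (v : C(Icc (0 : ℝ) 1, E)) : C(Icc (0 : ℝ) 1, E) where
  -- The constant is adjusted so that the integral over `[0,1]` is `b - a`: the curve from `a` with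
  -- this velocity ends at `b`.
  toFun t := (b - a) - (∫ τ in (0 : ℝ)..1, curveOfVelocity 0 (geodesicAcceleration hΓ a v) τ) +
    curveOfVelocity 0 (geodesicAcceleration hΓ a v) t
  continuous_toFun := by
    have h1 : Continuous (curveOfVelocity 0 (geodesicAcceleration hΓ a v)) :=
      continuous_iff_continuousAt.2 fun s => (hasDerivAt_curveOfVelocity _ _ s).continuousAt
    exact continuous_const.add (h1.comp continuous_subtype_val)

theorem continuous_curveOfVelocity (a : E) (v : C(Icc (0 : ℝ) 1, E)) :
    Continuous (curveOfVelocity a v) :=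
  continuous_iff_continuousAt.2 fun s => (hasDerivAt_curveOfVelocity a v s).continuousAt

/-- The factor 2 comes from two terms of norm at most `C`: the primitive of the acceleration and its
mean over `[0,1]`. -/
theorem norm_geodesicOperator_sub_le {Γ : E → E →L[ℝ] E →L[ℝ] E} (hΓ : Continuous Γ) (a b : E)
    (v : C(Icc (0 : ℝ) 1, E)) {C : ℝ} (hC : ∀ t, ‖geodesicAcceleration hΓ a v t‖ ≤ C) (t) :
    ‖geodesicOperator hΓ a b v t - (b - a)‖ ≤ 2 * C := by
  have h1 : ∀ s ∈ Icc (0 : ℝ) 1, ‖curveOfVelocity 0 (geodesicAcceleration hΓ a v) s‖ ≤ C :=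
    fun s hs => by
      rw [curveOfVelocity, zero_add]
      exact norm_integral_IccExtend_le _ hs hC
  have h2 : ‖∫ τ in (0 : ℝ)..1, curveOfVelocity 0 (geodesicAcceleration hΓ a v) τ‖ ≤ C := by
    have := intervalIntegral.norm_integral_le_of_norm_le_const (a := 0) (b := 1) (C := C)
      (f := curveOfVelocity 0 (geodesicAcceleration hΓ a v)) (fun t ht => h1 t (by
        rw [uIoc_of_le zero_le_one] at ht; exact Ioc_subset_Icc_self ht))
    simpa using this
  have e : geodesicOperator hΓ a b v t - (b - a) =
    curveOfVelocity 0 (geodesicAcceleration hΓ a v) t -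
      ∫ τ in (0 : ℝ)..1, curveOfVelocity 0 (geodesicAcceleration hΓ a v) τ := by
    simp only [geodesicOperator, ContinuousMap.coe_mk]; abel
  rw [e]
  refine (norm_sub_le _ _).trans ?_
  linarith [h1 t t.2]

/-- The term `b - a` cancels, so only the differences of the primitives and of their means remain;
this reduces the contraction property to a Lipschitz estimate of the acceleration. -/
theorem norm_geodesicOperator_sub_geodesicOperator_le {Γ : E → E →L[ℝ] E →L[ℝ] E}
    (hΓ : Continuous Γ) (a b : E) (v w : C(Icc (0 : ℝ) 1, E)) {C : ℝ}
    (hC : ∀ t, ‖geodesicAcceleration hΓ a v t - geodesicAcceleration hΓ a w t‖ ≤ C) (t) :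
    ‖geodesicOperator hΓ a b v t - geodesicOperator hΓ a b w t‖ ≤ 2 * C := by
  have h1 : ∀ s ∈ Icc (0 : ℝ) 1, ‖curveOfVelocity 0 (geodesicAcceleration hΓ a v) s -
      curveOfVelocity 0 (geodesicAcceleration hΓ a w) s‖ ≤ C :=
    fun s hs => by
      rw [curveOfVelocity_sub]
      exact norm_integral_IccExtend_le _ hs hC
  have h2 : ‖(∫ τ in (0 : ℝ)..1, curveOfVelocity 0 (geodesicAcceleration hΓ a v) τ) -
      ∫ τ in (0 : ℝ)..1, curveOfVelocity 0 (geodesicAcceleration hΓ a w) τ‖ ≤ C := by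
    rw [← intervalIntegral.integral_sub
      ((continuous_curveOfVelocity _ _).intervalIntegrable _ _)
      ((continuous_curveOfVelocity _ _).intervalIntegrable _ _)]
    have := intervalIntegral.norm_integral_le_of_norm_le_const (a := 0) (b := 1) (C := C)
      (f := fun τ => curveOfVelocity 0 (geodesicAcceleration hΓ a v) τ -
        curveOfVelocity 0 (geodesicAcceleration hΓ a w) τ) (fun t ht => h1 t (by
        rw [uIoc_of_le zero_le_one] at ht; exact Ioc_subset_Icc_self ht))
    simpa using this
  have e : geodesicOperator hΓ a b v t - geodesicOperator hΓ a b w t =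
    (curveOfVelocity 0 (geodesicAcceleration hΓ a v) t -
      curveOfVelocity 0 (geodesicAcceleration hΓ a w) t) -
      ((∫ τ in (0 : ℝ)..1, curveOfVelocity 0 (geodesicAcceleration hΓ a v) τ) -
      ∫ τ in (0 : ℝ)..1, curveOfVelocity 0 (geodesicAcceleration hΓ a w) τ) := by
    simp only [geodesicOperator, ContinuousMap.coe_mk]; abel
  rw [e]
  refine (norm_sub_le _ _).trans ?_
  linarith [h1 t t.2]

/-- A fixed point of the operator is the velocity of a geodesic. -/
theorem isGeodesicCurve_of_fixedPoint {Γ : E → E →L[ℝ] E →L[ℝ] E} (hΓ : Continuous Γ) {a b : E}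
    {v : C(Icc (0 : ℝ) 1, E)} (hv : geodesicOperator hΓ a b v = v) :
    IsGeodesicCurve Γ (curveOfVelocity a v) (IccExtend zero_le_one v) ∧
      curveOfVelocity a v 0 = a ∧ curveOfVelocity a v 1 = b := by
  have hval : ∀ t ∈ Icc (0 : ℝ) 1, IccExtend zero_le_one v t = (b - a) -
      (∫ τ in (0 : ℝ)..1, curveOfVelocity 0 (geodesicAcceleration hΓ a v) τ) +
    curveOfVelocity 0 (geodesicAcceleration hΓ a v) t := by
    intro t ht
    rw [IccExtend_of_mem _ _ ht]
    conv_lhs => rw [← hv]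
    rfl
  refine ⟨⟨fun t _ => (hasDerivAt_curveOfVelocity a v t).hasDerivWithinAt, fun t ht => ?_⟩,
    by simp [curveOfVelocity], ?_⟩
  · have h1 := ((hasDerivAt_curveOfVelocity 0 (geodesicAcceleration hΓ a v) t).const_add
      ((b - a) - ∫ τ in (0 : ℝ)..1,
        curveOfVelocity 0 (geodesicAcceleration hΓ a v) τ)).hasDerivWithinAt (s := Icc 0 1)
    have h2 := h1.congr hval (hval t ht)
    convert h2 using 1
    rw [IccExtend_of_mem _ _ ht, IccExtend_of_mem _ _ ht]
    rfl
  · rw [curveOfVelocity, intervalIntegral.integral_congr (g := fun t => (b - a) -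
      (∫ τ in (0 : ℝ)..1, curveOfVelocity 0 (geodesicAcceleration hΓ a v) τ) +
      curveOfVelocity 0 (geodesicAcceleration hΓ a v) t)
      (fun t ht => hval t (by rwa [uIcc_of_le zero_le_one] at ht)),
      intervalIntegral.integral_add (by simp)
        ((continuous_curveOfVelocity _ _).intervalIntegrable _ _)]
    simp

/-- The velocity of a geodesic is a fixed point of the operator. -/
theorem IsGeodesicCurve.fixedPoint {Γ : E → E →L[ℝ] E →L[ℝ] E} (hΓ : Continuous Γ)
    {c v : ℝ → E} (h : IsGeodesicCurve Γ c v) :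
    ∃ w : C(Icc (0 : ℝ) 1, E), (∀ t, w t = v t) ∧
      (∀ t ∈ Icc (0 : ℝ) 1, curveOfVelocity (c 0) w t = c t) ∧
      geodesicOperator hΓ (c 0) (c 1) w = w := by
  have hvc : ContinuousOn v (Icc 0 1) := fun t ht => (h.hasDeriv_velocity t ht).continuousWithinAt
  let w : C(Icc (0 : ℝ) 1, E) := ⟨fun t => v t, hvc.domRestrict⟩
  -- A primitive on `[0,1]` is determined by its initial value. This is applied twice, to the curve
  -- and then to its velocity.
  have hprim : ∀ (g : ℝ → E) (u : C(Icc (0 : ℝ) 1, E)),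
      (∀ t ∈ Icc (0 : ℝ) 1, HasDerivWithinAt g (IccExtend zero_le_one u t) (Icc 0 1) t) →
      ∀ t ∈ Icc (0 : ℝ) 1, curveOfVelocity (g 0) u t = g t := by
    intro g u hg t ht
    have hd : ∀ x ∈ Icc (0 : ℝ) 1,
        HasDerivWithinAt (fun s => curveOfVelocity (g 0) u s - g s) 0 (Icc 0 1) x := by
      intro x hx
      have h2 := (hasDerivAt_curveOfVelocity (g 0) u x).hasDerivWithinAt.sub (hg x hx)
      rw [sub_self] at h2
      exact h2
    have := (convex_Icc (0 : ℝ) 1).norm_image_sub_le_of_norm_hasDerivWithin_le (C := 0) hd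
      (by simp) (left_mem_Icc.2 zero_le_one) ht
    simp only [zero_mul, norm_le_zero_iff] at this
    rw [sub_eq_zero] at this
    have h0 : curveOfVelocity (g 0) u 0 = g 0 := by simp [curveOfVelocity]
    rw [h0, sub_self, sub_eq_zero] at this
    exact this
  have hcw : ∀ t ∈ Icc (0 : ℝ) 1, curveOfVelocity (c 0) w t = c t := by
    refine hprim c w fun t ht => ?_
    rw [IccExtend_of_mem _ _ ht]
    exact h.hasDeriv t ht
  have hacc : ∀ t ∈ Icc (0 : ℝ) 1,
      curveOfVelocity (v 0) (geodesicAcceleration hΓ (c 0) w) t = v t := by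
    refine hprim v _ fun t ht => ?_
    rw [IccExtend_of_mem _ _ ht]
    have := h.hasDeriv_velocity t ht
    simp only [geodesicAcceleration, ContinuousMap.coe_mk]
    rw [hcw t ht]
    exact this
  have hacc' : ∀ t ∈ Icc (0 : ℝ) 1,
      curveOfVelocity 0 (geodesicAcceleration hΓ (c 0) w) t = v t - v 0 := by
    intro t ht
    rw [← hacc t ht, curveOfVelocity, curveOfVelocity]
    abel
  refine ⟨w, fun t => rfl, hcw, ?_⟩
  ext t
  simp only [geodesicOperator, ContinuousMap.coe_mk]
  have hint : (∫ τ in (0 : ℝ)..1, curveOfVelocity 0 (geodesicAcceleration hΓ (c 0) w) τ) =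
      (c 1 - c 0) - v 0 := by
    have h1 := hcw 1 (right_mem_Icc.2 zero_le_one)
    rw [curveOfVelocity] at h1
    have hw : Continuous (IccExtend zero_le_one w) := w.continuous.Icc_extend'
    rw [intervalIntegral.integral_congr (g := fun t => IccExtend zero_le_one w t - v 0)
      (fun t ht => by
        rw [uIcc_of_le zero_le_one] at ht
        simp only
        rw [hacc' t ht, IccExtend_of_mem _ _ ht]; rfl),
      intervalIntegral.integral_sub (hw.intervalIntegrable _ _) (by simp), ← h1]
    simp
  rw [hint, hacc' t t.2]
  change _ = v t
  abel

end GeodesicODE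

/-- In a small ball, any two points are joined by exactly one solution of the geodesic equation,
with a radius depending only on bounds of the Christoffel symbols. -/
theorem exists_unique_geodesicCurve_in_ball {E : Type*} [NormedAddCommGroup E]
    [InnerProductSpace ℝ E] [CompleteSpace E] {Γ : E → E →L[ℝ] E →L[ℝ] E} {K L : NNReal}
    (hK : ∀ x, ‖Γ x‖ ≤ K) (hL : LipschitzWith L Γ) {r : ℝ} (hr : 128 * (K + L + 1) * r ≤ 1)
    {x₀ a b : E} (ha : a ∈ Metric.ball x₀ r) (hb : b ∈ Metric.ball x₀ r) :
    (∃ c v : ℝ → E, IsGeodesicCurve Γ c v ∧ c 0 = a ∧ c 1 = b ∧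
      ∀ t ∈ Icc (0 : ℝ) 1, c t ∈ Metric.ball x₀ r) ∧
    ∀ c v c' v' : ℝ → E, IsGeodesicCurve Γ c v → IsGeodesicCurve Γ c' v' →
      c 0 = a → c 1 = b → c' 0 = a → c' 1 = b → (∀ t ∈ Icc (0 : ℝ) 1, c t ∈ Metric.ball x₀ r) →
      (∀ t ∈ Icc (0 : ℝ) 1, c' t ∈ Metric.ball x₀ r) → EqOn c' c (Icc 0 1) := by
  have hΓ : Continuous Γ := hL.continuous
  have hr0 : 0 < r := Metric.pos_of_mem_ball ha
  have hK0 : (0 : ℝ) ≤ K := K.2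
  have hL0 : (0 : ℝ) ≤ L := L.2
  have hKr0 : 0 ≤ (K : ℝ) * r := by positivity
  have hLr0 : 0 ≤ (L : ℝ) * r := by positivity
  have hKr : (K : ℝ) * r ≤ 1 / 128 := by nlinarith
  have hLr : (L : ℝ) * r ≤ 1 / 128 := by nlinarith
  have hr1 : r ≤ 1 / 128 := by nlinarith
  have hab : ‖b - a‖ ≤ 2 * r := by
    rw [mem_ball_iff_norm] at ha hb
    calc ‖b - a‖ = ‖(b - x₀) - (a - x₀)‖ := by congr 1; abel
      _ ≤ _ := norm_sub_le _ _
      _ ≤ 2 * r := by linarith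
  -- The radius `8 r` is the a priori bound of `norm_velocity_le`, so this ball contains the
  -- velocities of all solutions that stay in the ball of radius `r`.
  let s : Set C(Icc (0 : ℝ) 1, E) := Metric.closedBall 0 (8 * r)
  have hs : ∀ v, v ∈ s ↔ ∀ t, ‖v t‖ ≤ 8 * r := fun v => by
    rw [mem_closedBall_zero_iff, ContinuousMap.norm_le _ (by positivity)]
  have hmaps : MapsTo (geodesicOperator hΓ a b) s s := by
    intro v hv
    rw [hs] at hv ⊢
    intro t
    have h1 : ∀ t, ‖geodesicAcceleration hΓ a v t‖ ≤ K * (8 * r) * (8 * r) := by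
      intro t
      simp only [geodesicAcceleration, ContinuousMap.coe_mk, norm_neg]
      refine (ContinuousLinearMap.le_opNorm₂ _ _ _).trans ?_
      gcongr
      · exact hK _
      · exact hv t
      · exact hv t
    have h2 := norm_geodesicOperator_sub_le hΓ a b v h1 t
    have h3 : ‖geodesicOperator hΓ a b v t‖ ≤
        ‖geodesicOperator hΓ a b v t - (b - a)‖ + ‖b - a‖ := by
      simpa using norm_add_le (geodesicOperator hΓ a b v t - (b - a)) (b - a)
    nlinarith
  have hlip : ∀ v ∈ s, ∀ w ∈ s, ‖geodesicOperator hΓ a b v - geodesicOperator hΓ a b w‖ ≤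
      1 / 2 * ‖v - w‖ := by
    intro v hv w hw
    rw [hs] at hv hw
    rw [ContinuousMap.norm_le _ (by positivity)]
    intro t
    have hvw : ∀ t, ‖v t - w t‖ ≤ ‖v - w‖ := fun t => (v - w).norm_coe_le_norm t
    have h1 : ∀ t, ‖geodesicAcceleration hΓ a v t - geodesicAcceleration hΓ a w t‖ ≤
        1 / 4 * ‖v - w‖ := by
      intro t
      have hcv : ‖curveOfVelocity a v t - curveOfVelocity a w t‖ ≤ ‖v - w‖ := by
        rw [curveOfVelocity_sub]
        exact norm_integral_IccExtend_le _ t.2 hvw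
      have e : geodesicAcceleration hΓ a v t - geodesicAcceleration hΓ a w t =
          -((Γ (curveOfVelocity a v t) - Γ (curveOfVelocity a w t)) (v t) (v t) +
          (Γ (curveOfVelocity a w t) (v t - w t) (v t) +
            Γ (curveOfVelocity a w t) (w t) (v t - w t))) := by
        simp only [geodesicAcceleration, ContinuousMap.coe_mk, sub_apply,
          map_sub]
        abel
      rw [e, norm_neg]
      have n1 : ‖(Γ (curveOfVelocity a v t) - Γ (curveOfVelocity a w t)) (v t) (v t)‖ ≤
          (L * ‖v - w‖) * (8 * r) * (8 * r) := by
        refine (ContinuousLinearMap.le_opNorm₂ _ _ _).trans ?_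
        have := hL.norm_sub_le (curveOfVelocity a v t) (curveOfVelocity a w t)
        gcongr
        · exact this.trans (by gcongr)
        · exact hv t
        · exact hv t
      have n2 : ‖Γ (curveOfVelocity a w t) (v t - w t) (v t)‖ ≤ K * ‖v - w‖ * (8 * r) := by
        refine (ContinuousLinearMap.le_opNorm₂ _ _ _).trans ?_
        gcongr
        · exact hK _
        · exact hvw t
        · exact hv t
      have n3 : ‖Γ (curveOfVelocity a w t) (w t) (v t - w t)‖ ≤ K * (8 * r) * ‖v - w‖ := by
        refine (ContinuousLinearMap.le_opNorm₂ _ _ _).trans ?_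
        gcongr
        · exact hK _
        · exact hw t
        · exact hvw t
      refine (norm_add_le _ _).trans ((add_le_add n1 ((norm_add_le _ _).trans
        (add_le_add n2 n3))).trans ?_)
      -- The constant 128 in the hypothesis makes this at most `1/4`; doubled by the operator, it
      -- gives the contraction factor `1/2`.
      have : 64 * ((L : ℝ) * r) * r + 16 * (K * r) ≤ 1 / 4 := by nlinarith
      calc _ = (64 * ((L : ℝ) * r) * r + 16 * (K * r)) * ‖v - w‖ := by ring
        _ ≤ _ := by gcongr
    have := norm_geodesicOperator_sub_geodesicOperator_le hΓ a b v w h1 t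
    rw [ContinuousMap.sub_apply]
    linarith
  constructor
  · have hcontr : ContractingWith (1 / 2) (hmaps.restrict (geodesicOperator hΓ a b) s s) := by
      refine ⟨by norm_num, LipschitzWith.of_dist_le_mul fun v w => ?_⟩
      have := hlip v v.2 w w.2
      rw [Subtype.dist_eq, dist_eq_norm, Subtype.dist_eq, dist_eq_norm]
      simpa using this
    obtain ⟨v, hv, hfix, -⟩ := hcontr.exists_fixedPoint' (Metric.isClosed_closedBall.isComplete)
      hmaps (x := 0) (by simp [s, hr0.le]) (edist_ne_top _ _)
    obtain ⟨hgeo, h0, h1⟩ := isGeodesicCurve_of_fixedPoint hΓ hfix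
    refine ⟨_, _, hgeo, h0, h1, fun t ht => ?_⟩
    rw [mem_ball_iff_norm]
    refine norm_sub_lt_of_acceleration_le (C := K) hgeo.hasDeriv hgeo.hasDeriv_velocity
      (fun t ht => ?_) (fun t ht => ?_) ?_ ?_ t ht
    · rw [norm_neg]
      refine (ContinuousLinearMap.le_opNorm₂ _ _ _).trans ?_
      rw [sq, ← mul_assoc]
      gcongr
      exact hK _
    -- The fixed point is first only known to stay within `9 r` of the centre. This is close enough
    -- for the convexity argument, which brings it back to the ball of radius `r`.
    · have h2 : ‖curveOfVelocity a v t - x₀‖ ≤ 9 * r := by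
        have h3 := norm_integral_IccExtend_le v ht ((hs v).1 hv)
        rw [mem_ball_iff_norm] at ha
        calc ‖curveOfVelocity a v t - x₀‖
            = ‖(a - x₀) + ∫ τ in (0 : ℝ)..t, IccExtend zero_le_one v τ‖ := by
              rw [curveOfVelocity]; congr 1; abel
          _ ≤ _ := norm_add_le _ _
          _ ≤ 9 * r := by linarith
      nlinarith
    · rw [h0]; exact mem_ball_iff_norm.1 ha
    · rw [h1]; exact mem_ball_iff_norm.1 hb
  -- Both velocities are fixed points lying in `s`, hence equal by contraction.
  · intro c v c' v' h h' h0 h1 h0' h1' hc hc'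
    have hv := h.norm_velocity_le hK0 (fun t _ => hK _) (by linarith) hc
    have hv' := h'.norm_velocity_le hK0 (fun t _ => hK _) (by linarith) hc'
    obtain ⟨w, hw, hcw, hfix⟩ := h.fixedPoint hΓ
    obtain ⟨w', hw', hcw', hfix'⟩ := h'.fixedPoint hΓ
    rw [h0, h1] at hfix
    rw [h0', h1'] at hfix'
    have := hlip w ((hs w).2 fun t => by rw [hw]; exact hv t t.2) w'
      ((hs w').2 fun t => by rw [hw']; exact hv' t t.2)
    rw [hfix, hfix'] at this
    have hww : w = w' := by
      rw [← sub_eq_zero, ← norm_le_zero_iff]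
      linarith [norm_nonneg (w - w')]
    intro t ht
    rw [← hcw t ht, ← hcw' t ht, hww, h0, h0']

/-! ### Smooth dependence of integrals on parameters -/

section ParametricIntegral

/-- Compactness of `[0,1]` and the tube lemma turn a bound over one parameter into a bound over
nearby parameters. It provides the domination needed to pass to limits and derivatives under the
integral. -/
theorem exists_bound_of_continuousOn_prod {H E : Type*} [TopologicalSpace H] [NormedAddCommGroup E]
    {G : H × ℝ → E} {O : Set (H × ℝ)} (hO : IsOpen O) (hG : ContinuousOn G O) {x : H}
    (hx : ∀ s ∈ Icc (0 : ℝ) 1, (x, s) ∈ O) :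
    ∃ C : ℝ, ∃ U ∈ 𝓝 x, ∀ y ∈ U, ∀ s ∈ Icc (0 : ℝ) 1, (y, s) ∈ O ∧ ‖G (y, s)‖ ≤ C := by
  have hsub : ({x} : Set H) ×ˢ Icc (0 : ℝ) 1 ⊆ O := by
    rintro ⟨y, s⟩ ⟨hy, hs⟩
    rw [mem_singleton_iff] at hy
    subst hy
    exact hx s hs
  have hcomp : IsCompact (({x} : Set H) ×ˢ Icc (0 : ℝ) 1) := isCompact_singleton.prod isCompact_Icc
  obtain ⟨C, hC⟩ := hcomp.exists_bound_of_continuousOn (hG.mono hsub)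
  -- The bound is relaxed to the strict inequality `< C + 1` to obtain an open condition.
  have hopen : IsOpen (O ∩ (fun p => ‖G p‖) ⁻¹' Iio (C + 1)) :=
    hG.norm.isOpen_inter_preimage hO isOpen_Iio
  obtain ⟨u, v, hu, -, hxu, hv, huv⟩ := generalized_tube_lemma isCompact_singleton
    (isCompact_Icc (a := (0 : ℝ)) (b := 1)) hopen (s := ({x} : Set H)) (fun p hp =>
      ⟨hsub hp, by simp only [mem_preimage, mem_Iio]; linarith [hC p hp]⟩)
  refine ⟨C + 1, u, hu.mem_nhds (hxu rfl), fun y hy s hs => ?_⟩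
  have := huv (mk_mem_prod hy (hv hs))
  exact ⟨this.1, this.2.le⟩

variable {H : Type u} [NormedAddCommGroup H] [NormedSpace ℝ H]

theorem continuousOn_slice {H E : Type*} [TopologicalSpace H] [TopologicalSpace E]
    {G : H × ℝ → E} {O : Set (H × ℝ)}
    (hG : ContinuousOn G O) {x : H}
    (hx : ∀ s ∈ Icc (0 : ℝ) 1, (x, s) ∈ O) : ContinuousOn (fun s => G (x, s)) (Icc (0 : ℝ) 1) :=
  hG.comp (by fun_prop) hx

theorem aestronglyMeasurable_slice {H E : Type*} [TopologicalSpace H]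
    [NormedAddCommGroup E] {G : H × ℝ → E}
    {O : Set (H × ℝ)} (hG : ContinuousOn G O) {x : H}
    (hx : ∀ s ∈ Icc (0 : ℝ) 1, (x, s) ∈ O) :
    MeasureTheory.AEStronglyMeasurable (fun s => G (x, s))
      (MeasureTheory.volume.restrict (uIoc (0 : ℝ) 1)) := by
  rw [uIoc_of_le zero_le_one]
  exact ((continuousOn_slice hG hx).mono Ioc_subset_Icc_self).aestronglyMeasurable
    measurableSet_Ioc

theorem continuousOn_parametric_integral {H E : Type*} [NormedAddCommGroup H]
    [NormedAddCommGroup E] [NormedSpace ℝ E] {G : H × ℝ → E} {O : Set (H × ℝ)} {U : Set H}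
    (hO : IsOpen O)
    (hUO : ∀ x ∈ U, ∀ s ∈ Icc (0 : ℝ) 1, (x, s) ∈ O) (hG : ContinuousOn G O) :
    ContinuousOn (fun x => ∫ s in (0 : ℝ)..1, G (x, s)) U := by
  intro x hx
  obtain ⟨C, W, hW, hC⟩ := exists_bound_of_continuousOn_prod hO hG (hUO x hx)
  refine (intervalIntegral.continuousAt_of_dominated_interval (bound := fun _ => C)
    ?_ ?_ (by simp) ?_).continuousWithinAt
  · filter_upwards [hW] with y hy
    exact aestronglyMeasurable_slice hG fun s hs => (hC y hy s hs).1
  · filter_upwards [hW] with y hy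
    refine MeasureTheory.ae_of_all _ fun s hs => ?_
    rw [uIoc_of_le zero_le_one] at hs
    exact (hC y hy s (Ioc_subset_Icc_self hs)).2
  · refine MeasureTheory.ae_of_all _ fun s hs => ?_
    rw [uIoc_of_le zero_le_one] at hs
    have h1 : ContinuousAt G (x, s) :=
      hG.continuousAt (hO.mem_nhds (hUO x hx s (Ioc_subset_Icc_self hs)))
    exact ContinuousAt.comp (f := fun y => (y, s)) h1 (by fun_prop)

/-- Differentiation under the integral sign. -/
theorem hasFDerivAt_parametric_integral {E : Type*} [NormedAddCommGroup E] [NormedSpace ℝ E]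
    {F : H × ℝ → E} {O : Set (H × ℝ)} (hO : IsOpen O) {x : H}
    (hx : ∀ s ∈ Icc (0 : ℝ) 1, (x, s) ∈ O) (hF : ContDiffOn ℝ 1 F O) :
    HasFDerivAt (fun x => ∫ s in (0 : ℝ)..1, F (x, s))
      (∫ s in (0 : ℝ)..1, (fderiv ℝ F (x, s)).comp (ContinuousLinearMap.inl ℝ H ℝ)) x := by
  have hF' : ContinuousOn
      (fun p : H × ℝ => (fderiv ℝ F p).comp (ContinuousLinearMap.inl ℝ H ℝ)) O :=
    (hF.continuousOn_fderiv_of_isOpen hO le_rfl).clm_comp continuousOn_const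
  obtain ⟨C, W, hW, hC⟩ := exists_bound_of_continuousOn_prod hO hF' hx
  refine intervalIntegral.hasFDerivAt_integral_of_dominated_of_fderiv_le
    (F := fun x s => F (x, s))
    (F' := fun x s => (fderiv ℝ F (x, s)).comp (ContinuousLinearMap.inl ℝ H ℝ))
    (bound := fun _ => C) hW ?_ ?_ ?_ ?_ (by simp) ?_
  · filter_upwards [hW] with y hy
    exact aestronglyMeasurable_slice hF.continuousOn fun s hs => (hC y hy s hs).1
  · refine (ContinuousOn.intervalIntegrable ?_)
    rw [uIcc_of_le zero_le_one]
    exact continuousOn_slice hF.continuousOn hx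
  · exact aestronglyMeasurable_slice hF' hx
  · refine MeasureTheory.ae_of_all _ fun s hs y hy => ?_
    rw [uIoc_of_le zero_le_one] at hs
    exact (hC y hy s (Ioc_subset_Icc_self hs)).2
  · refine MeasureTheory.ae_of_all _ fun s hs y hy => ?_
    rw [uIoc_of_le zero_le_one] at hs
    have h1 : HasFDerivAt F (fderiv ℝ F (y, s)) (y, s) :=
      ((hF.contDiffAt (hO.mem_nhds (hC y hy s (Ioc_subset_Icc_self hs)).1)).differentiableAt
        (by simp)).hasFDerivAt
    exact HasFDerivAt.comp (g := F) (f := fun y => (y, s)) y h1 (hasFDerivAt_prodMk_left y s)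

/-- Induction by differentiating under the integral. The target space is quantified inside the
induction because the derivative takes values in `H →L[ℝ] E`, which must lie in the same universe as
`E`. -/
theorem contDiffOn_parametric_integral_nat (n : ℕ) {O : Set (H × ℝ)} {U : Set H} (hO : IsOpen O)
    (hU : IsOpen U) (hUO : ∀ x ∈ U, ∀ s ∈ Icc (0 : ℝ) 1, (x, s) ∈ O) :
    ∀ {E : Type u} [NormedAddCommGroup E] [NormedSpace ℝ E] {F : H × ℝ → E},
    ContDiffOn ℝ n F O →
    ContDiffOn ℝ n (fun x => ∫ s in (0 : ℝ)..1, F (x, s)) U := by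
  induction n with
  | zero =>
    intro E _ _ F hF
    rw [Nat.cast_zero, contDiffOn_zero] at hF ⊢
    exact continuousOn_parametric_integral hO hUO hF
  | succ n ih =>
    intro E _ _ F hF
    have h1 : ContDiffOn ℝ 1 F O := hF.of_le (by simp)
    have hd : ∀ x ∈ U, HasFDerivAt (fun x => ∫ s in (0 : ℝ)..1, F (x, s))
      (∫ s in (0 : ℝ)..1, (fderiv ℝ F (x, s)).comp (ContinuousLinearMap.inl ℝ H ℝ)) x :=
      fun x hx => hasFDerivAt_parametric_integral hO (hUO x hx) h1
    rw [Nat.cast_add, Nat.cast_one] at hF ⊢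
    rw [contDiffOn_succ_iff_fderiv_of_isOpen hO] at hF
    rw [contDiffOn_succ_iff_fderiv_of_isOpen hU]
    refine ⟨fun x hx => (hd x hx).differentiableAt.differentiableWithinAt,
      fun h => absurd h (by simp), ?_⟩
    have h2 := ih (F := fun p : H × ℝ => (fderiv ℝ F p).comp (ContinuousLinearMap.inl ℝ H ℝ))
      (hF.2.2.clm_comp contDiffOn_const)
    exact h2.congr fun x hx => (hd x hx).fderiv

/-- An integral over `[0,1]` depends smoothly on parameters. -/
theorem contDiffOn_parametric_integral {O : Set (H × ℝ)} {U : Set H} (hO : IsOpen O)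
    (hU : IsOpen U) (hUO : ∀ x ∈ U, ∀ s ∈ Icc (0 : ℝ) 1, (x, s) ∈ O)
    {E : Type u} [NormedAddCommGroup E] [NormedSpace ℝ E] {F : H × ℝ → E}
    (hF : ContDiffOn ℝ ∞ F O) :
    ContDiffOn ℝ ∞ (fun x => ∫ s in (0 : ℝ)..1, F (x, s)) U :=
  contDiffOn_infty.2 fun n => contDiffOn_parametric_integral_nat n hO hU hUO
    (contDiffOn_infty.1 hF n)

end ParametricIntegral

/-! ### The Poincaré lemma with parameters -/

section Poincare

open ContinuousAlternatingMap

variable {E : Type u} [NormedAddCommGroup E] [NormedSpace ℝ E]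

/-- Currying of alternating forms as a continuous linear map. -/
noncomputable def curryLeftCLM (E : Type*) [NormedAddCommGroup E] [NormedSpace ℝ E] (k : ℕ) :
    (E [⋀^Fin (k + 1)]→L[ℝ] ℝ) →L[ℝ] (E →L[ℝ] E [⋀^Fin k]→L[ℝ] ℝ) :=
  (curryLeftLI (𝕜 := ℝ) (E := E) (F := ℝ) (n := k)).toContinuousLinearMap

theorem hasFDerivAt_curryLeftCLM {k : ℕ} (β : E [⋀^Fin (k + 1)]→L[ℝ] ℝ) :
    HasFDerivAt (fun β : E [⋀^Fin (k + 1)]→L[ℝ] ℝ => curryLeftCLM E k β) (curryLeftCLM E k) β :=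
  ContinuousLinearMap.hasFDerivAt _

theorem contDiff_curryLeftCLM {k : ℕ} {n : WithTop ℕ∞} :
    ContDiff ℝ n (fun β : E [⋀^Fin (k + 1)]→L[ℝ] ℝ => curryLeftCLM E k β) :=
  ContinuousLinearMap.contDiff _

/-- The integrand of the homotopy operator contracting to `c`. -/
noncomputable def homotopyIntegrand {k : ℕ} (α : E → E [⋀^Fin (k + 1)]→L[ℝ] ℝ) (c u : E) (s : ℝ) :
    E [⋀^Fin k]→L[ℝ] ℝ :=
  s ^ k • (α (c + s • (u - c))).curryLeft (u - c)

/-- Evaluate the vanishing alternation on `(x, v₀, …, v_k)`: the term of index 0 is `D x v`, and in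
all others `x` occupies the first slot with the sign shifted by one. This is the pointwise algebra
behind Cartan's formula for a closed form. -/
theorem alternatizeUncurryFin_curryLeft_apply {k : ℕ} (D : E →L[ℝ] E [⋀^Fin (k + 1)]→L[ℝ] ℝ)
    (hD : alternatizeUncurryFin D = 0) (x : E) (L : E →L[ℝ] E [⋀^Fin k]→L[ℝ] ℝ)
    (hL : ∀ v, L v = (D v).curryLeft x) : alternatizeUncurryFin L = D x := by
  ext v
  have h := congrArg (fun A => A (Matrix.vecCons x v)) hD
  rw [alternatizeUncurryFin_apply, Fin.sum_univ_succ, ContinuousAlternatingMap.coe_zero,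
    Pi.zero_apply] at h
  rw [alternatizeUncurryFin_apply]
  simp only [Fin.val_zero, pow_zero, one_smul, Matrix.cons_val_zero, Fin.val_succ,
    Matrix.cons_val_succ] at h
  have e0 : Fin.removeNth 0 (Matrix.vecCons x v) = v := by
    ext i; simp [Fin.removeNth]
  have ei : ∀ i : Fin (k + 1), Fin.removeNth i.succ (Matrix.vecCons x v) =
      Matrix.vecCons x (Fin.removeNth i v) := by
    intro i
    ext j
    refine Fin.cases ?_ (fun j => ?_) j
    · simp [Fin.removeNth]
    · simp [Fin.removeNth]
  rw [e0] at h
  rw [← sub_eq_zero, ← neg_eq_zero, ← h, neg_sub, sub_eq_add_neg, ← Finset.sum_neg_distrib]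
  congr 1
  refine Finset.sum_congr rfl fun i _ => ?_
  rw [ei, hL, curryLeft_apply_apply, pow_succ]
  simp

theorem hasFDerivAt_homotopyIntegrand {k : ℕ} {α : E → E [⋀^Fin (k + 1)]→L[ℝ] ℝ} {c u : E} {s : ℝ}
    {D : E →L[ℝ] E [⋀^Fin (k + 1)]→L[ℝ] ℝ} (hα : HasFDerivAt α D (c + s • (u - c))) :
    HasFDerivAt (fun u => homotopyIntegrand α c u s)
      (s ^ k • ((α (c + s • (u - c))).curryLeft +
        (((curryLeftCLM E k).comp (s • D)).flip (u - c)))) u := by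
  have h1 : HasFDerivAt (fun u : E => c + s • (u - c)) (s • ContinuousLinearMap.id ℝ E) u :=
    (((hasFDerivAt_id u).sub_const c).const_smul s).const_add c
  have h2 : HasFDerivAt (fun u => (curryLeftCLM E k) (α (c + s • (u - c))))
      ((curryLeftCLM E k).comp (D.comp (s • ContinuousLinearMap.id ℝ E))) u :=
    HasFDerivAt.comp (g := fun β => curryLeftCLM E k β) u
      (hasFDerivAt_curryLeftCLM (α (c + s • (u - c)))) (hα.comp u h1)
  have h3 := (h2.clm_apply ((hasFDerivAt_id u).sub_const c)).const_smul (s ^ k)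
  refine h3.congr_fderiv ?_
  ext v
  simp [curryLeftCLM]

/-- Cartan's formula for the radial contraction. The right-hand side is the derivative with respect
to `s` of `s ^ (k + 1) • α (c + s • (u - c))`. -/
theorem alternatizeUncurryFin_fderiv_homotopyIntegrand {k : ℕ}
    {α : E → E [⋀^Fin (k + 1)]→L[ℝ] ℝ} {c u : E} {s : ℝ}
    (hα : DifferentiableAt ℝ α (c + s • (u - c))) (hd : extDeriv α (c + s • (u - c)) = 0) :
    alternatizeUncurryFin (fderiv ℝ (fun u => homotopyIntegrand α c u s) u) =
      ((k + 1 : ℕ) * s ^ k) • α (c + s • (u - c)) +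
        s ^ (k + 1) • fderiv ℝ α (c + s • (u - c)) (u - c) := by
  rw [(hasFDerivAt_homotopyIntegrand hα.hasFDerivAt).fderiv, alternatizeUncurryFin_smul,
    alternatizeUncurryFin_add, alternatizeUncurryFin_curryLeft]
  have hd' : alternatizeUncurryFin (s • fderiv ℝ α (c + s • (u - c))) = 0 := by
    rw [alternatizeUncurryFin_smul]
    rw [extDeriv] at hd
    rw [hd, smul_zero]
  rw [alternatizeUncurryFin_curryLeft_apply (s • fderiv ℝ α (c + s • (u - c))) hd' (u - c) _
    (fun v => rfl)]
  rw [smul_add, _root_.smul_apply, smul_smul, ← pow_succ, ← Nat.cast_smul_eq_nsmul ℝ,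
    smul_smul, mul_comm]

theorem ContinuousLinearMap.integral_zero_one_comp_comm {A B : Type*} [NormedAddCommGroup A]
    [NormedSpace ℝ A] [CompleteSpace A] [NormedAddCommGroup B] [NormedSpace ℝ B] [CompleteSpace B]
    (L : A →L[ℝ] B) {f : ℝ → A} (hf : ContinuousOn f (Icc 0 1)) :
    ∫ s in (0 : ℝ)..1, L (f s) = L (∫ s in (0 : ℝ)..1, f s) :=
  L.intervalIntegral_comp_comm
    (ContinuousOn.intervalIntegrable (by rwa [uIcc_of_le zero_le_one]))

/-- The homotopy formula: on a set which is star-shaped around `c`, a closed form is the exterior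
derivative of its image under the homotopy operator. -/
theorem extDeriv_integral_homotopyIntegrand [FiniteDimensional ℝ E] {k : ℕ}
    {α : E → E [⋀^Fin (k + 1)]→L[ℝ] ℝ} {U : Set E} (hU : IsOpen U) {c u : E}
    (hα : ContDiffOn ℝ ∞ α U) (hd : ∀ x ∈ U, extDeriv α x = 0)
    (hu : ∀ s ∈ Icc (0 : ℝ) 1, c + s • (u - c) ∈ U) :
    extDeriv (fun u => ∫ s in (0 : ℝ)..1, homotopyIntegrand α c u s) u = α u := by
  let O : Set (E × ℝ) := (fun p : E × ℝ => c + p.2 • (p.1 - c)) ⁻¹' U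
  have hO : IsOpen O := hU.preimage (by fun_prop)
  have hF : ContDiffOn ℝ ∞ (fun p : E × ℝ => homotopyIntegrand α c p.1 p.2) O := by
    have h1 : ContDiffOn ℝ ∞ (fun p : E × ℝ => α (c + p.2 • (p.1 - c))) O :=
      hα.comp (ContDiff.contDiffOn (by fun_prop)) (fun p hp => hp)
    have h2 : ContDiffOn ℝ ∞ (fun p : E × ℝ =>
        (curryLeftCLM E k) (α (c + p.2 • (p.1 - c)))) O :=
      contDiff_curryLeftCLM.comp_contDiffOn h1
    have h3 : ContDiffOn ℝ ∞ (fun p : E × ℝ => p.2 ^ k) O := by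
      exact (contDiff_snd.pow k).contDiffOn
    have h4 : ContDiffOn ℝ ∞ (fun p : E × ℝ => p.1 - c) O :=
      (contDiff_fst.sub contDiff_const).contDiffOn
    exact h3.smul (h2.clm_apply h4)
  have hder := hasFDerivAt_parametric_integral hO (x := u) hu (hF.of_le (by simp))
  have hslice : ∀ s ∈ Icc (0 : ℝ) 1,
      (fderiv ℝ (fun p : E × ℝ => homotopyIntegrand α c p.1 p.2) (u, s)).comp
        (ContinuousLinearMap.inl ℝ E ℝ) = fderiv ℝ (fun u => homotopyIntegrand α c u s) u := by
    intro s hs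
    have h1 := ((hF.contDiffAt (hO.mem_nhds (x := (u, s)) (hu s hs))).differentiableAt
      (by simp)).hasFDerivAt
    exact (HasFDerivAt.comp (g := fun p : E × ℝ => homotopyIntegrand α c p.1 p.2)
      (f := fun y => (y, s)) u h1 (hasFDerivAt_prodMk_left u s)).fderiv.symm
  have hαd : ∀ s ∈ Icc (0 : ℝ) 1, DifferentiableAt ℝ α (c + s • (u - c)) := fun s hs =>
    (hα.contDiffAt (hU.mem_nhds (hu s hs))).differentiableAt (by simp)
  have hcont' : ContinuousOn
      (fun s : ℝ => (fderiv ℝ (fun p : E × ℝ => homotopyIntegrand α c p.1 p.2) (u, s)).comp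
        (ContinuousLinearMap.inl ℝ E ℝ)) (Icc 0 1) :=
    continuousOn_slice (G := fun p => (fderiv ℝ (fun p : E × ℝ =>
        homotopyIntegrand α c p.1 p.2) p).comp (ContinuousLinearMap.inl ℝ E ℝ))
      ((hF.continuousOn_fderiv_of_isOpen hO (by simp)).clm_comp continuousOn_const) hu
  rw [extDeriv, hder.fderiv, ← alternatizeUncurryFinCLM_apply]
  refine (ContinuousLinearMap.integral_zero_one_comp_comm (A := E →L[ℝ] E [⋀^Fin k]→L[ℝ] ℝ)
    (B := E [⋀^Fin (k + 1)]→L[ℝ] ℝ) (alternatizeUncurryFinCLM ℝ E ℝ) hcont').symm.trans ?_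
  -- The integrand is thus an exact derivative. Its primitive vanishes at `s = 0`, since the
  -- exponent is positive, and equals `α u` at `s = 1`.
  have hval : ∀ s ∈ uIcc (0 : ℝ) 1, HasDerivAt (fun s : ℝ => s ^ (k + 1) • α (c + s • (u - c)))
      (alternatizeUncurryFinCLM ℝ E ℝ
        ((fderiv ℝ (fun p : E × ℝ => homotopyIntegrand α c p.1 p.2) (u, s)).comp
        (ContinuousLinearMap.inl ℝ E ℝ))) s := by
    intro s hs
    rw [uIcc_of_le zero_le_one] at hs
    rw [hslice s hs, alternatizeUncurryFinCLM_apply,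
      alternatizeUncurryFin_fderiv_homotopyIntegrand (hαd s hs) (hd _ (hu s hs))]
    have h1 : HasDerivAt (fun s : ℝ => c + s • (u - c)) (u - c) s := by
      simpa using ((hasDerivAt_id s).smul_const (u - c)).const_add c
    have h2 := (hαd s hs).hasFDerivAt.comp_hasDerivAt s h1
    have h3 := (hasDerivAt_pow (k + 1) s).smul h2
    exact h3.congr_deriv (add_comm _ _)
  rw [intervalIntegral.integral_eq_sub_of_hasDerivAt hval]
  · simp
  · refine ContinuousOn.intervalIntegrable ?_
    rw [uIcc_of_le zero_le_one]
    exact (alternatizeUncurryFinCLM ℝ E ℝ).continuous.comp_continuousOn hcont'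

variable {T : Type u} [NormedAddCommGroup T] [NormedSpace ℝ T]

/-- The homotopy operator depends smoothly on parameters. -/
theorem contDiffOn_integral_homotopyIntegrand {k : ℕ} {α : E × T → E [⋀^Fin (k + 1)]→L[ℝ] ℝ}
    {U : Set (E × T)} (hU : IsOpen U) (hα : ContDiffOn ℝ ∞ α U) {c : T → E}
    (hc : ContDiffOn ℝ ∞ c (Prod.snd '' U))
    (hstar : ∀ z ∈ U, ∀ s ∈ Icc (0 : ℝ) 1, (c z.2 + s • (z.1 - c z.2), z.2) ∈ U) :
    ContDiffOn ℝ ∞ (fun z : E × T =>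
      ∫ s in (0 : ℝ)..1, homotopyIntegrand (fun u => α (u, z.2)) (c z.2) z.1 s) U := by
  have hV : IsOpen (Prod.snd '' U) := isOpenMap_snd U hU
  -- The centre `c` is smooth only over the projection of `U`, so the domain of the integrand is cut
  -- out of the part of the space lying above that projection.
  let A : Set ((E × T) × ℝ) := {p | p.1.2 ∈ Prod.snd '' U}
  have hA : IsOpen A := hV.preimage (by fun_prop)
  have hcA : ContDiffOn ℝ ∞ (fun p : (E × T) × ℝ => c p.1.2) A :=
    hc.comp (ContDiff.contDiffOn (by fun_prop)) (fun p hp => hp)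
  have hlin : ContDiffOn ℝ ∞ (fun p : (E × T) × ℝ => p.1.1 - c p.1.2) A :=
    (ContDiff.contDiffOn (by fun_prop)).sub hcA
  have hg : ContDiffOn ℝ ∞ (fun p : (E × T) × ℝ =>
      (c p.1.2 + p.2 • (p.1.1 - c p.1.2), p.1.2)) A :=
    (hcA.add (contDiff_snd.contDiffOn.smul hlin)).prodMk (ContDiff.contDiffOn (by fun_prop))
  let O : Set ((E × T) × ℝ) := A ∩ (fun p : (E × T) × ℝ =>
    (c p.1.2 + p.2 • (p.1.1 - c p.1.2), p.1.2)) ⁻¹' U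
  have hO : IsOpen O := hg.continuousOn.isOpen_inter_preimage hA hU
  refine contDiffOn_parametric_integral hO hU (fun z hz s hs => ⟨⟨z, hz, rfl⟩, hstar z hz s hs⟩)
    (F := fun p : (E × T) × ℝ =>
      homotopyIntegrand (fun u => α (u, p.1.2)) (c p.1.2) p.1.1 p.2) ?_
  have h1 : ContDiffOn ℝ ∞ (fun p : (E × T) × ℝ =>
      α (c p.1.2 + p.2 • (p.1.1 - c p.1.2), p.1.2)) O :=
    hα.comp (hg.mono inter_subset_left) (fun p hp => hp.2)
  have h2 : ContDiffOn ℝ ∞ (fun p : (E × T) × ℝ =>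
      (curryLeftCLM E k) (α (c p.1.2 + p.2 • (p.1.1 - c p.1.2), p.1.2))) O :=
    contDiff_curryLeftCLM.comp_contDiffOn h1
  exact (contDiff_snd.pow k).contDiffOn.smul (h2.clm_apply (hlin.mono inter_subset_left))

end Poincare

/-! ### Smoothness of pull-backs -/

section Pullback

variable {E F H : Type*} [NormedAddCommGroup E] [NormedSpace ℝ E] [NormedAddCommGroup F]
  [NormedSpace ℝ F] [NormedAddCommGroup H] [NormedSpace ℝ H]

/-- Among multilinear maps, pull-back is linear in the form and multilinear in copies of the linear
map, hence smooth. A linear retraction onto alternating maps, continuous by finite dimension, brings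
the statement back to alternating forms. -/
theorem ContDiffOn.continuousAlternatingMap_compContinuousLinearMap [FiniteDimensional ℝ E]
    {k : ℕ} {n : WithTop ℕ∞}
    {α : H → F [⋀^Fin k]→L[ℝ] ℝ} {g : H → E →L[ℝ] F} {s : Set H} (hα : ContDiffOn ℝ n α s)
    (hg : ContDiffOn ℝ n g s) :
    ContDiffOn ℝ n (fun x => (α x).compContinuousLinearMap (g x)) s := by
  have hfin : FiniteDimensional ℝ (ContinuousMultilinearMap ℝ (fun _ : Fin k => E) ℝ) :=
    FiniteDimensional.of_injective
      (ContinuousMultilinearMap.toMultilinearMapLinear (R' := ℝ) (A := ℝ)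
        (M₁ := fun _ : Fin k => E) (M₂ := ℝ))
      ContinuousMultilinearMap.toMultilinearMap_injective
  obtain ⟨P, hP⟩ := LinearMap.exists_leftInverse_of_injective
    (ContinuousAlternatingMap.toContinuousMultilinearMapLinear :
      (E [⋀^Fin k]→L[ℝ] ℝ) →ₗ[ℝ] ContinuousMultilinearMap ℝ (fun _ : Fin k => E) ℝ)
    (LinearMap.ker_eq_bot.2 ContinuousAlternatingMap.toContinuousMultilinearMap_injective)
  have h1 : ContDiffOn ℝ n (fun x => (α x).toContinuousMultilinearMap) s :=
    (ContinuousAlternatingMap.toContinuousMultilinearMapLI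
      (𝕜 := ℝ) (E := F) (F := ℝ) (ι := Fin k)).toContinuousLinearMap.contDiff.comp_contDiffOn hα
  have h2 : ContDiffOn ℝ n (fun x =>
      ContinuousMultilinearMap.compContinuousLinearMapContinuousMultilinear ℝ
        (fun _ : Fin k => E) (fun _ => F) ℝ (fun _ => g x)) s :=
    (ContinuousMultilinearMap.contDiff _).comp_contDiffOn (contDiffOn_pi.2 fun _ => hg)
  refine ((LinearMap.toContinuousLinearMap P).contDiff.comp_contDiffOn (h2.clm_apply h1)).congr
    fun x _ => ?_
  exact (LinearMap.congr_fun hP ((α x).compContinuousLinearMap (g x))).symm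

end Pullback

namespace Foliation

variable {p q : ℕ} {M : Type u} [TopologicalSpace M]
  [ChartedSpace (EuclideanSpace ℝ (Fin (p + q))) M]

/-! ### Changes of distinguished charts -/

section Charts

theorem mdifferentiableAt_of_mem {φ : OpenPartialHomeomorph M (FolModel p q)}
    (hφ : IsSmoothChart φ) {x : M} (hx : x ∈ φ.source) :
    MDifferentiableAt (𝓡 (p + q)) 𝓘(ℝ, FolModel p q) φ x :=
  ((hφ.1 x hx).contMDiffAt (φ.open_source.mem_nhds hx)).mdifferentiableAt (by simp)

theorem mdifferentiableAt_symm_of_mem {φ : OpenPartialHomeomorph M (FolModel p q)}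
    (hφ : IsSmoothChart φ) {y : FolModel p q} (hy : y ∈ φ.target) :
    MDifferentiableAt 𝓘(ℝ, FolModel p q) (𝓡 (p + q)) φ.symm y :=
  ((hφ.2 y hy).contMDiffAt (φ.open_target.mem_nhds hy)).mdifferentiableAt (by simp)

/-- The differential of a chart, between the model spaces. -/
noncomputable def chartDeriv (φ : OpenPartialHomeomorph M (FolModel p q)) (x : M) :
    EuclideanSpace ℝ (Fin (p + q)) →L[ℝ] FolModel p q :=
  mfderiv (𝓡 (p + q)) 𝓘(ℝ, FolModel p q) φ x

/-- The differential of the inverse of a chart, between the model spaces. -/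
noncomputable def chartSymmDeriv (φ : OpenPartialHomeomorph M (FolModel p q))
    (y : FolModel p q) : FolModel p q →L[ℝ] EuclideanSpace ℝ (Fin (p + q)) :=
  mfderiv 𝓘(ℝ, FolModel p q) (𝓡 (p + q)) φ.symm y

/-- The change of charts from `ψ` to `φ` is smooth. -/
theorem contDiffOn_transition {φ ψ : OpenPartialHomeomorph M (FolModel p q)}
    (hφ : IsSmoothChart φ) (hψ : IsSmoothChart ψ) :
    ContDiffOn ℝ ∞ (fun y => φ (ψ.symm y)) (ψ.target ∩ ψ.symm ⁻¹' φ.source) :=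
  (hφ.1.comp (hψ.2.mono inter_subset_left) fun _ hy => hy.2).contDiffOn

theorem hasFDerivAt_transition {φ ψ : OpenPartialHomeomorph M (FolModel p q)}
    (hφ : IsSmoothChart φ) (hψ : IsSmoothChart ψ) {y : FolModel p q} (hy : y ∈ ψ.target)
    (hx : ψ.symm y ∈ φ.source) :
    HasFDerivAt (fun z : FolModel p q => φ (ψ.symm z))
      ((chartDeriv φ (ψ.symm y)).comp (chartSymmDeriv ψ y)) y :=
  ((mdifferentiableAt_of_mem hφ hx).hasMFDerivAt.comp y
    (mdifferentiableAt_symm_of_mem hψ hy).hasMFDerivAt).hasFDerivAt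

theorem chartDeriv_chartSymmDeriv {φ : OpenPartialHomeomorph M (FolModel p q)}
    (hφ : IsSmoothChart φ) {y : FolModel p q} (hy : y ∈ φ.target) (v : FolModel p q) :
    chartDeriv φ (φ.symm y) (chartSymmDeriv φ y v) = v := by
  have h1 := hasFDerivAt_transition hφ hφ hy (φ.map_target hy)
  have h2 : (fun z : FolModel p q => φ (φ.symm z)) =ᶠ[𝓝 y] id := by
    filter_upwards [φ.open_target.mem_nhds hy] with z hz using φ.right_inv hz
  have h3 := h1.unique ((hasFDerivAt_id y).congr_of_eventuallyEq h2)
  exact congrArg (fun L : FolModel p q →L[ℝ] FolModel p q => L v) h3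

theorem chartSymmDeriv_chartDeriv {φ : OpenPartialHomeomorph M (FolModel p q)}
    (hφ : IsSmoothChart φ) {y : FolModel p q} (hy : y ∈ φ.target)
    (v : EuclideanSpace ℝ (Fin (p + q))) :
    chartSymmDeriv φ y (chartDeriv φ (φ.symm y) v) = v := by
  have hx := φ.map_target hy
  have h0 : MDifferentiableAt 𝓘(ℝ, FolModel p q) (𝓡 (p + q)) φ.symm (φ (φ.symm y)) := by
    rw [φ.right_inv hy]; exact mdifferentiableAt_symm_of_mem hφ hy
  have h1 := h0.hasMFDerivAt.comp (φ.symm y) (mdifferentiableAt_of_mem hφ hx).hasMFDerivAt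
  have h2 : (φ.symm ∘ φ) =ᶠ[𝓝 (φ.symm y)] id := by
    filter_upwards [φ.open_source.mem_nhds hx] with z hz using φ.left_inv hz
  have h3 := hasMFDerivAt_unique h1
    ((hasMFDerivAt_id (I := 𝓡 (p + q)) (φ.symm y)).congr_of_eventuallyEq h2)
  have h4 := congrArg (fun L : EuclideanSpace ℝ (Fin (p + q)) →L[ℝ]
    EuclideanSpace ℝ (Fin (p + q)) => L v) h3
  rw [φ.right_inv hy] at h4
  exact h4

theorem tendsto_symm_slice {M : Type*} [TopologicalSpace M]
    {φ : OpenPartialHomeomorph M (FolModel p q)} {y : FolModel p q}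
    (hy : y ∈ φ.target) :
    Tendsto (fun a : EuclideanSpace ℝ (Fin p) => φ.symm ((a, y.2) : FolModel p q))
      (𝓝 y.1) (𝓝 (φ.symm y)) :=
  (φ.continuousAt_symm hy).tendsto.comp (Continuous.tendsto (by fun_prop : Continuous
    fun a : EuclideanSpace ℝ (Fin p) => ((a, y.2) : FolModel p q)) y.1)

theorem eventually_slice_mem {s : Set (FolModel p q)} (hs : IsOpen s) {y : FolModel p q}
    (hy : y ∈ s) : ∀ᶠ a in 𝓝 y.1, ((a, y.2) : FolModel p q) ∈ s :=
  (Continuous.tendsto (by fun_prop : Continuous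
    fun a : EuclideanSpace ℝ (Fin p) => ((a, y.2) : FolModel p q)) y.1).eventually (hs.mem_nhds hy)

/-- Along the slices of `ψ` the transverse coordinates of `φ` are locally constant. -/
theorem eventually_transverse_eq (F : Foliation p q M)
    {φ ψ : OpenPartialHomeomorph M (FolModel p q)}
    (hφ : φ ∈ F.charts) (hψ : ψ ∈ F.charts) {y : FolModel p q} (hy : y ∈ ψ.target)
    (hx : ψ.symm y ∈ φ.source) :
    ∀ᶠ a in 𝓝 y.1, (φ (ψ.symm (a, y.2))).2 = (φ (ψ.symm y)).2 := by
  obtain ⟨U, hU, h, hh⟩ := F.compatible ψ hψ φ hφ _ ⟨ψ.map_target hy, hx⟩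
  filter_upwards [(tendsto_symm_slice hy).eventually hU,
    eventually_slice_mem ψ.open_target hy] with a ha hta
  rw [hh _ ha, hh _ (mem_of_mem_nhds hU), ψ.right_inv hta, ψ.right_inv hy]

end Charts

/-! ### Leafwise forms given by their expression in one chart -/

section LocalForms

/-- The leaf coordinates of a tangent vector of the foliation in the chart `φ`. -/
noncomputable def leafCoord (F : Foliation p q M) (φ : OpenPartialHomeomorph M (FolModel p q))
    (x : M) : F.tangent x →L[ℝ] EuclideanSpace ℝ (Fin p) :=
  ((ContinuousLinearMap.fst ℝ (EuclideanSpace ℝ (Fin p)) (EuclideanSpace ℝ (Fin q))).comp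
    (mfderiv (𝓡 (p + q)) 𝓘(ℝ, FolModel p q) φ x :
      TangentSpace (𝓡 (p + q)) x →L[ℝ] FolModel p q)).comp (F.tangent x).subtypeL

/-- The leafwise derivative of the leaf component of the change of charts from `ψ` to `φ`. -/
noncomputable def leafTransitionDeriv (φ ψ : OpenPartialHomeomorph M (FolModel p q))
    (y : FolModel p q) : EuclideanSpace ℝ (Fin p) →L[ℝ] EuclideanSpace ℝ (Fin p) :=
  (ContinuousLinearMap.fst ℝ (EuclideanSpace ℝ (Fin p)) (EuclideanSpace ℝ (Fin q))).comp
    ((fderiv ℝ (fun z => φ (ψ.symm z)) y).comp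
      (ContinuousLinearMap.inl ℝ (EuclideanSpace ℝ (Fin p)) (EuclideanSpace ℝ (Fin q))))

theorem leafCoord_comp_frame (F : Foliation p q M)
    {φ ψ : OpenPartialHomeomorph M (FolModel p q)}
    (hφ : φ ∈ F.charts) (hψ : ψ ∈ F.charts) {y : FolModel p q} (hy : y ∈ ψ.target)
    (hx : ψ.symm y ∈ φ.source) :
    (F.leafCoord φ (ψ.symm y)).comp (F.frame hψ hy) = leafTransitionDeriv φ ψ y := by
  rw [leafTransitionDeriv, (hasFDerivAt_transition (F.smooth φ hφ) (F.smooth ψ hψ) hy hx).fderiv]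
  rfl

theorem fderiv_leafTransition (F : Foliation p q M)
    {φ ψ : OpenPartialHomeomorph M (FolModel p q)}
    (hφ : φ ∈ F.charts) (hψ : ψ ∈ F.charts) {y : FolModel p q} (hy : y ∈ ψ.target)
    (hx : ψ.symm y ∈ φ.source) :
    fderiv ℝ (fun a : EuclideanSpace ℝ (Fin p) => (φ (ψ.symm (a, y.2))).1) y.1 =
      leafTransitionDeriv φ ψ y := by
  have h1 := (hasFDerivAt_transition (F.smooth φ hφ) (F.smooth ψ hψ) hy hx)
  rw [← h1.fderiv] at h1
  have h4 : HasFDerivAt (fun a : EuclideanSpace ℝ (Fin p) => ((a, y.2) : FolModel p q))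
      (ContinuousLinearMap.inl ℝ (EuclideanSpace ℝ (Fin p)) (EuclideanSpace ℝ (Fin q))) y.1 :=
    hasFDerivAt_prodMk_left y.1 y.2
  exact (((ContinuousLinearMap.fst ℝ (EuclideanSpace ℝ (Fin p))
    (EuclideanSpace ℝ (Fin q))).hasFDerivAt (x := φ (ψ.symm y))).comp y.1
      (HasFDerivAt.comp (g := fun z : FolModel p q => φ (ψ.symm z)) y.1 h1 h4)).fderiv

theorem contDiffOn_leafTransitionDeriv {φ ψ : OpenPartialHomeomorph M (FolModel p q)}
    (hφ : IsSmoothChart φ) (hψ : IsSmoothChart ψ) :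
    ContDiffOn ℝ ∞ (leafTransitionDeriv φ ψ) (ψ.target ∩ ψ.symm ⁻¹' φ.source) := by
  have h := (contDiffOn_transition hφ hψ).fderiv_of_isOpen
    (ψ.isOpen_inter_preimage_symm φ.open_source) (m := ∞) le_rfl
  exact contDiffOn_const.clm_comp (h.clm_comp contDiffOn_const)

/-- A vector tangent to the foliation has no transverse component in a distinguished chart, so its
leaf coordinates determine it. -/
theorem frame_comp_leafCoord (F : Foliation p q M)
    {φ : OpenPartialHomeomorph M (FolModel p q)} (hφ : φ ∈ F.charts) {z : FolModel p q}
    (hz : z ∈ φ.target) :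
    (F.frame hφ hz).comp (F.leafCoord φ (φ.symm z)) = ContinuousLinearMap.id ℝ _ := by
  ext v : 1
  apply Subtype.ext
  have h2 : (chartDeriv φ (φ.symm z) v.1).2 = 0 :=
    v.2 φ hφ (φ.map_target hz)
  refine Eq.trans ?_ (chartSymmDeriv_chartDeriv (F.smooth φ hφ) hz v.1)
  change chartSymmDeriv φ z ((chartDeriv φ (φ.symm z) v.1).1, 0) = _
  congr 1
  exact Prod.ext rfl h2.symm

variable {k : ℕ}

/-- The family of alternating forms on the tangent spaces of the leaves whose expression in the
chart `φ` is `β`. -/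
noncomputable def ofChart (F : Foliation p q M) (φ : OpenPartialHomeomorph M (FolModel p q))
    (V : Opens M) (β : FolModel p q → EuclideanSpace ℝ (Fin p) [⋀^Fin k]→L[ℝ] ℝ) (x : V) :
    F.tangent (x : M) [⋀^Fin k]→L[ℝ] ℝ :=
  (β (φ x)).compContinuousLinearMap (F.leafCoord φ x)

theorem localRep_ofChart (F : Foliation p q M)
    {φ ψ : OpenPartialHomeomorph M (FolModel p q)}
    (hφ : φ ∈ F.charts) (hψ : ψ ∈ F.charts) {V : Opens M} (hV : (V : Set M) ⊆ φ.source)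
    (β : FolModel p q → EuclideanSpace ℝ (Fin p) [⋀^Fin k]→L[ℝ] ℝ) {y : FolModel p q}
    (hy : y ∈ ψ.target ∩ ψ.symm ⁻¹' (V : Set M)) :
    F.localRep (F.ofChart φ V β) hψ y =
      (β (φ (ψ.symm y))).compContinuousLinearMap (leafTransitionDeriv φ ψ y) := by
  rw [localRep, dif_pos ⟨hy.1, hy.2⟩, ← F.leafCoord_comp_frame hφ hψ hy.1 (hV hy.2)]
  rfl

/-- A form on `V` is recovered from its expression in `φ`, because `frame` after `leafCoord` is the
identity. Its expression in any other chart is then the pull-back by the leafwise part of the change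
of charts. -/
theorem localRep_eq_pullback (F : Foliation p q M)
    {φ ψ : OpenPartialHomeomorph M (FolModel p q)}
    (hφ : φ ∈ F.charts) (hψ : ψ ∈ F.charts) {V : Opens M} (hV : (V : Set M) ⊆ φ.source)
    (θ : ∀ x : V, F.tangent (x : M) [⋀^Fin k]→L[ℝ] ℝ) {y : FolModel p q}
    (hy : y ∈ ψ.target ∩ ψ.symm ⁻¹' (V : Set M)) :
    F.localRep θ hψ y =
      (F.localRep θ hφ (φ (ψ.symm y))).compContinuousLinearMap (leafTransitionDeriv φ ψ y) := by
  have key : ∀ (x : V), θ x = F.ofChart φ V (F.localRep θ hφ) x := by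
    rintro ⟨x, hxV⟩
    obtain ⟨z, hz, rfl⟩ : ∃ z ∈ φ.target, x = φ.symm z :=
      ⟨φ x, φ.map_source (hV hxV), (φ.left_inv (hV hxV)).symm⟩
    have h1 := F.frame_comp_leafCoord hφ hz
    rw [ofChart]
    simp only
    rw [φ.right_inv hz, localRep, dif_pos ⟨hz, hxV⟩]
    have h2 : ((θ ⟨φ.symm z, hxV⟩).compContinuousLinearMap (F.frame hφ hz)).compContinuousLinearMap
        (F.leafCoord φ (φ.symm z)) = (θ ⟨φ.symm z, hxV⟩).compContinuousLinearMap
          ((F.frame hφ hz).comp (F.leafCoord φ (φ.symm z))) := rfl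
    rw [h2, h1]
    rfl
  have h3 : θ = F.ofChart φ V (F.localRep θ hφ) := funext key
  conv_lhs => rw [h3]
  exact F.localRep_ofChart hφ hψ hV _ hy

theorem ofChart_mem_leafwiseForms (F : Foliation p q M)
    {φ : OpenPartialHomeomorph M (FolModel p q)} (hφ : φ ∈ F.charts) {V : Opens M}
    (hV : (V : Set M) ⊆ φ.source)
    {β : FolModel p q → EuclideanSpace ℝ (Fin p) [⋀^Fin k]→L[ℝ] ℝ}
    (hβ : ContDiffOn ℝ ∞ β (φ.target ∩ φ.symm ⁻¹' (V : Set M))) :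
    F.ofChart φ V β ∈ F.leafwiseForms V k := by
  intro ψ hψ
  have hT := contDiffOn_transition (F.smooth φ hφ) (F.smooth ψ hψ)
  have hD := contDiffOn_leafTransitionDeriv (F.smooth φ hφ) (F.smooth ψ hψ)
  have hsub : ψ.target ∩ ψ.symm ⁻¹' (V : Set M) ⊆ ψ.target ∩ ψ.symm ⁻¹' φ.source :=
    fun y hy => ⟨hy.1, hV hy.2⟩
  have h1 : ContDiffOn ℝ ∞ (fun y => β (φ (ψ.symm y))) (ψ.target ∩ ψ.symm ⁻¹' (V : Set M)) :=
    hβ.comp (hT.mono hsub) fun y hy => ⟨φ.map_source (hV hy.2), by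
      rw [mem_preimage, φ.left_inv (hV hy.2)]; exact hy.2⟩
  exact (h1.continuousAlternatingMap_compContinuousLinearMap (hD.mono hsub)).congr
    fun y hy => F.localRep_ofChart hφ hψ hV β hy

/-- The leafwise exterior derivative can be computed in one chart. -/
theorem mem_leafwiseDeriv_ofChart (F : Foliation p q M)
    {φ : OpenPartialHomeomorph M (FolModel p q)} (hφ : φ ∈ F.charts) {V : Opens M}
    (hV : (V : Set M) ⊆ φ.source)
    {β : FolModel p q → EuclideanSpace ℝ (Fin p) [⋀^Fin k]→L[ℝ] ℝ}
    (hβ : ContDiffOn ℝ ∞ β (φ.target ∩ φ.symm ⁻¹' (V : Set M))) (θ : F.LeafwiseForm V (k + 1))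
    (hθ : ∀ y ∈ φ.target ∩ φ.symm ⁻¹' (V : Set M),
      extDeriv (fun a : EuclideanSpace ℝ (Fin p) => β (a, y.2)) y.1 = θ.rep hφ y) :
    ((⟨F.ofChart φ V β, F.ofChart_mem_leafwiseForms hφ hV hβ⟩ : F.leafwiseForms V k), θ) ∈
      F.leafwiseDeriv V k := by
  intro ψ hψ y hy
  change F.localRep θ.1 hψ y = extDeriv (fun a : EuclideanSpace ℝ (Fin p) =>
    F.localRep (F.ofChart φ V β) hψ (a, y.2)) y.1
  have hx : ψ.symm y ∈ φ.source := hV hy.2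
  have hTy : φ (ψ.symm y) ∈ φ.target ∩ φ.symm ⁻¹' (V : Set M) :=
    ⟨φ.map_source hx, by rw [mem_preimage, φ.left_inv hx]; exact hy.2⟩
  rw [F.localRep_eq_pullback hφ hψ hV _ hy]
  have hWo : IsOpen (ψ.target ∩ ψ.symm ⁻¹' (V : Set M)) := ψ.isOpen_inter_preimage_symm V.isOpen
  have hUo : IsOpen (φ.target ∩ φ.symm ⁻¹' (V : Set M)) := φ.isOpen_inter_preimage_symm V.isOpen
  -- Along a slice of `ψ` the transverse coordinates of `φ` are locally constant. The expression in
  -- `ψ` is therefore the pull-back of one single slice of `β`, and the exterior derivative commutes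
  -- with that pull-back.
  have hev : (fun a : EuclideanSpace ℝ (Fin p) => F.localRep (F.ofChart φ V β) hψ (a, y.2))
      =ᶠ[𝓝 y.1] fun a => (β ((φ (ψ.symm (a, y.2))).1, (φ (ψ.symm y)).2)).compContinuousLinearMap
        (fderiv ℝ (fun a : EuclideanSpace ℝ (Fin p) => (φ (ψ.symm (a, y.2))).1) a) := by
    filter_upwards [eventually_slice_mem hWo hy, F.eventually_transverse_eq hφ hψ hy.1 hx]
      with a ha hta
    rw [F.localRep_ofChart hφ hψ hV β ha, ← hta]
    congr 1
    exact (F.fderiv_leafTransition hφ hψ (y := (a, y.2)) ha.1 (hV ha.2)).symm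
  rw [hev.extDeriv_eq]
  have hsl : ContDiffAt ℝ ∞ (fun a : EuclideanSpace ℝ (Fin p) => (φ (ψ.symm (a, y.2))).1) y.1 := by
    have h1 : ContDiffAt ℝ ∞ (fun z => φ (ψ.symm z)) y :=
      (contDiffOn_transition (F.smooth φ hφ) (F.smooth ψ hψ)).contDiffAt
        ((ψ.isOpen_inter_preimage_symm φ.open_source).mem_nhds ⟨hy.1, hx⟩)
    have h2 : ContDiffAt ℝ ∞ (fun a : EuclideanSpace ℝ (Fin p) => ((a, y.2) : FolModel p q)) y.1 :=
      ContDiff.contDiffAt (by fun_prop)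
    exact contDiffAt_fst.comp y.1 (ContDiffAt.comp (g := fun z => φ (ψ.symm z)) y.1 h1 h2)
  have hβd : DifferentiableAt ℝ (fun a : EuclideanSpace ℝ (Fin p) => β (a, (φ (ψ.symm y)).2))
      (φ (ψ.symm (y.1, y.2))).1 := by
    have h1 : DifferentiableAt ℝ β ((φ (ψ.symm y)).1, (φ (ψ.symm y)).2) :=
      (hβ.contDiffAt (hUo.mem_nhds hTy)).differentiableAt (by simp)
    exact (h1.hasFDerivAt.comp (φ (ψ.symm y)).1
      (hasFDerivAt_prodMk_left (φ (ψ.symm y)).1 (φ (ψ.symm y)).2)).differentiableAt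
  have h5 := extDeriv_pullback
    (f := fun a : EuclideanSpace ℝ (Fin p) => (φ (ψ.symm (a, y.2))).1) hβd hsl
    (by simpa using WithTop.coe_le_coe.2 (le_top (a := (2 : ℕ∞))))
  rw [h5, F.fderiv_leafTransition hφ hψ hy.1 hx]
  congr 1
  exact (hθ _ hTy).symm

end LocalForms

/-! ### Vanishing of the leafwise cohomology -/

/-- An open set with convex slices has a smooth section. -/
theorem _root_.exists_smooth_section_of_convex_slices {E T : Type*} [NormedAddCommGroup E]
    [NormedSpace ℝ E] [NormedAddCommGroup T] [NormedSpace ℝ T]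
    [FiniteDimensional ℝ T] {U : Set (E × T)} (hU : IsOpen U)
    (hconv : ∀ t, Convex ℝ {a | (a, t) ∈ U}) :
    ∃ c : T → E, ContDiffOn ℝ ∞ c (Prod.snd '' U) ∧ ∀ t ∈ Prod.snd '' U, (c t, t) ∈ U := by
  let N : Opens T := ⟨Prod.snd '' U, isOpenMap_snd U hU⟩
  have : SecondCountableTopology T := by
    have := FiniteDimensional.proper_real T
    infer_instance
  have : LocallyCompactSpace N := N.isOpen.locallyCompactSpace
  -- As `U` is open, a point of one slice also belongs to the neighbouring slices. These constant
  -- local sections are glued by a partition of unity, and convexity keeps the result in `U`.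
  obtain ⟨g, hg⟩ := exists_contMDiffMap_forall_mem_convex_of_local_const (n := ⊤) 𝓘(ℝ, T) (M := N)
    (F := E) (t := fun t : N => {a | (a, (t : T)) ∈ U}) (fun t => hconv t) (fun t => by
      obtain ⟨⟨a, t'⟩, hz, ht⟩ := t.2
      simp only at ht
      subst ht
      refine ⟨a, ?_⟩
      have : Continuous fun t : N => (a, (t : T)) := by fun_prop
      exact this.continuousAt.eventually (hU.mem_nhds hz))
  classical
  refine ⟨fun t => if h : t ∈ N then g ⟨t, h⟩ else 0, ?_, fun t ht => ?_⟩
  · intro t ht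
    have h1 : ContMDiffAt 𝓘(ℝ, T) 𝓘(ℝ, E) ∞
        ((fun t => if h : t ∈ N then g ⟨t, h⟩ else 0) ∘ ((↑) : N → T)) ⟨t, ht⟩ := by
      refine g.contMDiff.contMDiffAt.congr_of_eventuallyEq (Eventually.of_forall fun s => ?_)
      simp
    have h2 := (contMDiffAt_subtype_iff (I := 𝓘(ℝ, T)) (U := N) (x := ⟨t, ht⟩)
      (f := fun t => if h : t ∈ N then g ⟨t, h⟩ else 0)).1 h1
    exact h2.contDiffAt.contDiffWithinAt
  · have h : t ∈ N := ht
    simp only [dif_pos h]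
    exact hg ⟨t, h⟩

/-- Convex slices are star-shaped around the points of a smooth section. The homotopy operator
contracting each slice to its point is smooth in the transverse parameter, so it yields a leafwise
primitive on all of `V`. -/
theorem LeafwiseCohomology.subsingleton_of_convex_slices (F : Foliation p q M)
    {φ : OpenPartialHomeomorph M (FolModel p q)} (hφ : φ ∈ F.charts) {V : Opens M}
    (hV : (V : Set M) ⊆ φ.source)
    (hconv : ∀ t : EuclideanSpace ℝ (Fin q), Convex ℝ
      {a : EuclideanSpace ℝ (Fin p) | (a, t) ∈ φ.target ∩ φ.symm ⁻¹' (V : Set M)})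
    {k : ℕ} (hk : 0 < k) : Subsingleton (F.LeafwiseCohomology V k) := by
  obtain ⟨k, rfl⟩ : ∃ j, k = j + 1 := ⟨k - 1, by omega⟩
  rw [Submodule.Quotient.subsingleton_iff, eq_top_iff]
  rintro ⟨θ, hθ⟩ -
  rw [Submodule.submoduleOf, Submodule.mem_comap, Submodule.subtype_apply]
  have hUo : IsOpen (φ.target ∩ φ.symm ⁻¹' (V : Set M)) := φ.isOpen_inter_preimage_symm V.isOpen
  have hclosed : ∀ y ∈ φ.target ∩ φ.symm ⁻¹' (V : Set M),
      extDeriv (fun a : EuclideanSpace ℝ (Fin p) => θ.rep hφ (a, y.2)) y.1 = 0 := by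
    intro y hy
    have h1 := hθ φ hφ y hy
    rw [← LeafwiseForm.rep_zero (F := F) (V := V) (k := k + 1 + 1) hφ y]
    exact h1.symm
  obtain ⟨c, hc, hcU⟩ := exists_smooth_section_of_convex_slices hUo hconv
  have hsm : ContDiffOn ℝ ∞ (θ.rep hφ) (φ.target ∩ φ.symm ⁻¹' (V : Set M)) := θ.2 φ hφ
  have hstar : ∀ z ∈ φ.target ∩ φ.symm ⁻¹' (V : Set M), ∀ s ∈ Icc (0 : ℝ) 1,
      ((c z.2 + s • (z.1 - c z.2), z.2) : FolModel p q) ∈ φ.target ∩ φ.symm ⁻¹' (V : Set M) :=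
    fun z hz s hs => (hconv z.2).add_smul_sub_mem (hcU z.2 ⟨z, hz, rfl⟩) hz hs
  have hβ := contDiffOn_integral_homotopyIntegrand hUo hsm hc hstar
  refine ⟨(_, θ), F.mem_leafwiseDeriv_ofChart hφ hV hβ θ fun y hy => ?_, rfl⟩
  have hsl : Continuous fun a : EuclideanSpace ℝ (Fin p) => ((a, y.2) : FolModel p q) := by fun_prop
  have := extDeriv_integral_homotopyIntegrand (α := fun a => θ.rep hφ (a, y.2))
    (U := (fun a : EuclideanSpace ℝ (Fin p) => ((a, y.2) : FolModel p q)) ⁻¹'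
      (φ.target ∩ φ.symm ⁻¹' (V : Set M))) (hUo.preimage hsl) (c := c y.2) (u := y.1)
    (hsm.comp (ContDiff.contDiffOn (by fun_prop)) fun a ha => ha)
    (fun a ha => hclosed (a, y.2) ha) (fun s hs => hstar y hy s hs)
  exact this

end Foliation

/-! ### Covariant derivatives in local coordinates -/

section ConnectionCoordinates

variable {n : ℕ} {M : Type u} [TopologicalSpace M] [ChartedSpace (EuclideanSpace ℝ (Fin n)) M]
  {W : Type*} [NormedAddCommGroup W] [NormedSpace ℝ W]

/-- `f` is a local coordinate map at `x`: it is smooth with invertible derivative. -/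
structure IsCoordinateMapAt (f : M → W) (x : M) : Prop where
  contMDiffAt : ContMDiffAt (𝓡 n) 𝓘(ℝ, W) ∞ f x
  isInvertible : (mfderiv (𝓡 n) 𝓘(ℝ, W) f x).IsInvertible

/-- The derivative of a map into a normed space, with values in that space. -/
noncomputable def coordDeriv (f : M → W) (x : M) : TangentSpace (𝓡 n) x →L[ℝ] W :=
  mfderiv (𝓡 n) 𝓘(ℝ, W) f x

/-- The vector field with constant components `w` in the coordinates `f`. -/
noncomputable def constField (f : M → W) (w : W) (x : M) : TangentSpace (𝓡 n) x :=
  VectorField.mpullback (𝓡 n) 𝓘(ℝ, W) f (fun _ => w) x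

/-- The components, in the coordinates `f`, of the covariant derivative in the direction `X` of
the field of constant components `w`. -/
noncomputable def covCoord [IsManifold (𝓡 n) ∞ M]
    (cov : CovariantDerivative (𝓡 n) (EuclideanSpace ℝ (Fin n))
    (TangentSpace (𝓡 n) : M → Type _)) (f : M → W) (x : M) (X : TangentSpace (𝓡 n) x) (w : W) :
    W :=
  coordDeriv f x (cov (constField f w) x X)

theorem constField_add (f : M → W) (v w : W) :
    constField (n := n) f (v + w) = constField f v + constField f w := by
  funext x
  exact map_add (mfderiv (𝓡 n) 𝓘(ℝ, W) f x).inverse v w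

theorem constField_smul (f : M → W) (c : ℝ) (w : W) :
    constField (n := n) f (c • w) = c • constField f w := by
  funext x
  exact map_smul (mfderiv (𝓡 n) 𝓘(ℝ, W) f x).inverse c w

theorem IsCoordinateMapAt.mfderiv_constField {f : M → W} {x : M}
    (hf : IsCoordinateMapAt (n := n) f x) (w : W) :
    mfderiv (𝓡 n) 𝓘(ℝ, W) f x (constField f w x) = w := by
  obtain ⟨A, hA⟩ := hf.isInvertible
  change mfderiv (𝓡 n) 𝓘(ℝ, W) f x ((mfderiv (𝓡 n) 𝓘(ℝ, W) f x).inverse w) = w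
  rw [← hA, ContinuousLinearMap.inverse_equiv]
  exact A.apply_symm_apply w

theorem IsCoordinateMapAt.constField_mfderiv {f : M → W} {x : M}
    (hf : IsCoordinateMapAt (n := n) f x)
    (X : TangentSpace (𝓡 n) x) :
    constField f (mfderiv (𝓡 n) 𝓘(ℝ, W) f x X) x = X := by
  obtain ⟨A, hA⟩ := hf.isInvertible
  change (mfderiv (𝓡 n) 𝓘(ℝ, W) f x).inverse (mfderiv (𝓡 n) 𝓘(ℝ, W) f x X) = X
  rw [← hA, ContinuousLinearMap.inverse_equiv]
  exact A.symm_apply_apply X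

theorem coordDeriv_eq_comp {W' : Type*} [NormedAddCommGroup W'] [NormedSpace ℝ W'] {f : M → W}
    {κ : M → W'} {S : W → W'} {x : M} (hf : IsCoordinateMapAt (n := n) f x)
    (hS : DifferentiableAt ℝ S (f x)) (hκS : κ =ᶠ[𝓝 x] S ∘ f) (X : TangentSpace (𝓡 n) x) :
    coordDeriv κ x X = fderiv ℝ S (f x) (coordDeriv f x X) := by
  have h := (hS.hasFDerivAt.hasMFDerivAt.comp x
    (hf.contMDiffAt.mdifferentiableAt (by simp)).hasMFDerivAt).congr_of_eventuallyEq hκS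
  exact congrArg (fun T : TangentSpace (𝓡 n) x →L[ℝ] W' => T X) h.mfderiv

/-- Regularity is needed at all nearby times, not only at `t`, because the velocity is to be
differentiated once more. -/
theorem eventually_contDiffWithinAt_comp {f : M → W} {γ : ℝ → M} {t : ℝ}
    (hγ : ContMDiffOn 𝓘(ℝ, ℝ) (𝓡 n) 2 γ (Icc 0 1)) (ht : t ∈ Icc (0 : ℝ) 1)
    (hf : ∀ᶠ y in 𝓝 (γ t), IsCoordinateMapAt (n := n) f y) :
    ∀ᶠ s in 𝓝[Icc 0 1] t, ContDiffWithinAt ℝ 2 (fun s => f (γ s)) (Icc 0 1) s := by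
  filter_upwards [(hγ t ht).continuousWithinAt.eventually hf, self_mem_nhdsWithin] with s hs hsI
  have h2 : ContMDiffAt (𝓡 n) 𝓘(ℝ, W) 2 f (γ s) := hs.contMDiffAt.of_le ENat.LEInfty.out
  exact contMDiffWithinAt_iff_contDiffWithinAt.1
    (h2.comp_contMDiffWithinAt s (hγ s hsI))

variable [IsManifold (𝓡 n) ∞ M]

theorem IsCoordinateMapAt.contMDiffAt_constField [FiniteDimensional ℝ W] {f : M → W} {x : M}
    (hf : IsCoordinateMapAt (n := n) f x) (w : W) :
    ContMDiffAt (𝓡 n) (𝓡 n).tangent ∞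
      (fun y => (⟨y, constField f w y⟩ : TangentBundle (𝓡 n) M)) x := by
  have := FiniteDimensional.complete ℝ W
  refine ContMDiffAt.mpullback_vectorField_preimage (n := ∞) (m := ∞) ?_ hf.contMDiffAt
    hf.isInvertible le_rfl
  exact contMDiffAt_vectorSpace_iff_contDiffAt.2 contDiffAt_const

variable (cov : CovariantDerivative (𝓡 n) (EuclideanSpace ℝ (Fin n))
    (TangentSpace (𝓡 n) : M → Type _))

theorem covCoord_add_left (f : M → W) (x : M) (X Y : TangentSpace (𝓡 n) x) (w : W) :
    covCoord cov f x (X + Y) w = covCoord cov f x X w + covCoord cov f x Y w := by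
  rw [covCoord, map_add]
  exact map_add (mfderiv (𝓡 n) 𝓘(ℝ, W) f x) _ _

theorem covCoord_smul_left (f : M → W) (x : M) (c : ℝ) (X : TangentSpace (𝓡 n) x) (w : W) :
    covCoord cov f x (c • X) w = c • covCoord cov f x X w := by
  rw [covCoord, map_smul]
  exact map_smul (mfderiv (𝓡 n) 𝓘(ℝ, W) f x) _ _

variable [FiniteDimensional ℝ W]

theorem covCoord_add {f : M → W} {x : M} (hf : IsCoordinateMapAt (n := n) f x)
    (X : TangentSpace (𝓡 n) x) (v w : W) :
    covCoord cov f x X (v + w) = covCoord cov f x X v + covCoord cov f x X w := by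
  have h := cov.isCovariantDerivativeOnUniv.add
    ((hf.contMDiffAt_constField v).mdifferentiableAt (by simp))
    ((hf.contMDiffAt_constField w).mdifferentiableAt (by simp))
  rw [covCoord, constField_add, h]
  exact map_add (mfderiv (𝓡 n) 𝓘(ℝ, W) f x) _ _

theorem covCoord_smul {f : M → W} {x : M} (hf : IsCoordinateMapAt (n := n) f x)
    (X : TangentSpace (𝓡 n) x) (c : ℝ) (w : W) :
    covCoord cov f x X (c • w) = c • covCoord cov f x X w := by
  have h := cov.isCovariantDerivativeOnUniv.smul_const c
    ((hf.contMDiffAt_constField w).mdifferentiableAt (by simp))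
  rw [covCoord, constField_smul, h]
  exact map_smul (mfderiv (𝓡 n) 𝓘(ℝ, W) f x) _ _

/-- The expression of a covariant derivative in local coordinates. -/
theorem coordDeriv_covariantDerivative {f : M → W} {x : M}
    (hf : ∀ᶠ y in 𝓝 x, IsCoordinateMapAt (n := n) f y) {Y : ∀ y : M, TangentSpace (𝓡 n) y}
    (hY : MDifferentiableAt (𝓡 n) (𝓡 n).tangent (fun y => (⟨y, Y y⟩ : TangentBundle (𝓡 n) M)) x)
    {g : M → W} (hg : MDifferentiableAt (𝓡 n) 𝓘(ℝ, W) g x)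
    (hYg : ∀ᶠ y in 𝓝 x, coordDeriv (n := n) f y (Y y) = g y) (X : TangentSpace (𝓡 n) x) :
    coordDeriv f x (cov Y x X) = coordDeriv g x X + covCoord cov f x X (g x) := by
  classical
  have hfx := hf.self_of_nhds
  let b := Module.finBasis ℝ W
  let L : Fin (Module.finrank ℝ W) → W →L[ℝ] ℝ := fun i => (b.coord i).toContinuousLinearMap
  have hc : ∀ i, MDifferentiableAt (𝓡 n) 𝓘(ℝ, ℝ) (fun y => L i (g y)) x := fun i =>
    (L i).differentiableAt.mdifferentiableAt.comp x hg
  have hdc : ∀ i, coordDeriv (fun y => L i (g y)) x X = L i (coordDeriv g x X) := fun i =>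
    congrArg (fun T : TangentSpace (𝓡 n) x →L[ℝ] ℝ => T X)
      (((L i).hasFDerivAt.hasMFDerivAt.comp x hg.hasMFDerivAt).mfderiv)
  have he : ∀ i, MDifferentiableAt (𝓡 n) (𝓡 n).tangent
      (fun y => (⟨y, constField f (b i) y⟩ : TangentBundle (𝓡 n) M)) x := fun i =>
    (hfx.contMDiffAt_constField (b i)).mdifferentiableAt (by simp)
  have hsum : ∀ w : W, ∑ i, L i w • b i = w := fun w => b.sum_repr w
  -- Leibniz's rule for partial sums of the expansion of `Y` in the coordinate fields.
  -- Differentiability of the partial sums is carried along, since additivity of `cov` requires it.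
  have key : ∀ s : Finset (Fin (Module.finrank ℝ W)),
      MDifferentiableAt (𝓡 n) (𝓡 n).tangent (fun y => (⟨y, (∑ i ∈ s, (fun y => L i (g y)) •
        constField f (b i)) y⟩ : TangentBundle (𝓡 n) M)) x ∧
      coordDeriv f x (cov (∑ i ∈ s, (fun y => L i (g y)) • constField f (b i)) x X) =
        ∑ i ∈ s, (L i (coordDeriv g x X) • b i + L i (g x) • covCoord cov f x X (b i)) := by
    intro s
    induction s using Finset.induction_on with
    | empty =>
      refine ⟨by simpa using! Bundle.mdifferentiableAt_zeroSection .., ?_⟩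
      simp only [Finset.sum_empty]
      rw [cov.isCovariantDerivativeOnUniv.zero]
      exact map_zero (coordDeriv f x)
    | insert i s hi ih =>
      have h1 := (hc i).smul_section (he i)
      rw [Finset.sum_insert hi, Finset.sum_insert hi]
      refine ⟨mdifferentiableAt_add_section h1 ih.1, ?_⟩
      rw [cov.isCovariantDerivativeOnUniv.add h1 ih.1,
        cov.isCovariantDerivativeOnUniv.leibniz (he i) (hc i), ← ih.2, ← hdc,
        add_comm (coordDeriv _ x X • b i)]
      have h2 : coordDeriv f x (constField f (b i) x) = b i := hfx.mfderiv_constField (b i)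
      refine (map_add (coordDeriv f x) _ _).trans (congrArg₂ (· + ·) ?_ rfl)
      refine (map_add (coordDeriv f x) _ _).trans (congrArg₂ (· + ·) ?_ ?_)
      · exact map_smul (coordDeriv (n := n) f x) _ _
      · exact (map_smul (coordDeriv (n := n) f x) _ _).trans (congrArg _ h2)
  have hY' : cov Y x = cov (∑ i, (fun y => L i (g y)) • constField f (b i)) x := by
    refine cov.isCovariantDerivativeOnUniv.congr_of_eventuallyEq hY (key Finset.univ).1 univ_mem ?_
    filter_upwards [hYg, hf] with y hy hfy
    have h1 : Y y = constField (n := n) f (g y) y := by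
      rw [← hy]
      exact (hfy.constField_mfderiv (Y y)).symm
    rw [h1, Finset.sum_apply]
    conv_lhs => rw [← hsum (g y)]
    refine (map_sum (mfderiv (𝓡 n) 𝓘(ℝ, W) f y).inverse _ _).trans
      (Finset.sum_congr rfl fun i _ => map_smul (mfderiv (𝓡 n) 𝓘(ℝ, W) f y).inverse _ _)
  rw [hY', (key _).2, Finset.sum_add_distrib, hsum]
  congr 1
  conv_rhs => rw [← hsum (g x)]
  let T : W →ₗ[ℝ] W :=
    { toFun := covCoord cov f x X
      map_add' := covCoord_add cov hfx X
      map_smul' := covCoord_smul cov hfx X }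
  exact ((map_sum T _ _).trans (Finset.sum_congr rfl fun i _ => map_smul T _ _)).symm

/-- The Christoffel symbols in the coordinates `f`. -/
noncomputable def christoffelCoord (f : M → W) (x : M) (v w : W) : W :=
  covCoord cov f x (constField f v x) w

/-- The change of coordinates formula for the Christoffel symbols. -/
theorem fderiv_covCoord {W' : Type*} [NormedAddCommGroup W'] [NormedSpace ℝ W']
    [FiniteDimensional ℝ W'] {f : M → W} {κ : M → W'} {S : W → W'} {x : M}
    (hf : ∀ᶠ y in 𝓝 x, IsCoordinateMapAt (n := n) f y)
    (hκ : ∀ᶠ y in 𝓝 x, IsCoordinateMapAt (n := n) κ y)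
    (hS : ContDiffAt ℝ 2 S (f x)) (hκS : κ =ᶠ[𝓝 x] S ∘ f)
    (X : TangentSpace (𝓡 n) x) (w : W) :
    fderiv ℝ S (f x) (covCoord cov f x X w) =
      fderiv ℝ (fderiv ℝ S) (f x) (coordDeriv f x X) w +
        covCoord cov κ x X (fderiv ℝ S (f x) w) := by
  have hfx := hf.self_of_nhds
  have hfd : MDifferentiableAt (𝓡 n) 𝓘(ℝ, W) f x := hfx.contMDiffAt.mdifferentiableAt (by simp)
  have hS1 : ∀ᶠ y in 𝓝 x, DifferentiableAt ℝ S (f y) :=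
    hfx.contMDiffAt.continuousAt.eventually
      ((hS.eventually (by simp)).mono fun y hy => hy.differentiableAt (by simp))
  have hS2 : DifferentiableAt ℝ (fderiv ℝ S) (f x) :=
    (hS.fderiv_right (m := 1) (by norm_num)).differentiableAt (by simp)
  have hd : HasMFDerivAt (𝓡 n) 𝓘(ℝ, W') (fun y => fderiv ℝ S (f y) w) x
      (((ContinuousLinearMap.apply ℝ W' w).comp (fderiv ℝ (fderiv ℝ S) (f x))).comp
        (coordDeriv f x)) := by
    have h1 : HasFDerivAt (fun z => fderiv ℝ S z w)
      ((ContinuousLinearMap.apply ℝ W' w).comp (fderiv ℝ (fderiv ℝ S) (f x))) (f x) :=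
      (ContinuousLinearMap.apply ℝ W' w).hasFDerivAt.comp (f x) hS2.hasFDerivAt
    exact h1.hasMFDerivAt.comp x hfd.hasMFDerivAt
  -- The field that is constant in the coordinates `f` has the components `DS · w` in `κ`;
  -- differentiating them produces the second-order term.
  have hYg : ∀ᶠ y in 𝓝 x, coordDeriv (n := n) κ y (constField f w y) = fderiv ℝ S (f y) w := by
    filter_upwards [hS1, hf, hκS.eventuallyEq_nhds] with y h1 h2 h3
    rw [coordDeriv_eq_comp h2 h1 h3]
    exact congrArg _ (h2.mfderiv_constField w)
  have h := coordDeriv_covariantDerivative cov hκ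
    ((hfx.contMDiffAt_constField w).mdifferentiableAt (by simp)) hd.mdifferentiableAt hYg X
  rw [coordDeriv_eq_comp hfx hS1.self_of_nhds hκS] at h
  refine h.trans (congrArg₂ (· + ·) ?_ rfl)
  exact congrArg (fun T : TangentSpace (𝓡 n) x →L[ℝ] W' => T X) hd.mfderiv

/-- The left-hand side of the geodesic equation, in the coordinates `f`. -/
noncomputable def geodesicDefect (f : M → W) (γ : ℝ → M) (t : ℝ) : W :=
  derivWithin (derivWithin (fun s => f (γ s)) (Icc 0 1)) (Icc 0 1) t +
    christoffelCoord cov f (γ t) (derivWithin (fun s => f (γ s)) (Icc 0 1) t)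
      (derivWithin (fun s => f (γ s)) (Icc 0 1) t)

/-- The left-hand side of the geodesic equation transforms as a vector. -/
theorem geodesicDefect_comp {W' : Type*} [NormedAddCommGroup W'] [NormedSpace ℝ W']
    [FiniteDimensional ℝ W'] {f : M → W} {κ : M → W'} {S : W → W'}
    {γ : ℝ → M} {t : ℝ}
    (hγ : ContMDiffOn 𝓘(ℝ, ℝ) (𝓡 n) 2 γ (Icc 0 1)) (ht : t ∈ Icc (0 : ℝ) 1)
    (hf : ∀ᶠ y in 𝓝 (γ t), IsCoordinateMapAt (n := n) f y)
    (hκ : ∀ᶠ y in 𝓝 (γ t), IsCoordinateMapAt (n := n) κ y)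
    (hS : ContDiffAt ℝ 2 S (f (γ t))) (hκS : κ =ᶠ[𝓝 (γ t)] S ∘ f) :
    geodesicDefect cov κ γ t = fderiv ℝ S (f (γ t)) (geodesicDefect cov f γ t) := by
  set I : Set ℝ := Icc 0 1 with hI
  have hu : UniqueDiffOn ℝ I := uniqueDiffOn_Icc one_pos
  set c : ℝ → W := fun s => f (γ s) with hcdef
  have hfx := hf.self_of_nhds
  have hc2 := eventually_contDiffWithinAt_comp hγ ht hf
  have hct : ContDiffWithinAt ℝ 2 c I t := hc2.self_of_nhdsWithin ht
  have hv : HasDerivWithinAt (derivWithin c I) (derivWithin (derivWithin c I) I t) I t :=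
    (((hct.fderivWithin_right (m := 1) hu (by norm_num) ht).clm_apply
      (contDiffWithinAt_const (c := (1 : ℝ)))).differentiableWithinAt (by simp)).hasDerivWithinAt
  have hS2 : HasFDerivAt (fderiv ℝ S) (fderiv ℝ (fderiv ℝ S) (c t)) (c t) :=
    ((hS.fderiv_right (m := 1) (by norm_num)).differentiableAt (by simp)).hasFDerivAt
  have hk' : derivWithin (fun s => κ (γ s)) I =ᶠ[𝓝[I] t]
      fun s => fderiv ℝ S (c s) (derivWithin c I s) := by
    have h1 : ∀ᶠ s in 𝓝[I] t, DifferentiableAt ℝ S (c s) :=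
      hct.continuousWithinAt.eventually
        ((hS.eventually (by simp)).mono fun y hy => hy.differentiableAt (by simp))
    have h2 : ∀ᶠ s in 𝓝[I] t, κ =ᶠ[𝓝 (γ s)] S ∘ f :=
      (hγ t ht).continuousWithinAt.eventually hκS.eventuallyEq_nhds
    filter_upwards [hc2, h1, h2, self_mem_nhdsWithin] with s hs hs1 hs2 hsI
    have h3 : HasDerivWithinAt (S ∘ c) (fderiv ℝ S (c s) (derivWithin c I s)) I s :=
      hs1.hasFDerivAt.comp_hasDerivWithinAt s
        (hs.differentiableWithinAt (by simp)).hasDerivWithinAt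
    have h4 : (fun s => κ (γ s)) =ᶠ[𝓝[I] s] S ∘ c :=
      (hγ s hsI).continuousWithinAt.eventually hs2
    exact (h3.congr_of_eventuallyEq h4 (hs2.eq_of_nhds)).derivWithin (hu s hsI)
  have hk't := hk'.self_of_nhdsWithin ht
  have hk'' : derivWithin (derivWithin (fun s => κ (γ s)) I) I t =
      fderiv ℝ (fderiv ℝ S) (c t) (derivWithin c I t) (derivWithin c I t) +
        fderiv ℝ S (c t) (derivWithin (derivWithin c I) I t) := by
    have h1 : HasDerivWithinAt (fun s => fderiv ℝ S (c s))
        (fderiv ℝ (fderiv ℝ S) (c t) (derivWithin c I t)) I t :=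
      hS2.comp_hasDerivWithinAt t (hct.differentiableWithinAt (by simp)).hasDerivWithinAt
    exact ((h1.clm_apply hv).congr_of_eventuallyEq hk' hk't).derivWithin (hu t ht)
  have hX : coordDeriv f (γ t) (constField f (derivWithin c I t) (γ t)) = derivWithin c I t :=
    hfx.mfderiv_constField _
  have hκX : constField κ (fderiv ℝ S (c t) (derivWithin c I t)) (γ t) =
      constField (n := n) f (derivWithin c I t) (γ t) := by
    have h1 := coordDeriv_eq_comp hfx (hS.differentiableAt (by simp)) hκS
      (constField f (derivWithin c I t) (γ t))
    rw [hX] at h1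
    rw [← h1]
    exact hκ.self_of_nhds.constField_mfderiv _
  -- The term `D²S(c', c')` in the second derivative of `S ∘ c` is the very one by which the
  -- Christoffel symbols fail to be tensorial, and the two cancel.
  have hlaw := fderiv_covCoord cov hf hκ hS hκS (constField f (derivWithin c I t) (γ t))
    (derivWithin c I t)
  rw [hX] at hlaw
  rw [geodesicDefect, geodesicDefect, hk'', hk't, map_add, christoffelCoord, christoffelCoord,
    hκX, hlaw]
  abel

end ConnectionCoordinates

/-! ### The connection in distinguished charts -/

theorem isCoordinateMapAt_extChartAt {n : ℕ} {M : Type u} [TopologicalSpace M]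
    [ChartedSpace (EuclideanSpace ℝ (Fin n)) M] [IsManifold (𝓡 n) ∞ M] {x₀ x : M}
    (hx : x ∈ (extChartAt (𝓡 n) x₀).source) :
    IsCoordinateMapAt (n := n) (extChartAt (𝓡 n) x₀) x where
  contMDiffAt := contMDiffAt_extChartAt' (by simpa using hx)
  isInvertible := by
    have : IsManifold (𝓡 n) 1 M := .of_le (n := ∞) ENat.LEInfty.out
    exact isInvertible_mfderiv_extChartAt hx

/-- Adaptedness and smoothness of the connection are tested on global fields, whereas coordinate
fields are local. Multiplication by a bump function makes them global without changing their germ at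
`x`. -/
theorem exists_smooth_extension_of_section {n : ℕ} {M : Type u} [TopologicalSpace M] [T2Space M]
    [ChartedSpace (EuclideanSpace ℝ (Fin n)) M] [IsManifold (𝓡 n) ∞ M] {U : Set M} (hU : IsOpen U)
    {x : M} (hx : x ∈ U) (Y : ∀ y : M, TangentSpace (𝓡 n) y)
    (hY : ∀ y ∈ U, ContMDiffAt (𝓡 n) (𝓡 n).tangent ∞
      (fun y => (⟨y, Y y⟩ : TangentBundle (𝓡 n) M)) y) :
    ∃ ρ : M → ℝ, ContMDiff (𝓡 n) (𝓡 n).tangent ∞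
      (fun y => (⟨y, ρ y • Y y⟩ : TangentBundle (𝓡 n) M)) ∧ (∀ᶠ y in 𝓝 x, ρ y = 1) ∧
      ∀ y ∉ U, ρ y = 0 := by
  obtain ⟨ρ, hρ, -⟩ := ((SmoothBumpFunction.nhds_basis_support (I := 𝓡 n)
    (hU.mem_nhds hx)).mem_iff).1
    (hU.mem_nhds hx)
  refine ⟨ρ, ?_, ρ.eventuallyEq_one, fun y hy => ?_⟩
  · exact ContMDiffOn.smul_section_of_tsupport (s := Y) ρ.contMDiff.contMDiffOn
      hU hρ (fun y hy => (hY y hy).contMDiffWithinAt)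
  · exact image_eq_zero_of_notMem_tsupport fun h => hy (hρ h)

section

variable {p q : ℕ} {M : Type u} [TopologicalSpace M]
  [ChartedSpace (EuclideanSpace ℝ (Fin (p + q))) M]

theorem IsSmoothChart.isCoordinateMapAt {φ : OpenPartialHomeomorph M (FolModel p q)}
    (hφ : IsSmoothChart φ) {x : M} (hx : x ∈ φ.source) :
    IsCoordinateMapAt (n := p + q) φ x where
  contMDiffAt := (hφ.1 x hx).contMDiffAt (φ.open_source.mem_nhds hx)
  isInvertible := by
    obtain ⟨z, hz, rfl⟩ : ∃ z ∈ φ.target, x = φ.symm z :=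
      ⟨φ x, φ.map_source hx, (φ.left_inv hx).symm⟩
    exact ContinuousLinearMap.IsInvertible.of_inverse (f := Foliation.chartDeriv φ (φ.symm z))
      (g := Foliation.chartSymmDeriv φ z)
      (ContinuousLinearMap.ext (Foliation.chartDeriv_chartSymmDeriv hφ hz))
      (ContinuousLinearMap.ext (Foliation.chartSymmDeriv_chartDeriv hφ hz))

theorem IsSmoothChart.eventually_isCoordinateMapAt {φ : OpenPartialHomeomorph M (FolModel p q)}
    (hφ : IsSmoothChart φ) {x : M} (hx : x ∈ φ.source) :
    ∀ᶠ y in 𝓝 x, IsCoordinateMapAt (n := p + q) φ y := by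
  filter_upwards [φ.open_source.mem_nhds hx] with y hy using hφ.isCoordinateMapAt hy

theorem IsSmoothChart.constField_symm {φ : OpenPartialHomeomorph M (FolModel p q)}
    (hφ : IsSmoothChart φ) {z : FolModel p q} (hz : z ∈ φ.target) (v : FolModel p q) :
    constField (n := p + q) φ v (φ.symm z) = Foliation.chartSymmDeriv φ z v := by
  have h := (hφ.isCoordinateMapAt (φ.map_target hz)).constField_mfderiv
    (Foliation.chartSymmDeriv φ z v)
  have h1 : mfderiv (𝓡 (p + q)) 𝓘(ℝ, FolModel p q) φ (φ.symm z)
    (Foliation.chartSymmDeriv φ z v) = v := Foliation.chartDeriv_chartSymmDeriv hφ hz v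
  rw [h1] at h
  exact h

theorem Foliation.constField_mem_tangent (F : Foliation p q M)
    {φ : OpenPartialHomeomorph M (FolModel p q)} (hφ : φ ∈ F.charts) {x : M} (hx : x ∈ φ.source)
    (w : EuclideanSpace ℝ (Fin p)) : constField φ ((w, 0) : FolModel p q) x ∈ F.tangent x := by
  obtain ⟨z, hz, rfl⟩ : ∃ z ∈ φ.target, x = φ.symm z :=
    ⟨φ x, φ.map_source hx, (φ.left_inv hx).symm⟩
  rw [(F.smooth φ hφ).constField_symm hz]
  exact F.frameAux_mem hφ hz w

variable [IsManifold (𝓡 (p + q)) ∞ M]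
  (cov : CovariantDerivative (𝓡 (p + q)) (EuclideanSpace ℝ (Fin (p + q)))
      (TangentSpace (𝓡 (p + q)) : M → Type _))

/-- The Christoffel symbols of an adapted connection in a distinguished chart preserve the
directions of the leaves. -/
theorem Foliation.IsAdapted.covCoord_snd_eq_zero [T2Space M] {F : Foliation p q M}
    {cov : CovariantDerivative (𝓡 (p + q)) (EuclideanSpace ℝ (Fin (p + q)))
      (TangentSpace (𝓡 (p + q)) : M → Type _)} (h : F.IsAdapted cov)
    {φ : OpenPartialHomeomorph M (FolModel p q)} (hφ : φ ∈ F.charts) {x : M} (hx : x ∈ φ.source)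
    (X : TangentSpace (𝓡 (p + q)) x) (w : EuclideanSpace ℝ (Fin p)) :
    (covCoord cov φ x X ((w, 0) : FolModel p q)).2 = 0 := by
  have hs : ∀ y ∈ φ.source, ContMDiffAt (𝓡 (p + q)) (𝓡 (p + q)).tangent ∞
      (fun y => (⟨y, constField φ ((w, 0) : FolModel p q) y⟩ : TangentBundle (𝓡 (p + q)) M)) y :=
    fun y hy => ((F.smooth φ hφ).isCoordinateMapAt hy).contMDiffAt_constField _
  obtain ⟨ρ, hρ, hρ1, hρ0⟩ := exists_smooth_extension_of_section φ.open_source hx _ hs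
  have h1 := h _ hρ (fun y => by
    by_cases hy : y ∈ φ.source
    · exact (F.tangent y).smul_mem _ (F.constField_mem_tangent hφ hy w)
    · rw [hρ0 y hy, zero_smul]
      exact zero_mem _) x X φ hφ hx
  have h2 : cov (fun y => ρ y • constField φ ((w, 0) : FolModel p q) y) x =
      cov (constField φ ((w, 0) : FolModel p q)) x := by
    refine cov.isCovariantDerivativeOnUniv.congr_of_eventuallyEq
      ((hρ x).mdifferentiableAt (by simp)) ((hs x hx).mdifferentiableAt (by simp)) univ_mem ?_
    filter_upwards [hρ1] with y hy
    rw [hy, one_smul]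
  rw [h2] at h1
  exact h1

/-- The smooth connection is applied to a cut-off coordinate field. The resulting vector field,
pulled back by `φ.symm`, has the Christoffel symbols as components. -/
theorem IsSmoothChart.contDiffAt_christoffelCoord [T2Space M]
    (hsmooth : CovariantDerivative.ContMDiffCovariantDerivative cov ∞)
    {φ : OpenPartialHomeomorph M (FolModel p q)} (hφ : IsSmoothChart φ) {z₀ : FolModel p q}
    (hz₀ : z₀ ∈ φ.target) (v w : FolModel p q) :
    ContDiffAt ℝ ∞ (fun z => christoffelCoord cov φ (φ.symm z) v w) z₀ := by
  have hx := φ.map_target hz₀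
  have hs : ∀ w : FolModel p q, ∀ y ∈ φ.source, ContMDiffAt (𝓡 (p + q)) (𝓡 (p + q)).tangent ∞
      (fun y => (⟨y, constField φ w y⟩ : TangentBundle (𝓡 (p + q)) M)) y :=
    fun w y hy => (hφ.isCoordinateMapAt hy).contMDiffAt_constField _
  obtain ⟨ρ, hρ, hρ1, hρ0⟩ := exists_smooth_extension_of_section φ.open_source hx _ (hs w)
  have h1 := (contMDiffOn_univ.1 (hsmooth.contMDiff.contMDiff (contMDiffOn_univ.2 hρ))) (φ.symm z₀)
  have h2 := h1.clm_bundle_apply (hs v _ hx)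
  have h3 : ContMDiffAt (𝓡 (p + q)) (𝓡 (p + q)).tangent ∞
      (fun y => (⟨y, cov (constField φ w) y (constField φ v y)⟩ : TangentBundle (𝓡 (p + q)) M))
      (φ.symm z₀) := by
    refine h2.congr_of_eventuallyEq ?_
    filter_upwards [hρ1.eventually_nhds, φ.open_source.mem_nhds hx] with y hy hys
    have h2 : cov (fun y => ρ y • constField φ w y) y = cov (constField φ w) y := by
      refine cov.isCovariantDerivativeOnUniv.congr_of_eventuallyEq
        ((hρ y).mdifferentiableAt (by simp)) ((hs w y hys).mdifferentiableAt (by simp)) univ_mem ?_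
      filter_upwards [hy] with y' hy'
      rw [hy', one_smul]
    rw [h2]
  have hinv : ∀ z ∈ φ.target, (mfderiv 𝓘(ℝ, FolModel p q) (𝓡 (p + q)) φ.symm z).IsInvertible ∧
      (mfderiv 𝓘(ℝ, FolModel p q) (𝓡 (p + q)) φ.symm z).inverse =
        Foliation.chartDeriv φ (φ.symm z) := by
    intro z hz
    have a1 : (Foliation.chartDeriv φ (φ.symm z)).comp (Foliation.chartSymmDeriv φ z) = .id ℝ _ :=
      ContinuousLinearMap.ext (Foliation.chartDeriv_chartSymmDeriv hφ hz)
    have a2 : (Foliation.chartSymmDeriv φ z).comp (Foliation.chartDeriv φ (φ.symm z)) = .id ℝ _ :=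
      ContinuousLinearMap.ext (Foliation.chartSymmDeriv_chartDeriv hφ hz)
    exact ⟨ContinuousLinearMap.IsInvertible.of_inverse (f := Foliation.chartSymmDeriv φ z)
      (g := Foliation.chartDeriv φ (φ.symm z)) a2 a1,
      ContinuousLinearMap.inverse_eq (f := Foliation.chartSymmDeriv φ z)
        (g := Foliation.chartDeriv φ (φ.symm z)) a2 a1⟩
  have h4 := ContMDiffAt.mpullback_vectorField_preimage (n := ∞) (m := ∞) h3
    ((hφ.2 z₀ hz₀).contMDiffAt (φ.open_target.mem_nhds hz₀)) (hinv z₀ hz₀).1 le_rfl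
  have h5 := contMDiffAt_vectorSpace_iff_contDiffAt.1 h4
  refine ContDiffAt.congr_of_eventuallyEq h5 ?_
  filter_upwards [φ.open_target.mem_nhds hz₀] with z hz
  exact congrArg (fun T : EuclideanSpace ℝ (Fin (p + q)) →L[ℝ] FolModel p q =>
    T (cov (constField φ w) (φ.symm z) (constField φ v (φ.symm z)))) (hinv z hz).2.symm

/-- The geodesic equation can be tested in the chart `φ`. -/
theorem IsSmoothChart.isGeodesicSegment_iff
    {φ : OpenPartialHomeomorph M (FolModel p q)} (hφ : IsSmoothChart φ) {γ : ℝ → M}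
    (hγ : ContMDiffOn 𝓘(ℝ, ℝ) (𝓡 (p + q)) 2 γ (Icc 0 1))
    (hmem : ∀ t ∈ Icc (0 : ℝ) 1, γ t ∈ φ.source) :
    IsGeodesicSegment cov γ ↔ ∀ t ∈ Icc (0 : ℝ) 1, geodesicDefect cov φ γ t = 0 := by
  have key : ∀ t ∈ Icc (0 : ℝ) 1, ∀ x₀ : M, γ t ∈ (extChartAt (𝓡 (p + q)) x₀).source →
      (geodesicDefect cov (extChartAt (𝓡 (p + q)) x₀) γ t = 0 ↔
        geodesicDefect cov φ γ t = 0) := by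
    intro t ht x₀ hx₀
    have hz : φ (γ t) ∈ φ.target := φ.map_source (hmem t ht)
    have hzt : φ.symm (φ (γ t)) = γ t := φ.left_inv (hmem t ht)
    have hκ : ∀ᶠ y in 𝓝 (γ t), IsCoordinateMapAt (n := p + q) (extChartAt (𝓡 (p + q)) x₀) y := by
      filter_upwards [(isOpen_extChartAt_source x₀).mem_nhds hx₀] with y hy
        using isCoordinateMapAt_extChartAt hy
    have hf := hφ.eventually_isCoordinateMapAt (hmem t ht)
    have hS : ContDiffAt ℝ ∞ (fun z => extChartAt (𝓡 (p + q)) x₀ (φ.symm z)) (φ (γ t)) := by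
      refine contMDiffAt_iff_contDiffAt.1 (ContMDiffAt.comp (I' := 𝓡 (p + q)) (φ (γ t)) ?_
        ((hφ.2 _ hz).contMDiffAt (φ.open_target.mem_nhds hz)))
      rw [hzt]
      exact (isCoordinateMapAt_extChartAt hx₀).contMDiffAt
    have hκS : extChartAt (𝓡 (p + q)) x₀ =ᶠ[𝓝 (γ t)]
        (fun z => extChartAt (𝓡 (p + q)) x₀ (φ.symm z)) ∘ φ := by
      filter_upwards [φ.open_source.mem_nhds (hmem t ht)] with y hy
      simp only [Function.comp, φ.left_inv hy]
    rw [geodesicDefect_comp cov hγ ht hf hκ (hS.of_le ENat.LEInfty.out) hκS]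
    refine ⟨fun h => ?_, fun h => by rw [h, map_zero]⟩
    set w := geodesicDefect cov φ γ t with hw
    -- The derivative of the change of coordinates is injective: a vector with zero components in
    -- the chart at `x₀` is zero, so its components in `φ` vanish too.
    have h1 := coordDeriv_eq_comp hf.self_of_nhds (hS.differentiableAt (by simp)) hκS
      (constField (n := p + q) φ w (γ t))
    have h2 : coordDeriv (n := p + q) φ (γ t) (constField φ w (γ t)) = w :=
      hf.self_of_nhds.mfderiv_constField w
    rw [h2, h] at h1
    have h3 := hκ.self_of_nhds.constField_mfderiv (constField φ w (γ t))
    have h4 : constField (n := p + q) φ w (γ t) = 0 := by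
      rw [← h3]
      refine Eq.trans (congrArg (fun u => constField (n := p + q)
        (extChartAt (𝓡 (p + q)) x₀) u (γ t)) h1) ?_
      exact map_zero (mfderiv (𝓡 (p + q)) 𝓘(ℝ, EuclideanSpace ℝ (Fin (p + q)))
        (extChartAt (𝓡 (p + q)) x₀) (γ t)).inverse
    rw [← h2, h4]
    exact map_zero (coordDeriv (n := p + q) φ (γ t))
  constructor
  · intro h t ht
    exact (key t ht (γ t) (mem_extChartAt_source (γ t))).1
      (h.2 t ht (γ t) (mem_extChartAt_source _))
  · intro h
    exact ⟨hγ, fun t ht x₀ hx₀ => (key t ht x₀ hx₀).2 (h t ht)⟩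

end

/-! ### Leafwise geodesics in small distinguished boxes -/

/-- A smooth function defined near a point coincides near this point with a globally bounded and
Lipschitz one. -/
theorem exists_bounded_lipschitz_extension {E G : Type*} [NormedAddCommGroup E] [NormedSpace ℝ E]
    [FiniteDimensional ℝ E] [NormedAddCommGroup G] [NormedSpace ℝ G] {f : E → G} {s : Set E}
    (hs : IsOpen s) (hf : ContDiffOn ℝ ∞ f s) {x : E} (hx : x ∈ s) :
    ∃ g : E → G, ∃ K L : NNReal, (∀ y, ‖g y‖ ≤ K) ∧ LipschitzWith L g ∧
      ∃ r > 0, ∀ y ∈ Metric.ball x r, y ∈ s ∧ g y = f y := by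
  obtain ⟨ε, hε, hεs⟩ := Metric.isOpen_iff.1 hs x hx
  -- The bump equals 1 up to radius `ε/4` and is supported in the closed ball of radius `ε/2`,
  -- inside `s`. The product with `f` thus has compact support, hence is bounded and Lipschitz.
  let χ : ContDiffBump x := ⟨ε / 4, ε / 2, by positivity, by linarith⟩
  have hsupp : tsupport χ ⊆ s := by
    rw [χ.tsupport_eq]
    exact (Metric.closedBall_subset_ball (by change ε / 2 < ε; linarith)).trans hεs
  have hg : ContDiff ℝ ∞ fun y => χ y • f y := by
    rw [contDiff_iff_contDiffAt]
    intro y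
    by_cases hy : y ∈ s
    · exact χ.contDiffAt.smul (hf.contDiffAt (hs.mem_nhds hy))
    · have h0 : (fun y => χ y • f y) =ᶠ[𝓝 y] fun _ => 0 := by
        have : y ∉ tsupport χ := fun h => hy (hsupp h)
        filter_upwards [(isClosed_tsupport χ).isOpen_compl.mem_nhds this] with z hz
        rw [image_eq_zero_of_notMem_tsupport hz, zero_smul]
      exact contDiffAt_const.congr_of_eventuallyEq h0
  have hc : HasCompactSupport fun y => χ y • f y := χ.hasCompactSupport.smul_right
  obtain ⟨L, hL⟩ := hg.lipschitzWith_of_hasCompactSupport hc (by simp)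
  obtain ⟨K, hK⟩ := hc.exists_bound_of_continuous hg.continuous
  refine ⟨_, K.toNNReal, L, fun y => (hK y).trans (Real.le_coe_toNNReal K), hL, ε / 4,
    by positivity, fun y hy => ⟨hεs (Metric.ball_subset_ball (by linarith) hy), ?_⟩⟩
  rw [χ.one_of_mem_closedBall (Metric.ball_subset_closedBall hy), one_smul]

section

variable {p q : ℕ} {M : Type u} [TopologicalSpace M]
  [ChartedSpace (EuclideanSpace ℝ (Fin (p + q))) M] [IsManifold (𝓡 (p + q)) ∞ M]
  (cov : CovariantDerivative (𝓡 (p + q)) (EuclideanSpace ℝ (Fin (p + q)))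
      (TangentSpace (𝓡 (p + q)) : M → Type _))

/-- The Christoffel symbols of the leaves in a distinguished chart. -/
noncomputable def leafChristoffel (φ : OpenPartialHomeomorph M (FolModel p q)) (z : FolModel p q) :
    EuclideanSpace ℝ (Fin p) →L[ℝ] EuclideanSpace ℝ (Fin p) →L[ℝ] EuclideanSpace ℝ (Fin p) :=
  -- Expanding on the standard basis makes the symbols a continuous bilinear map and reduces
  -- smoothness in `z` to that of finitely many components.
  ∑ i, (EuclideanSpace.proj i : EuclideanSpace ℝ (Fin p) →L[ℝ] ℝ).smulRight
    (∑ j, (EuclideanSpace.proj j : EuclideanSpace ℝ (Fin p) →L[ℝ] ℝ).smulRight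
      (christoffelCoord cov φ (φ.symm z) ((EuclideanSpace.single i 1, 0) : FolModel p q)
        ((EuclideanSpace.single j 1, 0) : FolModel p q)).1)

variable {cov}

/-- The transverse component vanishes by adaptedness; bilinearity gives the leaf component. The
geodesic equation thereby restricts to slices. -/
theorem leafChristoffel_apply [T2Space M] {F : Foliation p q M} (h : F.IsAdapted cov)
    {φ : OpenPartialHomeomorph M (FolModel p q)} (hφ : φ ∈ F.charts) {z : FolModel p q}
    (hz : z ∈ φ.target) (v w : EuclideanSpace ℝ (Fin p)) :
    christoffelCoord cov φ (φ.symm z) ((v, 0) : FolModel p q) ((w, 0) : FolModel p q) =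
      (leafChristoffel cov φ z v w, 0) := by
  have hc := (F.smooth φ hφ).isCoordinateMapAt (φ.map_target hz)
  refine Prod.ext ?_ (h.covCoord_snd_eq_zero hφ (φ.map_target hz) _ w)
  let B : EuclideanSpace ℝ (Fin p) →ₗ[ℝ] EuclideanSpace ℝ (Fin p) →ₗ[ℝ]
      EuclideanSpace ℝ (Fin p) := LinearMap.mk₂ ℝ
    (fun v w => (christoffelCoord cov φ (φ.symm z) ((v, 0) : FolModel p q)
      ((w, 0) : FolModel p q)).1)
    (fun v v' w => by
      have : ((v + v', 0) : FolModel p q) = (v, 0) + (v', 0) := by simp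
      rw [christoffelCoord, this, constField_add]
      exact congrArg Prod.fst (covCoord_add_left cov φ _ _ _ _))
    (fun c v w => by
      have : ((c • v, 0) : FolModel p q) = c • (v, 0) := by simp
      rw [christoffelCoord, this, constField_smul]
      exact congrArg Prod.fst (covCoord_smul_left cov φ _ _ _ _))
    (fun v w w' => by
      have : ((w + w', 0) : FolModel p q) = (w, 0) + (w', 0) := by simp
      rw [christoffelCoord, this]
      exact congrArg Prod.fst (covCoord_add cov hc _ _ _))
    (fun c v w => by
      have : ((c • w, 0) : FolModel p q) = c • (w, 0) := by simp
      rw [christoffelCoord, this]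
      exact congrArg Prod.fst (covCoord_smul cov hc _ _ _))
  have hsum : ∀ v : EuclideanSpace ℝ (Fin p), v = ∑ i, v i • EuclideanSpace.single i 1 := by
    intro v
    simpa using ((EuclideanSpace.basisFun (Fin p) ℝ).sum_repr v).symm
  change B v w = _
  conv_lhs => rw [hsum v]
  simp only [map_sum, LinearMap.sum_apply, leafChristoffel, sum_apply, smul_apply,
    ContinuousLinearMap.smulRight_apply]
  refine Finset.sum_congr rfl fun i _ => ?_
  conv_lhs => rw [hsum w]
  rw [map_smul, LinearMap.smul_apply]
  simp only [map_sum, map_smul]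
  rfl

theorem contDiffOn_leafChristoffel [T2Space M]
    (hsmooth : CovariantDerivative.ContMDiffCovariantDerivative cov ∞)
    {φ : OpenPartialHomeomorph M (FolModel p q)} (hφ : IsSmoothChart φ) :
    ContDiffOn ℝ ∞ (leafChristoffel cov φ) φ.target := by
  intro z hz
  refine ContDiffAt.contDiffWithinAt ?_
  refine ContDiffAt.sum fun i _ => contDiffAt_const.smulRight (ContDiffAt.sum fun j _ => 
    contDiffAt_const.smulRight ?_)
  exact (hφ.contDiffAt_christoffelCoord cov hsmooth hz _ _).fst

/-- The geodesic equation along a curve in a slice of a distinguished chart. -/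
theorem geodesicDefect_of_slice {φ : OpenPartialHomeomorph M (FolModel p q)} {γ : ℝ → M}
    {c : ℝ → EuclideanSpace ℝ (Fin p)} {t₀ : EuclideanSpace ℝ (Fin q)}
    (hc : ContDiffOn ℝ 2 c (Icc 0 1))
    (hγ : EqOn (fun s => φ (γ s)) (fun s => (c s, t₀)) (Icc 0 1)) {t : ℝ} (ht : t ∈ Icc (0 : ℝ) 1) :
    geodesicDefect cov φ γ t =
      ((derivWithin (derivWithin c (Icc 0 1)) (Icc 0 1) t, 0) : FolModel p q) +
      christoffelCoord cov φ (γ t) ((derivWithin c (Icc 0 1) t, 0) : FolModel p q)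
        ((derivWithin c (Icc 0 1) t, 0) : FolModel p q) := by
  have hu : UniqueDiffOn ℝ (Icc (0 : ℝ) 1) := uniqueDiffOn_Icc one_pos
  have key : ∀ {f : ℝ → EuclideanSpace ℝ (Fin p)} {g : ℝ → FolModel p q}
      {a : EuclideanSpace ℝ (Fin q)}, DifferentiableOn ℝ f (Icc 0 1) →
      EqOn g (fun s => (f s, a)) (Icc 0 1) →
      EqOn (derivWithin g (Icc 0 1)) (fun s => (derivWithin f (Icc 0 1) s, 0)) (Icc 0 1) := by
    intro f g a hf hg s hs
    rw [derivWithin_congr hg (hg hs)]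
    exact ((hf s hs).hasDerivWithinAt.prodMk (hasDerivWithinAt_const s _ a)).derivWithin (hu s hs)
  have h1 := key (hc.differentiableOn (by simp)) hγ
  have h2 := key ((hc.derivWithin hu (m := 1) (by norm_num)).differentiableOn (by simp)) h1
  rw [geodesicDefect, h1 ht, h2 ht]

/-- Geodesics inside the slab correspond to solutions of the slice equation. The Christoffel symbols
are replaced by a globally bounded, Lipschitz extension `G` that agrees with them near `φ x`; its
constants serve all slices, so the radius does not depend on `t₀`. -/
theorem exists_radius_isGeodesicallyConvex_slab [T2Space M] {F : Foliation p q M}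
    (hsmooth : CovariantDerivative.ContMDiffCovariantDerivative cov ∞) (h : F.IsAdapted cov)
    {φ : OpenPartialHomeomorph M (FolModel p q)} (hφ : φ ∈ F.charts) {x : M} (hx : x ∈ φ.source) :
    ∃ r₀ > 0, ∀ r > 0, r ≤ r₀ → ∀ t₀ : EuclideanSpace ℝ (Fin q),
      IsGeodesicallyConvex cov {y | y ∈ φ.source ∧ φ y ∈ Metric.ball (φ x) r ∧ (φ y).2 = t₀} := by
  obtain ⟨G, K, L, hK, hL, r₁, hr₁, hG⟩ := exists_bounded_lipschitz_extension φ.open_target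
    (contDiffOn_leafChristoffel hsmooth (F.smooth φ hφ)) (φ.map_source hx)
  have hKL : (0 : ℝ) < 128 * (K + L + 1) := by positivity
  refine ⟨min r₁ (1 / (128 * (K + L + 1))), by positivity, fun r hr hrr t₀ => ?_⟩
  have hr1 : r ≤ r₁ := hrr.trans (min_le_left _ _)
  have hr2 : 128 * (K + L + 1) * r ≤ 1 := by
    have := hrr.trans (min_le_right _ _)
    rw [le_div_iff₀ hKL] at this
    linarith
  have hu : UniqueDiffOn ℝ (Icc (0 : ℝ) 1) := uniqueDiffOn_Icc one_pos
  let Γ : EuclideanSpace ℝ (Fin p) → EuclideanSpace ℝ (Fin p) →L[ℝ] EuclideanSpace ℝ (Fin p) →L[ℝ]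
    EuclideanSpace ℝ (Fin p) := fun u => G (u, t₀)
  have hΓL : LipschitzWith L Γ := by
    have h1 := hL.comp (LipschitzWith.prodMk_right (α := EuclideanSpace ℝ (Fin p)) t₀)
    rwa [mul_one] at h1
  have hball : ∀ u : EuclideanSpace ℝ (Fin p), t₀ ∈ Metric.ball (φ x).2 r →
      u ∈ Metric.ball (φ x).1 r → ((u, t₀) : FolModel p q) ∈ Metric.ball (φ x) r := by
    intro u ht hu
    rw [← ball_prod_same (φ x).1 (φ x).2]
    exact ⟨hu, ht⟩
  -- a geodesic in the slab gives a solution of the geodesic equation of the slice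
  have toCurve : ∀ γ : ℝ → M, IsGeodesicSegment cov γ → (∀ t ∈ Icc (0 : ℝ) 1, γ t ∈
      {y | y ∈ φ.source ∧ φ y ∈ Metric.ball (φ x) r ∧ (φ y).2 = t₀}) →
      IsGeodesicCurve Γ (fun s => (φ (γ s)).1) (derivWithin (fun s => (φ (γ s)).1) (Icc 0 1)) := by
    intro γ hγ hmem
    have hC : ContDiffOn ℝ 2 (fun s => φ (γ s)) (Icc 0 1) := by
      have h1 : ContMDiffOn (𝓡 (p + q)) 𝓘(ℝ, FolModel p q) 2 φ φ.source :=
        (F.smooth φ hφ).1.of_le ENat.LEInfty.out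
      exact (h1.comp hγ.1 fun t ht => (hmem t ht).1).contDiffOn
    have hc : ContDiffOn ℝ 2 (fun s => (φ (γ s)).1) (Icc 0 1) := hC.fst
    refine ⟨fun t ht => ((hc.differentiableOn (by simp)) t ht).hasDerivWithinAt, fun t ht => ?_⟩
    have h1 := (((hc.derivWithin hu (m := 1) (by norm_num)).differentiableOn
      (by simp)) t ht).hasDerivWithinAt
    have h2 := ((F.smooth φ hφ).isGeodesicSegment_iff cov hγ.1 fun t ht => (hmem t ht).1).1 hγ t ht
    rw [geodesicDefect_of_slice hc (fun s hs => Prod.ext rfl (hmem s hs).2.2) ht,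
      ← φ.left_inv (hmem t ht).1, leafChristoffel_apply h hφ (φ.map_source (hmem t ht).1),
      ← (hG _ (Metric.ball_subset_ball hr1 (hmem t ht).2.1)).2] at h2
    have h3 := congrArg Prod.fst h2
    have h4 : G (φ (γ t)) = Γ (φ (γ t)).1 := by
      change G _ = G _
      rw [← (hmem t ht).2.2]
    simp only [Prod.fst_add, Prod.fst_zero] at h3
    rw [h4] at h3
    rw [eq_neg_of_add_eq_zero_left h3] at h1
    exact h1
  rintro a ⟨has, haB, hat⟩ b ⟨hbs, hbB, hbt⟩
  have hB1 : ∀ {z : FolModel p q}, z ∈ Metric.ball (φ x) r → z.1 ∈ Metric.ball (φ x).1 r ∧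
      z.2 ∈ Metric.ball (φ x).2 r := by
    intro z hz
    rw [← ball_prod_same (φ x).1 (φ x).2] at hz
    exact hz
  have ht₀ : t₀ ∈ Metric.ball (φ x).2 r := hat ▸ (hB1 haB).2
  obtain ⟨⟨c, v, hcv, hc0, hc1, hcB⟩, huniq⟩ := exists_unique_geodesicCurve_in_ball
    (fun u => hK (u, t₀)) hΓL hr2 (hB1 haB).1 (hB1 hbB).1
  have hc' : EqOn (derivWithin c (Icc 0 1)) v (Icc 0 1) := fun t ht =>
    (hcv.hasDeriv t ht).derivWithin (hu t ht)
  have hv' : EqOn (derivWithin v (Icc 0 1)) (fun t => -(Γ (c t) (v t) (v t))) (Icc 0 1) :=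
    fun t ht => (hcv.hasDeriv_velocity t ht).derivWithin (hu t ht)
  have hcc : ContinuousOn c (Icc 0 1) := fun t ht => (hcv.hasDeriv t ht).continuousWithinAt
  have hvc : ContinuousOn v (Icc 0 1) := fun t ht => (hcv.hasDeriv_velocity t ht).continuousWithinAt
  -- Bootstrap: the equation expresses `v'` through continuous functions, so `v` is `C¹` and `c` is
  -- `C²`, as required of a geodesic segment.
  have hcC : ContDiffOn ℝ 2 c (Icc 0 1) := by
    have hv1 : ContDiffOn ℝ 1 v (Icc 0 1) := by
      rw [show (1 : ℕ∞ω) = 0 + 1 from (zero_add 1).symm, contDiffOn_succ_iff_derivWithin hu]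
      refine ⟨fun t ht => (hcv.hasDeriv_velocity t ht).differentiableWithinAt, by simp, ?_⟩
      rw [contDiffOn_zero]
      refine ContinuousOn.congr ?_ hv'
      exact (((hΓL.continuous.comp_continuousOn hcc).clm_apply hvc).clm_apply hvc).neg
    rw [show (2 : ℕ∞ω) = 1 + 1 by norm_num, contDiffOn_succ_iff_derivWithin hu]
    exact ⟨fun t ht => (hcv.hasDeriv t ht).differentiableWithinAt, by simp, hv1.congr hc'⟩
  have hzT : ∀ t ∈ Icc (0 : ℝ) 1, ((c t, t₀) : FolModel p q) ∈ φ.target := fun t ht =>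
    (hG _ (Metric.ball_subset_ball hr1 (hball _ ht₀ (hcB t ht)))).1
  let γ : ℝ → M := fun t => φ.symm ((c t, t₀) : FolModel p q)
  have hφγ : EqOn (fun s => φ (γ s)) (fun s => (c s, t₀)) (Icc 0 1) := fun t ht =>
    φ.right_inv (hzT t ht)
  have hγmem : ∀ t ∈ Icc (0 : ℝ) 1, γ t ∈
      {y | y ∈ φ.source ∧ φ y ∈ Metric.ball (φ x) r ∧ (φ y).2 = t₀} := by
    intro t ht
    have h1 : φ (γ t) = (c t, t₀) := hφγ ht
    refine ⟨φ.map_target (hzT t ht), ?_, ?_⟩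
    · rw [h1]; exact hball _ ht₀ (hcB t ht)
    · rw [h1]
  have hγ2 : ContMDiffOn 𝓘(ℝ, ℝ) (𝓡 (p + q)) 2 γ (Icc 0 1) := by
    have h1 : ContMDiffOn 𝓘(ℝ, FolModel p q) (𝓡 (p + q)) 2 φ.symm φ.target :=
      (F.smooth φ hφ).2.of_le ENat.LEInfty.out
    exact h1.comp (hcC.prodMk contDiffOn_const).contMDiffOn hzT
  have hγgeo : IsGeodesicSegment cov γ := by
    refine ((F.smooth φ hφ).isGeodesicSegment_iff cov hγ2 fun t ht => (hγmem t ht).1).2 ?_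
    intro t ht
    rw [geodesicDefect_of_slice hcC hφγ ht, leafChristoffel_apply h hφ (hzT t ht),
      ← (hG _ (Metric.ball_subset_ball hr1 (hball _ ht₀ (hcB t ht)))).2, hc' ht,
      derivWithin_congr hc' (hc' ht), hv' ht]
    simp [Γ]
  have e0 : γ 0 = a := by
    change φ.symm (c 0, t₀) = a
    rw [hc0, ← hat]
    exact φ.left_inv has
  have e1 : γ 1 = b := by
    change φ.symm (c 1, t₀) = b
    rw [hc1, ← hbt]
    exact φ.left_inv hbs
  refine ⟨γ, ⟨hγgeo, e0, e1, hγmem⟩, fun γ' hγ' => ?_⟩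
  have h1 := huniq _ _ _ _ hcv (toCurve γ' hγ'.1 hγ'.2.2.2) hc0 hc1 (by rw [hγ'.2.1])
    (by rw [hγ'.2.2.1]) hcB (fun t ht => (hB1 (hγ'.2.2.2 t ht).2.1).1)
  intro t ht
  change γ' t = φ.symm (c t, t₀)
  rw [← h1 ht, ← (hγ'.2.2.2 t ht).2.2]
  exact (φ.left_inv (hγ'.2.2.2 t ht).1).symm

end

/-! ### Small distinguished boxes are convex in every distinguished chart -/

theorem OpenPartialHomeomorph.exists_radius_preimage_ball_subset {X Y : Type*} [TopologicalSpace X]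
    [PseudoMetricSpace Y] (φ : OpenPartialHomeomorph X Y) {x : X} (hx : x ∈ φ.source)
    {W : Set X} (hW : W ∈ 𝓝 x) :
    ∃ r₀ > 0, Metric.ball (φ x) r₀ ⊆ φ.target ∧ φ.source ∩ φ ⁻¹' Metric.ball (φ x) r₀ ⊆ W := by
  have h1 : φ.symm ⁻¹' W ∈ 𝓝 (φ x) := by
    refine (φ.continuousAt_symm (φ.map_source hx)).preimage_mem_nhds ?_
    rwa [φ.left_inv hx]
  obtain ⟨r, hr, h⟩ := Metric.mem_nhds_iff.1
    (inter_mem h1 (φ.open_target.mem_nhds (φ.map_source hx)))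
  refine ⟨r, hr, h.trans inter_subset_right, fun y hy => ?_⟩
  have h2 := (h hy.2).1
  rwa [mem_preimage, φ.left_inv hy.1] at h2

/-- The derivative of a local diffeomorphism is bounded below and its second derivative is
bounded. -/
theorem exists_second_derivative_bound {E F : Type*} [NormedAddCommGroup E] [NormedSpace ℝ E]
    [NormedAddCommGroup F] [NormedSpace ℝ F] {τ : E → F} {σ : F → E} {z₀ : E}
    (hτ : ContDiffAt ℝ 2 τ z₀) (hσ : ContDiffAt ℝ 2 σ (τ z₀)) (hστ : σ ∘ τ =ᶠ[𝓝 z₀] id) :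
    ∃ C : ℝ, 0 ≤ C ∧ ∀ᶠ z in 𝓝 z₀, ∀ w : E,
      ‖fderiv ℝ (fderiv ℝ τ) z w w‖ ≤ C * ‖fderiv ℝ τ z w‖ ^ 2 := by
  have h2 : ContinuousAt (fderiv ℝ (fderiv ℝ τ)) z₀ :=
    ((hτ.fderiv_right (m := 1) (by norm_num)).fderiv_right (m := 0) (by norm_num)).continuousAt
  have h1 : ContinuousAt (fun z => fderiv ℝ σ (τ z)) z₀ :=
    ContinuousAt.comp (f := τ) (g := fderiv ℝ σ)
      (hσ.fderiv_right (m := 1) (by norm_num)).continuousAt hτ.continuousAt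
  have h3 : ContinuousAt (fun z => ‖fderiv ℝ (fderiv ℝ τ) z‖) z₀ :=
    ContinuousAt.norm (E := E →L[ℝ] E →L[ℝ] F) h2
  -- Adding 1 leaves room for the bounds to persist near `z₀`. Since `w = Dσ (Dτ w)`, the first one
  -- gives `‖w‖ ≤ N ‖Dτ w‖`.
  set N := ‖fderiv ℝ σ (τ z₀)‖ + 1
  set N₂ := ‖fderiv ℝ (fderiv ℝ τ) z₀‖ + 1
  refine ⟨N₂ * N ^ 2, by positivity, ?_⟩
  filter_upwards [h1.norm.eventually (gt_mem_nhds (lt_add_one _)),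
    h3.eventually (gt_mem_nhds (lt_add_one _)), hστ.eventuallyEq_nhds,
    hτ.eventually (by simp), hτ.continuousAt.eventually (hσ.eventually (by simp))]
    with z hz1 hz2 hid hτz hσz w
  have hcomp := ((hσz.differentiableAt (by simp)).hasFDerivAt.comp z
    (hτz.differentiableAt (by simp)).hasFDerivAt).unique
    ((hasFDerivAt_id z).congr_of_eventuallyEq hid)
  have hw : ‖w‖ ≤ N * ‖fderiv ℝ τ z w‖ := by
    have h3 : fderiv ℝ σ (τ z) (fderiv ℝ τ z w) = w :=
      congrArg (fun T : E →L[ℝ] E => T w) hcomp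
    calc ‖w‖ = ‖fderiv ℝ σ (τ z) (fderiv ℝ τ z w)‖ := by rw [h3]
      _ ≤ ‖fderiv ℝ σ (τ z)‖ * ‖fderiv ℝ τ z w‖ := ContinuousLinearMap.le_opNorm _ _
      _ ≤ N * ‖fderiv ℝ τ z w‖ := by gcongr
  calc ‖fderiv ℝ (fderiv ℝ τ) z w w‖ ≤ ‖fderiv ℝ (fderiv ℝ τ) z‖ * ‖w‖ * ‖w‖ :=
        ContinuousLinearMap.le_opNorm₂ _ _ _
    _ ≤ N₂ * (N * ‖fderiv ℝ τ z w‖) * (N * ‖fderiv ℝ τ z w‖) := by gcongr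
    _ = N₂ * N ^ 2 * ‖fderiv ℝ τ z w‖ ^ 2 := by ring

namespace Foliation

variable {p q : ℕ} {M : Type u} [TopologicalSpace M]
  [ChartedSpace (EuclideanSpace ℝ (Fin (p + q))) M]

theorem fderiv_transition_snd_eq_zero (F : Foliation p q M)
    {φ ψ : OpenPartialHomeomorph M (FolModel p q)}
    (hφ : φ ∈ F.charts) (hψ : ψ ∈ F.charts) {z : FolModel p q} (hz : z ∈ ψ.target)
    (hx : ψ.symm z ∈ φ.source) (w : EuclideanSpace ℝ (Fin p)) :
    (fderiv ℝ (fun y => φ (ψ.symm y)) z ((w, 0) : FolModel p q)).2 = 0 := by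
  rw [(hasFDerivAt_transition (F.smooth φ hφ) (F.smooth ψ hψ) hz hx).fderiv]
  exact F.frameAux_mem hψ hz w φ hφ hx

/-- A segment in a slice of `ψ`, read in `φ`, keeps its transverse coordinate, and the acceleration
of its leaf part is bounded by a multiple of the squared velocity. Its leaf part thus stays in the
ball containing its ends. -/
theorem exists_radius_convex_slices (F : Foliation p q M)
    {φ ψ : OpenPartialHomeomorph M (FolModel p q)}
    (hφ : φ ∈ F.charts) (hψ : ψ ∈ F.charts) {x : M} (hxφ : x ∈ φ.source) (hxψ : x ∈ ψ.source) :
    ∃ r₀ > 0, ∀ r > 0, r ≤ r₀ → ∀ t : EuclideanSpace ℝ (Fin q),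
      Convex ℝ {u : EuclideanSpace ℝ (Fin p) | ((u, t) : FolModel p q) ∈
        ψ.target ∩ ψ.symm ⁻¹' (φ.source ∩ φ ⁻¹' Metric.ball (φ x) r)} := by
  have hs := contDiffOn_transition (F.smooth φ hφ) (F.smooth ψ hψ)
  set τ : FolModel p q → FolModel p q := fun y => φ (ψ.symm y) with hτ
  have hD : IsOpen (ψ.target ∩ ψ.symm ⁻¹' φ.source) := ψ.isOpen_inter_preimage_symm φ.open_source
  have hz₀ : ψ x ∈ ψ.target ∩ ψ.symm ⁻¹' φ.source := by
    refine ⟨ψ.map_source hxψ, ?_⟩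
    rwa [mem_preimage, ψ.left_inv hxψ]
  have hτx : τ (ψ x) = φ x := by rw [hτ]; simp only; rw [ψ.left_inv hxψ]
  obtain ⟨C, hC0, hC⟩ := exists_second_derivative_bound (τ := τ) (z₀ := ψ x)
    (σ := fun y => ψ (φ.symm y)) ((hs.contDiffAt (hD.mem_nhds hz₀)).of_le ENat.LEInfty.out) (by
      rw [hτx]
      refine ((contDiffOn_transition (F.smooth ψ hψ) (F.smooth φ hφ)).contDiffAt
        ((φ.isOpen_inter_preimage_symm ψ.open_source).mem_nhds
          ⟨φ.map_source hxφ, ?_⟩)).of_le ENat.LEInfty.out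
      rwa [mem_preimage, φ.left_inv hxφ]) (by
      filter_upwards [hD.mem_nhds hz₀] with y hy
      change ψ (φ.symm (φ (ψ.symm y))) = y
      rw [φ.left_inv hy.2, ψ.right_inv hy.1])
  have hd : ∀ᶠ z in 𝓝 (ψ x), ‖τ z - φ x‖ * C < 1 := by
    have h1 : ContinuousAt (fun z => ‖τ z - φ x‖ * C) (ψ x) :=
      ((hs.contDiffAt (hD.mem_nhds hz₀)).continuousAt.sub continuousAt_const).norm.mul
        continuousAt_const
    refine h1.eventually (gt_mem_nhds ?_)
    simp [hτx]
  -- Boxes inside this `ψ`-ball suffice: the ball is convex, so the whole segment remains where the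
  -- change of charts is defined and its estimates hold, even before it is known to stay in the box.
  obtain ⟨δ, hδ, hB⟩ := Metric.mem_nhds_iff.1 (inter_mem (inter_mem hC hd) (hD.mem_nhds hz₀))
  obtain ⟨r₀, hr₀, -, hr₀B⟩ := φ.exists_radius_preimage_ball_subset hxφ
    ((ψ.isOpen_inter_preimage Metric.isOpen_ball).mem_nhds
      (⟨hxψ, Metric.mem_ball_self hδ⟩ : x ∈ ψ.source ∩ ψ ⁻¹' Metric.ball (ψ x) δ))
  refine ⟨r₀, hr₀, fun r hr hrr t => ?_⟩
  intro u₀ hu₀ u₁ hu₁ a b ha hb hab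
  have hmem : ∀ u : EuclideanSpace ℝ (Fin p), ((u, t) : FolModel p q) ∈
      ψ.target ∩ ψ.symm ⁻¹' (φ.source ∩ φ ⁻¹' Metric.ball (φ x) r) →
      ((u, t) : FolModel p q) ∈ Metric.ball (ψ x) δ := by
    intro u hu
    have h1 := (hr₀B ⟨hu.2.1, Metric.ball_subset_ball hrr hu.2.2⟩).2
    rwa [mem_preimage, ψ.right_inv hu.1] at h1
  set w : EuclideanSpace ℝ (Fin p) := u₁ - u₀ with hw
  let g : ℝ → FolModel p q := fun s => (u₀ + s • w, t)
  have hg : ∀ s ∈ Icc (0 : ℝ) 1, g s ∈ Metric.ball (ψ x) δ := by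
    intro s hsI
    have h1 := (convex_ball (ψ x) δ) (hmem _ hu₀) (hmem _ hu₁) (sub_nonneg.2 hsI.2) hsI.1 (by ring)
    have h2 : g s = (1 - s) • ((u₀, t) : FolModel p q) + s • ((u₁, t) : FolModel p q) := by
      refine Prod.ext ?_ ?_
      · simp only [g, hw, Prod.smul_mk, Prod.mk_add_mk]; module
      · simp only [g, Prod.smul_mk, Prod.mk_add_mk]; module
    rwa [h2]
  have hgd : ∀ s, HasDerivWithinAt g ((w, 0) : FolModel p q) (Icc 0 1) s := by
    intro s
    have h1 : HasDerivWithinAt (fun s : ℝ => u₀ + s • w) w (Icc 0 1) s := by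
      simpa using ((hasDerivWithinAt_id s (Icc 0 1)).smul_const w).const_add u₀
    exact h1.prodMk (hasDerivWithinAt_const s _ t)
  have hτd : ∀ s ∈ Icc (0 : ℝ) 1, HasDerivWithinAt (fun s => τ (g s))
      (fderiv ℝ τ (g s) ((w, 0) : FolModel p q)) (Icc 0 1) s := by
    intro s hsI
    exact ((hs.contDiffAt (hD.mem_nhds (hB (hg s hsI)).2)).differentiableAt
      (by simp)).hasFDerivAt.comp_hasDerivWithinAt s (hgd s)
  have hτdd : ∀ s ∈ Icc (0 : ℝ) 1, HasDerivWithinAt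
      (fun s => fderiv ℝ τ (g s) ((w, 0) : FolModel p q))
      (fderiv ℝ (fderiv ℝ τ) (g s) ((w, 0) : FolModel p q) ((w, 0) : FolModel p q))
      (Icc 0 1) s := by
    intro s hsI
    have h1 := ((hs.contDiffAt (hD.mem_nhds (hB (hg s hsI)).2)).fderiv_right (m := ∞)
      le_rfl).differentiableAt (by simp)
    have h2 := (h1.hasFDerivAt.comp_hasDerivWithinAt s (hgd s)).clm_apply
      (hasDerivWithinAt_const s _ ((w, 0) : FolModel p q))
    simpa using h2
  have hsnd : ∀ s ∈ Icc (0 : ℝ) 1, (fderiv ℝ τ (g s) ((w, 0) : FolModel p q)).2 = 0 := fun s hsI =>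
    F.fderiv_transition_snd_eq_zero hφ hψ (hB (hg s hsI)).2.1 (hB (hg s hsI)).2.2 w
  have hfst : ∀ {f : ℝ → FolModel p q} {f' : FolModel p q} {s : ℝ},
      HasDerivWithinAt f f' (Icc 0 1) s →
      HasDerivWithinAt (fun s => (f s).1) f'.1 (Icc 0 1) s ∧
      HasDerivWithinAt (fun s => (f s).2) f'.2 (Icc 0 1) s := fun h =>
    ⟨(ContinuousLinearMap.fst ℝ (EuclideanSpace ℝ (Fin p))
      (EuclideanSpace ℝ (Fin q))).hasFDerivAt.comp_hasDerivWithinAt _ h,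
      (ContinuousLinearMap.snd ℝ (EuclideanSpace ℝ (Fin p))
      (EuclideanSpace ℝ (Fin q))).hasFDerivAt.comp_hasDerivWithinAt _ h⟩
  have hconst : ∀ s ∈ Icc (0 : ℝ) 1, (τ (g s)).2 = (τ (g 0)).2 := by
    refine constant_of_derivWithin_zero
      (fun s hsI => (hfst (hτd s hsI)).2.differentiableWithinAt) fun s hsI => ?_
    rw [((hfst (hτd s (Ico_subset_Icc_self hsI))).2.derivWithin
      (uniqueDiffOn_Icc one_pos s (Ico_subset_Icc_self hsI)))]
    exact hsnd s (Ico_subset_Icc_self hsI)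
  have hg0 : g 0 = (u₀, t) := by simp [g]
  have hg1 : g 1 = (u₁, t) := by simp [g, hw]
  have hends : ∀ s : ℝ, g s ∈ ψ.target ∩ ψ.symm ⁻¹' (φ.source ∩ φ ⁻¹' Metric.ball (φ x) r) →
      ‖(τ (g s)).1 - (φ x).1‖ < r := by
    intro s h
    have h1 : τ (g s) ∈ Metric.ball (φ x) r := h.2.2
    rw [mem_ball_iff_norm] at h1
    exact (norm_fst_le (τ (g s) - φ x)).trans_lt h1
  have hmain := norm_sub_lt_of_acceleration_le (x₀ := (φ x).1) (r := r) (C := C)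
    (fun s hsI => (hfst (hτd s hsI)).1) (fun s hsI => (hfst (hτdd s hsI)).1)
    -- The transverse velocity is zero, so the norm of the full velocity is that of its leaf part.
    (fun s hsI => by
      refine (norm_fst_le _).trans (((hB (hg s hsI)).1.1 _).trans_eq ?_)
      congr 2
      rw [Prod.norm_def, hsnd s hsI, norm_zero, max_eq_left (norm_nonneg _)])
    (fun s hsI => by
      refine le_trans ?_ (hB (hg s hsI)).1.2.le
      gcongr
      exact norm_fst_le (τ (g s) - φ x))
    (hends 0 (by rw [hg0]; exact hu₀)) (hends 1 (by rw [hg1]; exact hu₁))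
  have hbI : b ∈ Icc (0 : ℝ) 1 := ⟨hb, by linarith⟩
  have hgb : g b = (a • u₀ + b • u₁, t) := by
    refine Prod.ext ?_ rfl
    have : a = 1 - b := by linarith
    simp only [g, hw, this]
    module
  have hbD := (hB (hg b hbI)).2
  rw [mem_ofPred_eq, ← hgb]
  refine ⟨hbD.1, hbD.2, ?_⟩
  change τ (g b) ∈ Metric.ball (φ x) r
  rw [mem_ball_iff_norm, Prod.norm_def]
  refine max_lt (hmain b hbI) ?_
  change ‖(τ (g b)).2 - (φ x).2‖ < r
  rw [hconst b hbI, hg0]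
  have h1 : τ (u₀, t) ∈ Metric.ball (φ x) r := hu₀.2.2
  rw [mem_ball_iff_norm] at h1
  exact (norm_snd_le (τ (u₀, t) - φ x)).trans_lt h1

end Foliation

/-! ### Construction of the covering -/

/-- In a paracompact locally compact space there is a locally finite covering by small relatively
compact members of given bases of neighborhoods such that all the members which contain a given
point lie together in one of the sets `O b`, and are adapted to it. -/
theorem exists_locallyFinite_adapted_cover {X : Type u} [TopologicalSpace X] [T2Space X]
    [ParacompactSpace X] [LocallyCompactSpace X] {O : X → Set X} (hO : ∀ b, IsOpen (O b))
    (hbO : ∀ b, b ∈ O b) {V : X → ℝ → Set X} (hVo : ∀ x r, IsOpen (V x r))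
    (hxV : ∀ x r, 0 < r → x ∈ V x r) (hV : ∀ x, ∀ N ∈ 𝓝 x, ∀ᶠ r in 𝓝[>] 0, V x r ⊆ N)
    {A : X → ℝ → Prop} (hA : ∀ x, ∀ᶠ r in 𝓝[>] 0, A x r)
    {Q : X → X → ℝ → Prop} (hQ : ∀ b, ∀ x ∈ O b, ∀ᶠ r in 𝓝[>] 0, Q b x r) :
    ∃ (Λ : Type u) (c : Λ → X) (ρ : Λ → ℝ), (∀ l, A (c l) (ρ l)) ∧
      (∀ x, ∃ l, x ∈ V (c l) (ρ l)) ∧ LocallyFinite (fun l => V (c l) (ρ l)) ∧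
      (∀ l, IsCompact (closure (V (c l) (ρ l)))) ∧
      ∀ y, ∃ b, ∀ l, y ∈ V (c l) (ρ l) → V (c l) (ρ l) ⊆ O b ∧ Q b (c l) (ρ l) := by
  classical
  choose K hK using fun b : X => exists_compact_mem_nhds b
  obtain ⟨W, hWo, hWc, hWf, hWs⟩ := precise_refinement (fun b => O b ∩ interior (K b))
    (fun b => (hO b).inter isOpen_interior)
    (iUnion_eq_univ_iff.2 fun b => ⟨b, hbO b, mem_interior_iff_mem_nhds.2 (hK b).2⟩)
  have hWcpt : ∀ b, IsCompact (closure (W b)) := fun b =>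
    (hK b).1.closure_of_subset ((hWs b).trans (inter_subset_right.trans interior_subset))
  -- A shrinking with `closure (W' b) ⊆ W b`. The sets `W' b` locate points, while the larger `W b`
  -- leave room for the members around them.
  obtain ⟨W', hW'c, hW'o, hW's⟩ := exists_iUnion_eq_closure_subset hWo hWf.point_finite hWc
  have hW'f : LocallyFinite fun b => closure (W' b) :=
    hWf.subset fun b => hW's b
  -- A single radius handles all `b`: near `x` only finitely many `closure (W' b)` matter, by local
  -- finiteness. The dichotomy ensures that a member meeting `W' b` has its centre in `closure (W'
  -- b)`.
  have hchoose : ∀ x, ∃ r, 0 < r ∧ A x r ∧ ∀ b, (x ∈ closure (W' b) → V x r ⊆ W b ∧ Q b x r) ∧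
      (x ∉ closure (W' b) → Disjoint (V x r) (W' b)) := by
    intro x
    obtain ⟨N, hN, hNf⟩ := hW'f x
    have h1 : ∀ᶠ r in 𝓝[>] (0 : ℝ), ∀ b ∈ {b | (closure (W' b) ∩ N).Nonempty},
        (x ∈ closure (W' b) → V x r ⊆ W b ∧ Q b x r) ∧
        (x ∉ closure (W' b) → Disjoint (V x r) (W' b)) := by
      refine (eventually_all_finite hNf).2 fun b _ => ?_
      by_cases hb : x ∈ closure (W' b)
      · have hxW := hW's b hb
        filter_upwards [hV x _ ((hWo b).mem_nhds hxW), hQ b x (hWs b hxW).1] with r hr1 hr2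
        exact ⟨fun _ => ⟨hr1, hr2⟩, fun h => absurd hb h⟩
      · filter_upwards [hV x _ (isClosed_closure.isOpen_compl.mem_nhds hb)] with r hr
        exact ⟨fun h => absurd h hb, fun _ => disjoint_left.2 fun z hz hz' =>
          hr hz (subset_closure hz')⟩
    obtain ⟨r, hr1, hr2, hr3, hr4⟩ :=
      (h1.and ((hV x N hN).and ((hA x).and self_mem_nhdsWithin))).exists
    refine ⟨r, hr4, hr3, fun b => ?_⟩
    by_cases hb : (closure (W' b) ∩ N).Nonempty
    · exact hr1 b hb
    · refine ⟨fun h => absurd ⟨x, h, mem_of_mem_nhds hN⟩ hb, fun _ => disjoint_left.2 ?_⟩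
      exact fun z hz hz' => hb ⟨z, subset_closure hz', hr2 hz⟩
  choose ρ hρ0 hρA hρ using hchoose
  have hfin : ∀ b, ∃ T : Finset X, (∀ x ∈ T, x ∈ closure (W' b)) ∧
      closure (W' b) ⊆ ⋃ x ∈ T, V x (ρ x) := by
    intro b
    obtain ⟨T, hT1, hT2⟩ := ((hWcpt b).of_isClosed_subset isClosed_closure
      ((hW's b).trans subset_closure)).elim_nhds_subcover (fun x => V x (ρ x))
      fun x _ => (hVo x _).mem_nhds (hxV x _ (hρ0 x))
    exact ⟨T, hT1, hT2⟩
  choose T hT1 hT2 using hfin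
  have hsub : ∀ l : Σ b : X, T b, V l.2 (ρ l.2) ⊆ W l.1 := fun l =>
    ((hρ l.2 l.1).1 (hT1 l.1 l.2 l.2.2)).1
  refine ⟨Σ b : X, T b, fun l => l.2, fun l => ρ l.2, fun l => hρA _, fun x => ?_, fun x => ?_,
    fun l => (hWcpt l.1).of_isClosed_subset isClosed_closure (closure_mono (hsub l)),
    fun y => ?_⟩
  · obtain ⟨b, hb⟩ := iUnion_eq_univ_iff.1 hW'c x
    obtain ⟨z, hz, hxz⟩ := mem_iUnion₂.1 (hT2 b (subset_closure hb))
    exact ⟨⟨b, z, hz⟩, hxz⟩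
  -- A member with index over `b` lies in `W b`, and there are finitely many of them for each `b`.
  · obtain ⟨N, hN, hNf⟩ := hWf x
    refine ⟨N, hN, (hNf.preimage' (f := Sigma.fst) fun b _ => ?_).subset fun l hl =>
      hl.mono (inter_subset_inter_left _ (hsub l))⟩
    refine (finite_range (fun z : T b => (⟨b, z⟩ : Σ b : X, T b))).subset ?_
    rintro ⟨b', z⟩ rfl
    exact ⟨z, rfl⟩
  -- Any `b` with `y ∈ W' b` works: a member containing `y` meets `W' b`, so it is contained in `W
  -- b`, hence in `O b`.
  · obtain ⟨b, hb⟩ := iUnion_eq_univ_iff.1 hW'c y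
    refine ⟨b, fun l hl => ?_⟩
    have hx : (l.2 : X) ∈ closure (W' b) := by
      by_contra h
      exact disjoint_left.1 ((hρ l.2 b).2 h) hl hb
    have h1 := (hρ l.2 b).1 hx
    exact ⟨h1.1.trans ((hWs b).trans inter_subset_left), h1.2⟩

theorem TopologicalSpace.Opens.mem_finset_inf_iff {X ι : Type*} [TopologicalSpace X]
    {S : Finset ι} {V : ι → Opens X}
    {x : X} : x ∈ S.inf V ↔ ∀ l ∈ S, x ∈ V l := by
  rw [← SetLike.mem_coe, Opens.coe_finset_inf, Finset.inf_set_eq_iInter]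
  simp

/-! ### Plaques of boxes and of their finite intersections. -/

namespace Foliation

variable {p q : ℕ} {M : Type u} [TopologicalSpace M]
  [ChartedSpace (EuclideanSpace ℝ (Fin (p + q))) M]

/-- Compatibility is local, so it survives restriction; maximality of the atlas then applies. -/
theorem restrOpen_mem_charts (F : Foliation p q M) {φ : OpenPartialHomeomorph M (FolModel p q)}
    (hφ : φ ∈ F.charts) {s : Set M} (hs : IsOpen s) : φ.restrOpen s hs ∈ F.charts := by
  refine F.maximal _ ⟨(F.smooth φ hφ).1.mono inter_subset_left,
    (F.smooth φ hφ).2.mono inter_subset_left⟩ fun ψ hψ => ⟨fun x hx => ?_, fun x hx => ?_⟩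
  · exact F.compatible ψ hψ φ hφ x ⟨hx.1, hx.2.1⟩
  · exact F.compatible φ hφ ψ hψ x ⟨hx.1.1, hx.2⟩

/-- Along a path in one slice of a distinguished chart, the transverse coordinates of every other
distinguished chart are constant. -/
theorem transverse_eq_of_transverse_eq (F : Foliation p q M)
    {φ ψ : OpenPartialHomeomorph M (FolModel p q)} (hφ : φ ∈ F.charts) (hψ : ψ ∈ F.charts)
    {γ : ℝ → M} (hγ : ContinuousOn γ (Icc 0 1))
    (hmem : ∀ s ∈ Icc (0 : ℝ) 1, γ s ∈ φ.source ∩ ψ.source) {t : EuclideanSpace ℝ (Fin q)}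
    (ht : ∀ s ∈ Icc (0 : ℝ) 1, (φ (γ s)).2 = t) :
    ∀ s ∈ Icc (0 : ℝ) 1, (ψ (γ s)).2 = (ψ (γ 0)).2 := by
  have hloc : IsLocallyConstant fun s : unitInterval => (ψ (γ s)).2 := by
    refine (IsLocallyConstant.iff_eventually_eq _).2 fun s => ?_
    obtain ⟨U, hU, h, hh⟩ := F.compatible φ hφ ψ hψ _ (hmem s s.2)
    have hc : Continuous fun s : unitInterval => γ s := continuousOn_iff_continuous_domRestrict.1 hγ
    filter_upwards [hc.continuousAt.eventually hU] with s' hs'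
    rw [hh _ hs', hh _ (mem_of_mem_nhds hU), ht s' s'.2, ht s s.2]
  intro s hs
  exact hloc.apply_eq_of_preconnectedSpace (⟨s, hs⟩ : unitInterval) 0

theorem IsLeafwisePath.transverse_eq {F : Foliation p q M}
    {φ : OpenPartialHomeomorph M (FolModel p q)} (hφ : φ ∈ F.charts) {x y : M} {γ : Path x y}
    (hγ : F.IsLeafwisePath γ) (hmem : ∀ s, γ s ∈ φ.source) : (φ y).2 = (φ x).2 := by
  have hloc : IsLocallyConstant fun s : unitInterval => (φ (γ s)).2 :=
    (IsLocallyConstant.iff_eventually_eq _).2 fun s => hγ φ hφ s (hmem s)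
  simpa using hloc.apply_eq_of_preconnectedSpace 1 0

/-- In an open set whose slices in a distinguished chart are convex, the plaques are these
slices. -/
theorem plaque_eq (F : Foliation p q M) {φ : OpenPartialHomeomorph M (FolModel p q)}
    (hφ : φ ∈ F.charts) {V : Opens M} (hV : (V : Set M) ⊆ φ.source)
    (hconv : ∀ t : EuclideanSpace ℝ (Fin q), Convex ℝ {a : EuclideanSpace ℝ (Fin p) |
      ((a, t) : FolModel p q) ∈ φ.target ∩ φ.symm ⁻¹' (V : Set M)}) {y : M} (hy : y ∈ V) :
    F.plaque V y = {z | z ∈ V ∧ (φ z).2 = (φ y).2} := by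
  ext z
  constructor
  · rintro ⟨γ, hγV, hγ⟩
    refine ⟨?_, hγ.transverse_eq hφ fun s => hV (hγV s)⟩
    simpa using hγV 1
  · rintro ⟨hz, hzy⟩
    set t := (φ y).2 with ht
    have hmem : ∀ {x : M}, x ∈ V → (φ x).2 = t → ((φ x).1, t) ∈
        φ.target ∩ φ.symm ⁻¹' (V : Set M) := by
      intro x hx hxt
      rw [← hxt]
      refine ⟨φ.map_source (hV hx), ?_⟩
      rw [mem_preimage, φ.left_inv (hV hx)]
      exact hx
    let u : unitInterval → EuclideanSpace ℝ (Fin p) := fun s =>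
      (1 - (s : ℝ)) • (φ y).1 + (s : ℝ) • (φ z).1
    have hu : ∀ s, ((u s, t) : FolModel p q) ∈ φ.target ∩ φ.symm ⁻¹' (V : Set M) := fun s =>
      hconv t (hmem hy rfl) (hmem hz hzy) (sub_nonneg.2 s.2.2) s.2.1 (by ring)
    have huc : Continuous u := by fun_prop
    have hc : Continuous fun s => φ.symm ((u s, t) : FolModel p q) := by
      refine φ.continuousOn_symm.comp_continuous (by fun_prop) fun s => (hu s).1
    refine ⟨⟨⟨_, hc⟩, ?_, ?_⟩, fun s => (hu s).2, ?_⟩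
    · simp only [u, Icc.coe_zero, sub_zero, one_smul, zero_smul, add_zero]
      exact φ.left_inv (hV hy)
    · simp only [u, Icc.coe_one, sub_self, one_smul, zero_smul, zero_add]
      rw [← hzy]
      exact φ.left_inv (hV hz)
    · intro ψ hψ s hs
      have h1 := F.eventually_transverse_eq hψ hφ (hu s).1 hs
      exact huc.continuousAt.eventually h1

theorem convex_slices_finset_inf {M : Type*} [TopologicalSpace M]
    {φ : OpenPartialHomeomorph M (FolModel p q)} {ι : Type*}
    {S : Finset ι} (hS : S.Nonempty) {V : ι → Opens M} {t : EuclideanSpace ℝ (Fin q)}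
    (hconv : ∀ l ∈ S, Convex ℝ {a : EuclideanSpace ℝ (Fin p) |
      ((a, t) : FolModel p q) ∈ φ.target ∩ φ.symm ⁻¹' (V l : Set M)}) :
    Convex ℝ {a : EuclideanSpace ℝ (Fin p) |
      ((a, t) : FolModel p q) ∈ φ.target ∩ φ.symm ⁻¹' ((S.inf V : Opens M) : Set M)} := by
  have h : {a : EuclideanSpace ℝ (Fin p) |
      ((a, t) : FolModel p q) ∈ φ.target ∩ φ.symm ⁻¹' ((S.inf V : Opens M) : Set M)} =
      ⋂ l ∈ S, {a : EuclideanSpace ℝ (Fin p) |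
        ((a, t) : FolModel p q) ∈ φ.target ∩ φ.symm ⁻¹' (V l : Set M)} := by
    ext a
    obtain ⟨l₀, hl₀⟩ := hS
    simp only [mem_ofPred_eq, mem_inter_iff, mem_preimage, mem_iInter, SetLike.mem_coe,
      Opens.mem_finset_inf_iff]
    exact ⟨fun h l hl => ⟨h.1, h.2 l hl⟩, fun h => ⟨(h l₀ hl₀).1, fun l hl => (h l hl).2⟩⟩
  rw [h]
  exact convex_iInter₂ hconv

variable [IsManifold (𝓡 (p + q)) ∞ M]
  {cov : CovariantDerivative (𝓡 (p + q)) (EuclideanSpace ℝ (Fin (p + q)))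
      (TangentSpace (𝓡 (p + q)) : M → Type _)}

/-- Finite intersections of sets with geodesically convex slices have geodesically convex plaques,
provided that they lie in a common chart domain with geodesically convex slices. -/
theorem isGeodesicallyConvex_plaque (F : Foliation p q M)
    {φ : OpenPartialHomeomorph M (FolModel p q)} (hφ : φ ∈ F.charts) {O : Set M}
    (hO : O ⊆ φ.source) (hOconv : ∀ t, IsGeodesicallyConvex cov {y | y ∈ O ∧ (φ y).2 = t})
    {ι : Type*} {S : Finset ι} (hS : S.Nonempty) {V : ι → Opens M}
    {ψ : ι → OpenPartialHomeomorph M (FolModel p q)} (hψ : ∀ l ∈ S, ψ l ∈ F.charts)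
    (hVψ : ∀ l ∈ S, (V l : Set M) ⊆ (ψ l).source)
    (hVconv : ∀ l ∈ S, ∀ t, IsGeodesicallyConvex cov {y | y ∈ V l ∧ (ψ l y).2 = t})
    (hVO : ∀ l ∈ S, (V l : Set M) ⊆ O)
    (hconv : ∀ l ∈ S, ∀ t : EuclideanSpace ℝ (Fin q), Convex ℝ {a : EuclideanSpace ℝ (Fin p) |
      ((a, t) : FolModel p q) ∈ φ.target ∩ φ.symm ⁻¹' (V l : Set M)})
    {y : M} (hy : y ∈ S.inf V) : IsGeodesicallyConvex cov (F.plaque (S.inf V) y) := by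
  have hSl : ∀ l ∈ S, ((S.inf V : Opens M) : Set M) ⊆ V l := fun l hl z hz =>
    Opens.mem_finset_inf_iff.1 hz l hl
  obtain ⟨l₀, hl₀⟩ := hS
  have hplaque := F.plaque_eq hφ (V := S.inf V) (((hSl l₀ hl₀).trans (hVO l₀ hl₀)).trans hO)
    (fun t => convex_slices_finset_inf ⟨l₀, hl₀⟩ fun l hl => hconv l hl t) hy
  have hcontγ : ∀ {γ : ℝ → M}, IsGeodesicSegment cov γ → ContinuousOn γ (Icc 0 1) := fun h =>
    h.1.continuousOn
  intro a ha b hb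
  have ha' := ha
  have hb' := hb
  rw [hplaque] at ha' hb'
  set t := (φ y).2 with ht
  -- The geodesic of the larger set `O` is the candidate; it remains to show that it lies in every
  -- `V l`.
  obtain ⟨γ, hγ, huniq⟩ := hOconv t a ⟨hVO l₀ hl₀ (hSl l₀ hl₀ ha'.1), ha'.2⟩ b
    ⟨hVO l₀ hl₀ (hSl l₀ hl₀ hb'.1), hb'.2⟩
  have hγV : ∀ l ∈ S, ∀ s ∈ Icc (0 : ℝ) 1, γ s ∈ V l := by
    intro l hl
    have hsl : ∀ z ∈ F.plaque (S.inf V) y, (ψ l z).2 = (ψ l y).2 := by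
      rintro z ⟨δ, hδV, hδ⟩
      exact hδ.transverse_eq (hψ l hl) fun s => hVψ l hl (hSl l hl (hδV s))
    obtain ⟨γl, hγl, -⟩ := hVconv l hl (ψ l y).2 a ⟨hSl l hl ha'.1, hsl a ha⟩ b
      ⟨hSl l hl hb'.1, hsl b hb⟩
    -- The geodesic found in `V l` runs in a slice of `ψ l`, hence in a single slice of `φ`. It
    -- therefore competes in the uniqueness statement for `O` and equals `γ`.
    have h1 := F.transverse_eq_of_transverse_eq (hψ l hl) hφ (hcontγ hγl.1)
      (fun s hs => ⟨hVψ l hl (hγl.2.2.2 s hs).1, hO (hVO l hl (hγl.2.2.2 s hs).1)⟩)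
      fun s hs => (hγl.2.2.2 s hs).2
    have h2 := huniq γl ⟨hγl.1, hγl.2.1, hγl.2.2.1, fun s hs => ⟨hVO l hl (hγl.2.2.2 s hs).1, by
      rw [h1 s hs, hγl.2.1, ha'.2]⟩⟩
    intro s hs
    rw [← h2 hs]
    exact (hγl.2.2.2 s hs).1
  refine ⟨γ, ⟨hγ.1, hγ.2.1, hγ.2.2.1, fun s hs => ?_⟩, fun γ' hγ' => huniq γ' ?_⟩
  · rw [hplaque]
    exact ⟨Opens.mem_finset_inf_iff.2 fun l hl => hγV l hl s hs, (hγ.2.2.2 s hs).2⟩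
  · refine ⟨hγ'.1, hγ'.2.1, hγ'.2.2.1, fun s hs => ?_⟩
    have h3 := hγ'.2.2.2 s hs
    rw [hplaque] at h3
    exact ⟨hVO l₀ hl₀ (hSl l₀ hl₀ h3.1), h3.2⟩

end Foliation

/-! ### Assembling the covering. -/

theorem eventually_nhdsGT_zero_of_forall_le {P : ℝ → Prop} {r₀ : ℝ} (hr₀ : 0 < r₀)
    (h : ∀ r > 0, r ≤ r₀ → P r) : ∀ᶠ r in 𝓝[>] (0 : ℝ), P r := by
  filter_upwards [Ioc_mem_nhdsGT hr₀] with r hr using h r hr.1 hr.2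

/-- Every point receives one of the given charts and a box of adjustable radius in it. Geodesic
convexity of a box's own slices and affine convexity of those slices in a neighbouring chart hold
for all small radii, and the covering lemma satisfies both requirements simultaneously. -/
theorem lemma2 {p q : ℕ} {M : Type u} [TopologicalSpace M] [T2Space M] [ParacompactSpace M]
    [ChartedSpace (EuclideanSpace ℝ (Fin (p + q))) M] [IsManifold (𝓡 (p + q)) ∞ M]
    (F : Foliation p q M)
    (cov : CovariantDerivative (𝓡 (p + q)) (EuclideanSpace ℝ (Fin (p + q)))
      (TangentSpace (𝓡 (p + q)) : M → Type _))
    (hsmooth : CovariantDerivative.ContMDiffCovariantDerivative cov ∞)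
    (htorsion : cov.torsion = 0) (hadapted : F.IsAdapted cov)
    {ι : Type*} (φ : ι → OpenPartialHomeomorph M (FolModel p q))
    (hφ : ∀ i, φ i ∈ F.charts) (hcover : ∀ x : M, ∃ i, x ∈ (φ i).source) :
    ∃ (Λ : Type u) (ψ : Λ → OpenPartialHomeomorph M (FolModel p q)),
      (∀ l, ψ l ∈ F.charts) ∧
      (∀ l, ∃ i, (ψ l).source ⊆ (φ i).source ∧ EqOn (ψ l) (φ i) (ψ l).source) ∧
      (∀ l, IsCompact (closure (ψ l).source)) ∧
      F.IsGoodCovering (fun l => chartDomain (ψ l)) ∧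
      (∀ S : Finset Λ, S.Nonempty → ∀ y ∈ S.inf (fun l => chartDomain (ψ l)),
        IsGeodesicallyConvex cov (F.plaque (S.inf fun l => chartDomain (ψ l)) y)) := by
  have : LocallyCompactSpace M := Manifold.locallyCompact_of_finiteDimensional (𝓡 (p + q))
  choose i hi using hcover
  let box : M → ℝ → Set M := fun x r => (φ (i x)).source ∩ φ (i x) ⁻¹' Metric.ball (φ (i x) x) r
  have hboxo : ∀ x r, IsOpen (box x r) := fun x r =>
    (φ (i x)).isOpen_inter_preimage Metric.isOpen_ball
  have hxbox : ∀ x r, 0 < r → x ∈ box x r := fun x r hr => ⟨hi x, Metric.mem_ball_self hr⟩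
  have hgeo : ∀ x, ∀ᶠ r in 𝓝[>] (0 : ℝ), ∀ t,
      IsGeodesicallyConvex cov {y | y ∈ box x r ∧ (φ (i x) y).2 = t} := by
    intro x
    obtain ⟨r₀, hr₀, h⟩ := exists_radius_isGeodesicallyConvex_slab hsmooth hadapted
      (hφ (i x)) (hi x)
    refine eventually_nhdsGT_zero_of_forall_le hr₀ fun r hr hrr t => ?_
    convert h r hr hrr t using 1
    ext y
    exact and_assoc
  -- The larger boxes `box b (R b)` are fixed beforehand; they are the common ambient sets in which
  -- all members through a point are compared.
  choose R hR0 hR using fun b => ((hgeo b).and self_mem_nhdsWithin).exists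
  obtain ⟨Λ, c, ρ, hA, hcov, hlf, hcpt, hadapt⟩ := exists_locallyFinite_adapted_cover
    (O := fun b => box b (R b)) (fun b => hboxo b _) (fun b => hxbox b _ (hR b)) hboxo hxbox
    (fun x N hN => by
      obtain ⟨r₀, hr₀, -, h⟩ := (φ (i x)).exists_radius_preimage_ball_subset (hi x) hN
      exact eventually_nhdsGT_zero_of_forall_le hr₀ fun r _ hrr =>
        (inter_subset_inter_right _ (preimage_mono (Metric.ball_subset_ball hrr))).trans h)
    hgeo
    (Q := fun b x r => ∀ t : EuclideanSpace ℝ (Fin q), Convex ℝ {u : EuclideanSpace ℝ (Fin p) |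
      ((u, t) : FolModel p q) ∈ (φ (i b)).target ∩ (φ (i b)).symm ⁻¹' box x r})
    (fun b x hx => by
      obtain ⟨r₀, hr₀, h⟩ := F.exists_radius_convex_slices (hφ (i x)) (hφ (i b)) (hi x) hx.1
      exact eventually_nhdsGT_zero_of_forall_le hr₀ h)
  let ψ : Λ → OpenPartialHomeomorph M (FolModel p q) := fun l =>
    (φ (i (c l))).restrOpen (box (c l) (ρ l)) (hboxo _ _)
  have hψ : ∀ l, ψ l ∈ F.charts := fun l => F.restrOpen_mem_charts (hφ _) (hboxo _ _)
  have hψs : ∀ l, (ψ l).source = box (c l) (ρ l) := fun l =>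
    inter_eq_right.2 inter_subset_left
  have hdom : ∀ l, (chartDomain (ψ l) : Set M) = box (c l) (ρ l) := hψs
  have hcommon : ∀ y, ∃ b, ∀ l, y ∈ chartDomain (ψ l) →
      (chartDomain (ψ l) : Set M) ⊆ box b (R b) ∧ ∀ t : EuclideanSpace ℝ (Fin q),
        Convex ℝ {u : EuclideanSpace ℝ (Fin p) | ((u, t) : FolModel p q) ∈
          (φ (i b)).target ∩ (φ (i b)).symm ⁻¹' (chartDomain (ψ l) : Set M)} := by
    intro y
    obtain ⟨b, hb⟩ := hadapt y
    refine ⟨b, fun l hl => ?_⟩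
    rw [← SetLike.mem_coe, hdom] at hl
    rw [hdom]
    exact hb l hl
  refine ⟨Λ, ψ, hψ, fun l => ⟨i (c l), inter_subset_left, fun _ _ => rfl⟩, fun l => ?_,
    ⟨fun x => ?_, ?_, ?_⟩, ?_⟩
  · rw [hψs]
    exact hcpt l
  · obtain ⟨l, hl⟩ := hcov x
    exact ⟨l, by rw [← SetLike.mem_coe, hdom]; exact hl⟩
  · simpa only [hdom] using hlf
  · intro S hS k hk
    by_cases hne : ∃ y, y ∈ S.inf fun l => chartDomain (ψ l)
    · obtain ⟨y, hy⟩ := hne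
      obtain ⟨b, hb⟩ := hcommon y
      have hb' := fun l (hl : l ∈ S) => hb l (Opens.mem_finset_inf_iff.1 hy l hl)
      obtain ⟨l₀, hl₀⟩ := hS
      refine Foliation.LeafwiseCohomology.subsingleton_of_convex_slices F (hφ (i b)) ?_
        (fun t => Foliation.convex_slices_finset_inf ⟨l₀, hl₀⟩ fun l hl => (hb' l hl).2 t) hk
      exact fun z hz => ((hb' l₀ hl₀).1 (Opens.mem_finset_inf_iff.1 hz l₀ hl₀)).1
    -- An empty intersection has no point that selects a common chart, but its slices in any chart
    -- are empty and hence convex.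
    · obtain ⟨l₀, hl₀⟩ := hS
      push Not at hne
      refine Foliation.LeafwiseCohomology.subsingleton_of_convex_slices F (hψ l₀)
        (fun z hz => absurd hz (hne z)) (fun t => ?_) hk
      convert convex_empty (𝕜 := ℝ) (E := EuclideanSpace ℝ (Fin p))
      exact eq_empty_of_forall_notMem fun a ha => hne _ ha.2
  · intro S hS y hy
    obtain ⟨b, hb⟩ := hcommon y
    have hb' := fun l (hl : l ∈ S) => hb l (Opens.mem_finset_inf_iff.1 hy l hl)
    refine F.isGeodesicallyConvex_plaque (hφ (i b)) (O := box b (R b)) inter_subset_left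
      (hR0 b) hS (ψ := ψ) (fun l _ => hψ l) (fun l _ => subset_rfl) (fun l _ t => ?_)
      (fun l hl => (hb' l hl).1) (fun l hl => (hb' l hl).2) hy
    convert hA l t using 3
    rw [← SetLike.mem_coe, hdom]
    rfl
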